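/- Let $\mathcal M$ be a real ellipse and $\mathcal{NH}$ a hyperbola in the affine plane $\mathbb R^2$, given by $XMX^t=0$ and $XNX^t=0$, where $X=(x,y,1)$ and $M=(a_{ij})$, $N=(b_{ij})$ are real symmetric $3\times 3$ matrices. Let $M_2,N_2$ be the upper left $2\times2$ blocks of $M,N$, and put $T_1=\det M_2$, $T_2=\det N_2$, $T=T_1\operatorname{tr}(M_2^{-1}N_2)$, $L_0=\det N$, $L_1=L_0\operatorname{tr}(N^{-1}M)$, $L_3=\det M$, $L_2=L_3\operatorname{tr}(M^{-1}N)$, so that $$F(\lambda)=\det(\lambda N+M)=L_0\lambda^3+L_1\lambda^2+L_2\lambda+L_3 .$$ The matrices are normalised so that $a_{11}>0$, $a_{22}>0$, $T_1>0$, $L_3<0$ (real ellipse) and $T_2<0$, $L_0<0$ (hyperbola). Let $$\Delta=-27L_0^2L_3^2+18L_0L_1L_2L_3+L_1^2L_2^2-4L_1^3L_3-4L_0L_2^3,\qquad \Delta'=4L_1^2-12L_0L_2$$ be the discriminants of $F$ and $F'$, let $$H_0=\frac{T+\sqrt{T^2-4T_1T_2}}{2T_1},\quad H_2=\frac{T-\sqrt{T^2-4T_1T_2}}{2T_1},\quad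 H_5=\frac{L_0}{T_2},$$ $$J_5=-3L_0+L_1H_0,\quad J_4=3L_0-2L_1H_0+L_2H_0^2,\quad J_3=-L_0+L_1H_0-L_2H_0^2+L_3H_0^3,$$ $$J_1=\sqrt{\frac{L_3H_5}{H_2T_1}}-H_5\,\frac{H_0L_1-L_0}{2H_0L_0},$$ $$K_5=-\frac{3L_0}{H_2}+L_1,\quad K_4=3L_0-2H_2L_1+H_2^2L_2,\quad K_3=L_0-L_1H_2+L_2H_2^2-L_3H_2^3 ,$$ and let $\mathbf{Var}$ be the number of sign changes of a finite sequence of reals after dropping zeros, with $\mathbf{Var}(F)=\mathbf{Var}(L_0,L_1,L_2,L_3)$. A common point of $\mathcal M$ and $\mathcal{NH}$ is a *tangent point* if both curves have the same tangent line there; it is an *inner* (*outer*) tangent point if near it the two curves lie on the same side (on opposite sides) of that line. In the list below a *point of intersection* is a common point that is not a tangent point, and each of items 2-9 and 11 describes all the common points of the two curves. $\mathcal M$ and $\mathcal{NH}$ are *separated* if the closed region $XMX^t\le0$ bounded by the ellipse and the closed region $XNX^t\le0$ (the two closed convex regions bounded by the branches of the hyperbola) are disjoint; $\mathcal M$ is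 *inside* $\mathcal{NH}$ if the region $XMX^t\le 0$ is contained in the open region $XNX^t<0$. Then: 1. $\mathcal{NH}$ and $\mathcal M$ are separated iff $\Delta>0$, $\mathbf{Var}(F)=2$ and $\mathbf{Var}(L_0,K_5,K_4,K_3)=0$. 2. They have only two points of intersection iff $\Delta<0$. 3. They have only an inner tangent point iff either $\Delta=0$, $\mathbf{Var}(F)=0$, $J_3\ne0$ and $\mathbf{Var}(L_0,J_5,J_4,J_3)=2$; or $J_3=J_4=J_5=0$; or $J_1=0$, $J_3=0$, $J_4\neq0$ and $J_5>0$. 4. They have only two inner tangent points iff $J_3=0$, $J_4=0$ and $J_5<0$. 5. They have two points of intersection and an inner tangent point iff either $\Delta=0$, $\Delta'\ne0$, $\mathbf{Var}(L_0,J_5,J_4,J_3)=0$ and $J_3\neq0$; or $\Delta=0$, $\mathbf{Var}(L_0,J_5,J_4)=0$, $J_3=0$, $J_5<0$ and $J_1=0$. 6. They have only one outer tangent point iff $\Delta=0$, $\mathbf{Var}(F)=2$, $\mathbf{Var}(L_0,K_5,K_4,K_3)=0$ and $K_3\ne0$. 7. They have (only) two outer tangent points iff $K_3=0$ and $K_4=0$.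 8. They have two points of intersection and an outer tangent point iff $\Delta=0$, $\mathbf{Var}(L_0,K_5,K_4,K_3)=2$ and $K_3\ne0$. 9. They have four points of intersection iff either $\Delta>0$ and $\mathbf{Var}(L_0,J_5,J_4,J_3)=0$, or $\Delta>0$ and $\mathbf{Var}(L_0,K_5,K_4,K_3)>0$. 10. $\mathcal M$ is inside $\mathcal{NH}$ iff either $\Delta>0$, $\mathbf{Var}(F)=0$, $J_3\neq0$ and $\mathbf{Var}(L_0,J_5,J_4,J_3)=2$; or $\Delta>0$, $\mathbf{Var}(F)=0$, $J_3=0$, $J_4\ne0$ and $\mathbf{Var}(L_0,J_5,J_4)>0$; or $J_3=0$, $J_4=0$ and $J_5>0$. 11. They have only a point of intersection and an inner tangent point iff $\Delta=0$, $\Delta'=0$, $J_3<0$ and $J_5<0$. -/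

import Mathlib

open Topology

namespace EllipseHyperbola

noncomputable section

/-! ### Affine conics given by symmetric matrices -/

/-- The row vector `(x, y, 1)` of a point of the plane. -/
def hom (p : ℝ × ℝ) : Fin 3 → ℝ := ![p.1, p.2, 1]

/-- The value `(x, y, 1) A (x, y, 1)ᵗ`. -/
def form (A : Matrix (Fin 3) (Fin 3) ℝ) (p : ℝ × ℝ) : ℝ :=
  hom p ⬝ᵥ A.mulVec (hom p)

/-- The polar form of `p` with respect to the conic `A`, evaluated at `q`. -/
def polar (A : Matrix (Fin 3) (Fin 3) ℝ) (p q : ℝ × ℝ) : ℝ :=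
  hom q ⬝ᵥ A.mulVec (hom p)

/-- The real affine conic `(x, y, 1) A (x, y, 1)ᵗ = 0`. -/
def conic (A : Matrix (Fin 3) (Fin 3) ℝ) : Set (ℝ × ℝ) := {p | form A p = 0}

/-- The open region `(x, y, 1) A (x, y, 1)ᵗ < 0`. For an ellipse with positive definite quadratic
part this is its interior; for a hyperbola with `det A < 0` this is the union of the two
convex regions bounded by its branches (the component of the complement that contains the centre
is `(x, y, 1) A (x, y, 1)ᵗ > 0`). -/
def interiorRegion (A : Matrix (Fin 3) (Fin 3) ℝ) : Set (ℝ × ℝ) := {p | form A p < 0}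

/-- The conic together with the region that it bounds. -/
def solid (A : Matrix (Fin 3) (Fin 3) ℝ) : Set (ℝ × ℝ) := {p | form A p ≤ 0}

/-- The tangent line of the (nondegenerate) conic `A` at one of its points `p`. -/
def tangentLine (A : Matrix (Fin 3) (Fin 3) ℝ) (p : ℝ × ℝ) : Set (ℝ × ℝ) :=
  {q | polar A p q = 0}

/-! ### Contact of two conics -/

/-- The common points at which the two conics have the same tangent line. -/
def tangentPoints (M N : Matrix (Fin 3) (Fin 3) ℝ) : Set (ℝ × ℝ) :=
  {p | p ∈ conic M ∧ p ∈ conic N ∧ tangentLine M p = tangentLine N p}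

/-- The common points at which the conics are not tangent: the proper points of intersection. -/
def crossingPoints (M N : Matrix (Fin 3) (Fin 3) ℝ) : Set (ℝ × ℝ) :=
  {p | p ∈ conic M ∧ p ∈ conic N ∧ tangentLine M p ≠ tangentLine N p}

/-- Inner tangent points: the tangent lines agree, and near the point both curves lie on the same
side of the tangent line. (The restriction to a neighbourhood selects the branch of the hyperbola
through the point; the other branch is always on the other side of that line than this one.) -/
def innerTangentPoints (M N : Matrix (Fin 3) (Fin 3) ℝ) : Set (ℝ × ℝ) :=
  {p | p ∈ tangentPoints M N ∧
    ∃ U ∈ 𝓝 p, ∀ q ∈ conic M ∩ U, ∀ r ∈ conic N ∩ U, 0 ≤ polar M p q * polar M p r}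

/-- Outer tangent points: the tangent lines agree, and near the point the two curves lie on opposite
sides of the tangent line. -/
def outerTangentPoints (M N : Matrix (Fin 3) (Fin 3) ℝ) : Set (ℝ × ℝ) :=
  {p | p ∈ tangentPoints M N ∧
    ∃ U ∈ 𝓝 p, ∀ q ∈ conic M ∩ U, ∀ r ∈ conic N ∩ U, polar M p q * polar M p r ≤ 0}

/-! ### Relative positions -/

/-- The common points of the two conics are exactly `c` points of (non-tangential) intersection,
`i` inner tangent points and `o` outer tangent points. -/
def HasContact (M N : Matrix (Fin 3) (Fin 3) ℝ) (c i o : ℕ∞) : Prop :=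
  (crossingPoints M N).encard = c ∧ (innerTangentPoints M N).encard = i ∧
    (outerTangentPoints M N).encard = o ∧
    tangentPoints M N = innerTangentPoints M N ∪ outerTangentPoints M N

/-- The solid ellipse and the two solid convex regions of the hyperbola have no common point. -/
def Separated (M N : Matrix (Fin 3) (Fin 3) ℝ) : Prop := Disjoint (solid M) (solid N)

/-- The solid ellipse lies strictly inside the convex regions bounded by the hyperbola. -/
def Inside (M N : Matrix (Fin 3) (Fin 3) ℝ) : Prop := solid M ⊆ interiorRegion N

/-! ### Sign variations -/

/-- The number of sign changes of a list of reals after dropping zeros. -/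
def signVar (l : List ℝ) : ℕ :=
  (((l.map SignType.sign).filter (· ≠ 0)).destutter (· ≠ ·)).length - 1

/-! ### The characteristic polynomial of the pencil and the derived quantities -/

section Invariants

variable (M N : Matrix (Fin 3) (Fin 3) ℝ)

/-- The upper left `2 × 2` block. -/
def quadPart (A : Matrix (Fin 3) (Fin 3) ℝ) : Matrix (Fin 2) (Fin 2) ℝ :=
  !![A 0 0, A 0 1; A 1 0, A 1 1]

def T₁ : ℝ := (quadPart M).det
def T₂ : ℝ := (quadPart N).det
def T : ℝ := T₁ M * ((quadPart M)⁻¹ * quadPart N).trace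

def L₀ : ℝ := N.det
def L₁ : ℝ := L₀ N * (N⁻¹ * M).trace
def L₃ : ℝ := M.det
def L₂ : ℝ := L₃ M * (M⁻¹ * N).trace

/-- The number of sign variations of the coefficients of `F(λ) = det (λ N + M)`. -/
def varF : ℕ := signVar [L₀ N, L₁ M N, L₂ M N, L₃ M]

/-- The discriminant of `F`. -/
def Δ : ℝ :=
  -27 * L₀ N ^ 2 * L₃ M ^ 2 + 18 * L₀ N * L₁ M N * L₂ M N * L₃ M + L₁ M N ^ 2 * L₂ M N ^ 2
    - 4 * L₁ M N ^ 3 * L₃ M - 4 * L₀ N * L₂ M N ^ 3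

/-- The discriminant of the derivative `F'(λ) = 3 L₀ λ² + 2 L₁ λ + L₂`. -/
def Δ' : ℝ := 4 * L₁ M N ^ 2 - 12 * L₀ N * L₂ M N

def H₀ : ℝ := (T M N + √(T M N ^ 2 - 4 * T₁ M * T₂ N)) / (2 * T₁ M)
def H₂ : ℝ := (T M N - √(T M N ^ 2 - 4 * T₁ M * T₂ N)) / (2 * T₁ M)
def H₅ : ℝ := L₀ N / T₂ N

def J₅ : ℝ := -3 * L₀ N + L₁ M N * H₀ M N
def J₄ : ℝ := 3 * L₀ N - 2 * L₁ M N * H₀ M N + L₂ M N * H₀ M N ^ 2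
def J₃ : ℝ := -L₀ N + L₁ M N * H₀ M N - L₂ M N * H₀ M N ^ 2 + L₃ M * H₀ M N ^ 3
def J₁ : ℝ :=
  √(L₃ M * H₅ N / (H₂ M N * T₁ M)) - H₅ N * ((H₀ M N * L₁ M N - L₀ N) / (2 * H₀ M N * L₀ N))

def K₅ : ℝ := -3 * L₀ N / H₂ M N + L₁ M N
def K₄ : ℝ := 3 * L₀ N - 2 * H₂ M N * L₁ M N + H₂ M N ^ 2 * L₂ M N
def K₃ : ℝ := L₀ N - L₁ M N * H₂ M N + L₂ M N * H₂ M N ^ 2 - L₃ M * H₂ M N ^ 3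

/-- `L₀, L₁, L₂, L₃` are the coefficients of the characteristic polynomial. -/
theorem det_pencil (hM : M.det ≠ 0) (hN : N.det ≠ 0) (t : ℝ) :
    (t • N + M).det = L₀ N * t ^ 3 + L₁ M N * t ^ 2 + L₂ M N * t + L₃ M := by
  have e1 : L₁ M N = (N.adjugate * M).trace := by
    rw [L₁, L₀, Matrix.inv_def, Ring.inverse_eq_inv', Matrix.smul_mul, Matrix.trace_smul,
      smul_eq_mul, mul_inv_cancel_left₀ hN]
  have e2 : L₂ M N = (M.adjugate * N).trace := by
    rw [L₂, L₃, Matrix.inv_def, Ring.inverse_eq_inv', Matrix.smul_mul, Matrix.trace_smul,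
      smul_eq_mul, mul_inv_cancel_left₀ hM]
  rw [e1, e2, L₀, L₃]
  simp only [Matrix.trace_fin_three, Matrix.mul_apply, Fin.sum_univ_three]
  simp only [Matrix.det_fin_three, Matrix.adjugate_fin_three]
  simp
  ring

end Invariants

/-- A real ellipse, given by a symmetric matrix normalised so that its quadratic part is positive
definite. -/
structure IsEllipse (M : Matrix (Fin 3) (Fin 3) ℝ) : Prop where
  symm : M.IsSymm
  a₁₁_pos : 0 < M 0 0
  a₂₂_pos : 0 < M 1 1
  T₁_pos : 0 < T₁ M
  L₃_neg : L₃ M < 0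

/-- A (nondegenerate) hyperbola, given by a symmetric matrix normalised so that its determinant is
negative (replace the matrix by its negative otherwise). -/
structure IsHyperbola (N : Matrix (Fin 3) (Fin 3) ℝ) : Prop where
  symm : N.IsSymm
  T₂_neg : T₂ N < 0
  L₀_neg : L₀ N < 0

end

end EllipseHyperbola

open EllipseHyperbola

/-!
Everything is read off from the pencil of conics `λ N + M` and its determinant `F(λ)`.

A common point of the two conics is a tangent point exactly if it is a singular point of a member
of the pencil (`tangentLine_eq_iff`). There the gradients satisfy `∇M = -λ ∇N`, and since both
determinants are negative, each conic lies locally where its own tangent form is nonpositive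
(`eventually_polar_nonpos`); hence the tangent point is inner for `λ < 0` and outer for `λ > 0`
(`hasContact_iff`). The parameter of a tangent point is a multiple root of `F`
(`double_root_of_isKer`).

An affine change of coordinates, which reduces the quadratic parts simultaneously, turns the ellipse
into the unit circle and the hyperbola into `a x² - b y² + 2 p x + 2 q y + r = 0`, where `a = H₀` and
`b = -H₂` are positive (`exists_normal_form`). The quadratic part of `λ N + M` is then diagonal, with
the entries `1 + λ a` and `1 - λ b`; it degenerates at the two *poles* `-1 / a` and `1 / b`. As `F`
is nonpositive there and negative at `0`, the least root of `F` is at most `-1 / a` if all are real,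
and the two others have the same sign (`roots_poles`, `roots_location`). The geometry depends only on
the position of the roots with respect to the poles.

* A pair of complex roots gives two points of intersection (`encard_commonPts_eq_two`): the complex
  kernel vectors give a basis in which the common points can be computed.
* For three distinct roots there is no tangency. Either the pencil contains a positive definite
  member between the poles, and the conics are separated or one is inside the other
  (`inside_of_roots`, `separated_of_roots`), or the kernel vectors of the three singular members form
  a basis that diagonalises both conics with the signs that give four common points
  (`encard_commonPts_of_kernels`).
* At a multiple root off the poles, the singular member is a pair of real or complex lines through
  its vertex, which is the only tangent point; the lines meet the circle in the other common points,
  and one of them is tangent exactly if the root is triple (`contact_double_definite`,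
  `contact_double_indefinite`, `contact_triple`).
* At a multiple root that is a pole, the singular member is a double line,
  and all common points are tangent points (`contact_neg_pole`, `contact_pos_pole`).

The numbers `J₃, J₄, J₅` and `K₃, K₄, K₅` are, up to nonzero factors, the coefficients of the Taylor
expansions of `F` at the poles `-1 / H₀` and `-1 / H₂`. By Descartes' rule, which is exact for
polynomials with real roots only, the numbers of sign variations count the roots to the right of the
poles (`signVar_roots_zero`, `signVar_roots_one`, `signVar_roots_two`). If `-1 / H₀` is a root, then
`J₁ = 0` says that the two other roots are equal and negative (`RealRoots.J₁_iff`). Each item thus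
becomes a statement on the position of the roots, and can be checked case by case.
-/

namespace EllipseHyperbola

open Matrix

/-! ### Contact of two conics in algebraic terms -/

theorem polar_apply (A : Matrix (Fin 3) (Fin 3) ℝ) (p q : ℝ × ℝ) :
    polar A p q = q.1 * (A 0 0 * p.1 + A 0 1 * p.2 + A 0 2) +
      q.2 * (A 1 0 * p.1 + A 1 1 * p.2 + A 1 2) + (A 2 0 * p.1 + A 2 1 * p.2 + A 2 2) := by
  simp [polar, hom, mulVec, dotProduct, Fin.sum_univ_three]

theorem form_eq_polar (A : Matrix (Fin 3) (Fin 3) ℝ) (p : ℝ × ℝ) : form A p = polar A p p := rfl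

theorem mulVec_hom_eq_zero_iff (A : Matrix (Fin 3) (Fin 3) ℝ) (p : ℝ × ℝ) :
    A *ᵥ hom p = 0 ↔ A 0 0 * p.1 + A 0 1 * p.2 + A 0 2 = 0 ∧
      A 1 0 * p.1 + A 1 1 * p.2 + A 1 2 = 0 ∧ A 2 0 * p.1 + A 2 1 * p.2 + A 2 2 = 0 := by
  rw [funext_iff, Fin.forall_fin_succ, Fin.forall_fin_two]
  simp [hom, mulVec, dotProduct, Fin.sum_univ_three]

theorem hom_ne_zero (p : ℝ × ℝ) : hom p ≠ 0 := fun h => by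
  simpa [hom] using congrFun h 2

theorem mulVec_hom_ne_zero {A : Matrix (Fin 3) (Fin 3) ℝ} (hA : A.det ≠ 0) (p : ℝ × ℝ) :
    A *ᵥ hom p ≠ 0 := fun h =>
  hA (exists_mulVec_eq_zero_iff.1 ⟨hom p, hom_ne_zero p, h⟩)

/-- The gradient of a nondegenerate conic does not vanish at its points. -/
theorem gradient_pos {A : Matrix (Fin 3) (Fin 3) ℝ} (hA : A.det ≠ 0) {p : ℝ × ℝ}
    (hp : form A p = 0) :
    0 < (A 0 0 * p.1 + A 0 1 * p.2 + A 0 2) ^ 2 + (A 1 0 * p.1 + A 1 1 * p.2 + A 1 2) ^ 2 := by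
  by_contra! h
  have h0 : A 0 0 * p.1 + A 0 1 * p.2 + A 0 2 = 0 := by nlinarith
  have h1 : A 1 0 * p.1 + A 1 1 * p.2 + A 1 2 = 0 := by nlinarith
  rw [form_eq_polar, polar_apply, h0, h1] at hp
  exact mulVec_hom_ne_zero hA p ((mulVec_hom_eq_zero_iff A p).2 ⟨h0, h1, by linarith⟩)

theorem symm_entries {A : Matrix (Fin 3) (Fin 3) ℝ} (hA : A.IsSymm) :
    A 1 0 = A 0 1 ∧ A 2 0 = A 0 2 ∧ A 2 1 = A 1 2 :=
  ⟨hA.apply 0 1, hA.apply 0 2, hA.apply 1 2⟩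

/-- The determinant is invariant under translation of the origin to `p`. -/
theorem det_translate {A : Matrix (Fin 3) (Fin 3) ℝ} (hs : A.IsSymm) (p : ℝ × ℝ) {g1 g2 : ℝ}
    (h1 : A 0 0 * p.1 + A 0 1 * p.2 + A 0 2 = g1) (h2 : A 1 0 * p.1 + A 1 1 * p.2 + A 1 2 = g2) :
    A.det = (A 0 0 * A 1 1 - A 0 1 ^ 2) * form A p + 2 * A 0 1 * g1 * g2 - A 1 1 * g1 ^ 2 -
      A 0 0 * g2 ^ 2 := by
  obtain ⟨s1, s2, s3⟩ := symm_entries hs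
  rw [form_eq_polar, polar_apply, det_fin_three, s2, s3]
  rw [s1] at h2 ⊢
  rw [show A 0 2 = g1 - A 0 0 * p.1 - A 0 1 * p.2 by linarith,
    show A 1 2 = g2 - A 0 1 * p.1 - A 1 1 * p.2 by linarith]
  ring

theorem polar_translate {A : Matrix (Fin 3) (Fin 3) ℝ} (p : ℝ × ℝ) {g1 g2 : ℝ}
    (h1 : A 0 0 * p.1 + A 0 1 * p.2 + A 0 2 = g1) (h2 : A 1 0 * p.1 + A 1 1 * p.2 + A 1 2 = g2)
    (r : ℝ × ℝ) : polar A p r = form A p + g1 * (r.1 - p.1) + g2 * (r.2 - p.2) := by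
  rw [form_eq_polar, polar_apply, polar_apply, h1, h2]
  ring

theorem form_translate {A : Matrix (Fin 3) (Fin 3) ℝ} (hs : A.IsSymm) (p : ℝ × ℝ) {g1 g2 : ℝ}
    (h1 : A 0 0 * p.1 + A 0 1 * p.2 + A 0 2 = g1) (h2 : A 1 0 * p.1 + A 1 1 * p.2 + A 1 2 = g2)
    (r : ℝ × ℝ) : form A r = form A p + 2 * (g1 * (r.1 - p.1) + g2 * (r.2 - p.2)) +
      (A 0 0 * (r.1 - p.1) ^ 2 + 2 * A 0 1 * (r.1 - p.1) * (r.2 - p.2) +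
        A 1 1 * (r.2 - p.2) ^ 2) := by
  obtain ⟨s1, s2, s3⟩ := symm_entries hs
  rw [form_eq_polar, form_eq_polar, polar_apply, polar_apply, ← h1, ← h2, s1, s2, s3]
  ring

/-- Near a point `p` of a conic of negative determinant, the conic lies on one side of its tangent
line at `p`. With `w` the gradient at `p`, the Gram matrix of `p, r, w` has determinant
`det A` times a square, which reads `c (2 x y - c z) ≤ 0` for `c = A(p, r)`, `x = A(p, w)`,
`y = A(r, w)`, `z = A(w, w)`; and the bracket is positive near `p`. -/
theorem eventually_polar_nonpos {A : Matrix (Fin 3) (Fin 3) ℝ} (hs : A.IsSymm) (hA : A.det < 0)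
    {p : ℝ × ℝ} (hp : form A p = 0) :
    ∀ᶠ r in 𝓝 p, form A r = 0 → polar A p r ≤ 0 := by
  have hg := gradient_pos hA.ne hp
  obtain ⟨g1, hg1⟩ : ∃ g, A 0 0 * p.1 + A 0 1 * p.2 + A 0 2 = g := ⟨_, rfl⟩
  obtain ⟨g2, hg2⟩ : ∃ g, A 1 0 * p.1 + A 1 1 * p.2 + A 1 2 = g := ⟨_, rfl⟩
  rw [hg1, hg2] at hg
  let z := A 0 0 * g1 ^ 2 + 2 * A 0 1 * g1 * g2 + A 1 1 * g2 ^ 2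
  let y : ℝ × ℝ → ℝ := fun r =>
    (A 0 0 * (r.1 - p.1) + A 0 1 * (r.2 - p.2) + g1) * g1 +
      (A 0 1 * (r.1 - p.1) + A 1 1 * (r.2 - p.2) + g2) * g2
  let c : ℝ × ℝ → ℝ := fun r => g1 * (r.1 - p.1) + g2 * (r.2 - p.2)
  have hcont : Continuous fun r : ℝ × ℝ => 2 * (g1 ^ 2 + g2 ^ 2) * y r - c r * z := by fun_prop
  have hpos : 0 < 2 * (g1 ^ 2 + g2 ^ 2) * y p - c p * z := by
    have e1 : y p = g1 ^ 2 + g2 ^ 2 := by simp only [y]; ring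
    have e2 : c p = 0 := by simp only [c]; ring
    rw [e1, e2, zero_mul, sub_zero]
    positivity
  filter_upwards [hcont.continuousAt.eventually (lt_mem_nhds hpos)] with r hr hr0
  have hdet := det_translate hs p hg1 hg2
  have hform := form_translate hs p hg1 hg2 r
  rw [hp] at hdet hform
  rw [hr0] at hform
  rw [polar_translate p hg1 hg2, hp, zero_add]
  have key : c r * (2 * (g1 ^ 2 + g2 ^ 2) * y r - c r * z) =
      A.det * ((r.1 - p.1) * g2 - (r.2 - p.2) * g1) ^ 2 := by
    rw [hdet]
    simp only [c, y, z]
    linear_combination -(g1 ^ 2 + g2 ^ 2) ^ 2 * hform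
  have hr' : 0 < 2 * (g1 ^ 2 + g2 ^ 2) * y r - c r * z := hr
  change c r ≤ 0
  by_contra! hc
  have h1 := mul_pos hc hr'
  have h2 := mul_nonneg (neg_nonneg.2 hA.le) (sq_nonneg ((r.1 - p.1) * g2 - (r.2 - p.2) * g1))
  linarith

/-- A nondegenerate conic has points off its tangent line at `p` arbitrarily close to `p`: the
second points of intersection with the lines through `p` close to the tangent line. -/
theorem exists_polar_ne_zero {A : Matrix (Fin 3) (Fin 3) ℝ} (hs : A.IsSymm) (hA : A.det ≠ 0)
    {p : ℝ × ℝ} (hp : form A p = 0) {U : Set (ℝ × ℝ)} (hU : U ∈ 𝓝 p) :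
    ∃ q ∈ conic A ∩ U, polar A p q ≠ 0 := by
  have hg := gradient_pos hA hp
  obtain ⟨g1, hg1⟩ : ∃ g, A 0 0 * p.1 + A 0 1 * p.2 + A 0 2 = g := ⟨_, rfl⟩
  obtain ⟨g2, hg2⟩ : ∃ g, A 1 0 * p.1 + A 1 1 * p.2 + A 1 2 = g := ⟨_, rfl⟩
  rw [hg1, hg2] at hg
  let D : ℝ → ℝ := fun ε => A 0 0 * (-g2 + ε * g1) ^ 2 +
    2 * A 0 1 * (-g2 + ε * g1) * (g1 + ε * g2) + A 1 1 * (g1 + ε * g2) ^ 2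
  have hD0 : D 0 ≠ 0 := by
    intro h0
    have hdet := det_translate hs p hg1 hg2
    rw [hp] at hdet
    apply hA
    simp only [D] at h0
    linear_combination hdet - h0
  let s : ℝ → ℝ := fun ε => -2 * (ε * (g1 ^ 2 + g2 ^ 2)) / D ε
  let q : ℝ → ℝ × ℝ := fun ε => (p.1 + s ε * (-g2 + ε * g1), p.2 + s ε * (g1 + ε * g2))
  have hDc : Continuous D := by fun_prop
  have hsc : ContinuousAt s 0 := ContinuousAt.div (by fun_prop) hDc.continuousAt hD0
  have hqc : ContinuousAt q 0 := by fun_prop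
  have hq0 : q 0 = p := by simp [q, s]
  have h1 : ∀ᶠ ε in 𝓝 (0 : ℝ), q ε ∈ U := hqc.eventually (by rw [hq0]; exact hU)
  have h2 : ∀ᶠ ε in 𝓝 (0 : ℝ), D ε ≠ 0 := hDc.continuousAt.eventually_ne hD0
  obtain ⟨ε, ⟨hεU, hεD⟩, hε⟩ :=
    (((h1.and h2).filter_mono nhdsWithin_le_nhds).and
      (eventually_mem_nhdsWithin (a := (0 : ℝ)) (s := {0}ᶜ))).exists
  have hsD : s ε * D ε = -2 * (ε * (g1 ^ 2 + g2 ^ 2)) := div_mul_cancel₀ _ hεD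
  have hs0 : s ε ≠ 0 :=
    div_ne_zero (mul_ne_zero (by norm_num) (mul_ne_zero hε hg.ne')) hεD
  refine ⟨q ε, ⟨?_, hεU⟩, ?_⟩
  · change form A (q ε) = 0
    rw [form_translate hs p hg1 hg2, hp]
    simp only [q]
    simp only [D] at hsD
    linear_combination s ε * hsD
  · rw [polar_translate p hg1 hg2, hp]
    have : (0 : ℝ) + g1 * ((q ε).1 - p.1) + g2 * ((q ε).2 - p.2) =
        s ε * (ε * (g1 ^ 2 + g2 ^ 2)) := by
      simp only [q]
      ring
    rw [this]
    exact mul_ne_zero hs0 (mul_ne_zero hε hg.ne')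

/-- The common points at which no member of the pencil is singular. -/
def crossSet (M N : Matrix (Fin 3) (Fin 3) ℝ) : Set (ℝ × ℝ) :=
  {p | form M p = 0 ∧ form N p = 0 ∧ ∀ t : ℝ, (t • N + M) *ᵥ hom p ≠ 0}

/-- The common points that are singular points of a member of the pencil with parameter `t`
satisfying `S t`. -/
def singSet (M N : Matrix (Fin 3) (Fin 3) ℝ) (S : ℝ → Prop) : Set (ℝ × ℝ) :=
  {p | form M p = 0 ∧ form N p = 0 ∧ ∃ t : ℝ, S t ∧ (t • N + M) *ᵥ hom p = 0}

theorem polar_pencil (M N : Matrix (Fin 3) (Fin 3) ℝ) (t : ℝ) (p q : ℝ × ℝ) :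
    t * polar N p q + polar M p q = hom q ⬝ᵥ ((t • N + M) *ᵥ hom p) := by
  simp [polar, add_mulVec, smul_mulVec]

section

variable {M N : Matrix (Fin 3) (Fin 3) ℝ} {p : ℝ × ℝ}

theorem pencil_param_ne_zero (hM : M.det ≠ 0) {t : ℝ} (ht : (t • N + M) *ᵥ hom p = 0) :
    t ≠ 0 := by
  rintro rfl
  exact mulVec_hom_ne_zero hM p (by simpa using ht)

/-- Proportional gradients at a common point make that point singular for a member of the pencil: the
value of the form being zero, so is the third coordinate of `(t N + M) (x, y, 1)`. -/
theorem tangentLine_eq_iff (hM : M.det ≠ 0) (hN : N.det ≠ 0)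
    (hpM : form M p = 0) (hpN : form N p = 0) :
    tangentLine M p = tangentLine N p ↔ ∃ t : ℝ, (t • N + M) *ᵥ hom p = 0 := by
  constructor
  · intro h
    have hgM := gradient_pos hM hpM
    have hgN := gradient_pos hN hpN
    rw [form_eq_polar, polar_apply] at hpM hpN
    set m1 := M 0 0 * p.1 + M 0 1 * p.2 + M 0 2 with hm1
    set m2 := M 1 0 * p.1 + M 1 1 * p.2 + M 1 2 with hm2
    set n1 := N 0 0 * p.1 + N 0 1 * p.2 + N 0 2 with hn1
    set n2 := N 1 0 * p.1 + N 1 1 * p.2 + N 1 2 with hn2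
    have hq : ((p.1 - n2, p.2 + n1) : ℝ × ℝ) ∈ tangentLine M p := by
      rw [h, tangentLine, Set.mem_ofPred_eq, polar_apply]
      simp only [← hn1, ← hn2]
      linear_combination hpN
    rw [tangentLine, Set.mem_ofPred_eq, polar_apply] at hq
    simp only [← hm1, ← hm2] at hq
    have hd : m2 * n1 = m1 * n2 := by linear_combination hq - hpM
    have hg : n1 ^ 2 + n2 ^ 2 ≠ 0 := hgN.ne'
    set t := -(m1 * n1 + m2 * n2) / (n1 ^ 2 + n2 ^ 2) with ht
    have e1 : t * n1 + m1 = 0 := by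
      rw [ht]; field_simp; linear_combination -n2 * hd
    have e2 : t * n2 + m2 = 0 := by
      rw [ht]; field_simp; linear_combination n1 * hd
    refine ⟨t, (mulVec_hom_eq_zero_iff _ _).2 ⟨?_, ?_, ?_⟩⟩ <;>
      simp only [Matrix.add_apply, Matrix.smul_apply, smul_eq_mul]
    · linear_combination e1
    · linear_combination e2
    · linear_combination t * hpN + hpM - p.1 * e1 - p.2 * e2
  · rintro ⟨t, ht⟩
    have ht0 := pencil_param_ne_zero hM ht
    ext q
    have := polar_pencil M N t p q
    rw [ht, dotProduct_zero] at this
    simp only [tangentLine, Set.mem_ofPred_eq]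
    constructor
    · intro h
      rw [h, add_zero] at this
      exact (mul_eq_zero.1 this).resolve_left ht0
    · intro h
      rw [h, mul_zero, zero_add] at this
      exact this

/-- Each conic lies on the negative side of its own equation of the tangent line near `p`. -/
theorem eventually_polar_mul (hMs : M.IsSymm) (hNs : N.IsSymm) (hM : M.det < 0) (hN : N.det < 0)
    (hpM : form M p = 0) (hpN : form N p = 0) :
    ∃ U ∈ 𝓝 p, ∀ q ∈ conic M ∩ U, ∀ r ∈ conic N ∩ U, 0 ≤ polar M p q * polar N p r := by
  refine ⟨_, Filter.inter_mem (eventually_polar_nonpos hMs hM hpM)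
    (eventually_polar_nonpos hNs hN hpN), ?_⟩
  rintro q ⟨hq, hqU, -⟩ r ⟨hr, -, hrU⟩
  exact mul_nonneg_of_nonpos_of_nonpos (hqU hq) (hrU hr)

theorem exists_polar_mul (hMs : M.IsSymm) (hNs : N.IsSymm) (hM : M.det < 0) (hN : N.det < 0)
    (hpM : form M p = 0) (hpN : form N p = 0) {U : Set (ℝ × ℝ)} (hU : U ∈ 𝓝 p) :
    ∃ q ∈ conic M ∩ U, ∃ r ∈ conic N ∩ U, 0 < polar M p q * polar N p r := by
  obtain ⟨V, hV, h⟩ := eventually_polar_mul hMs hNs hM hN hpM hpN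
  obtain ⟨q, ⟨hq, hqU⟩, hq0⟩ :=
    exists_polar_ne_zero hMs hM.ne hpM (Filter.inter_mem hU hV)
  obtain ⟨r, ⟨hr, hrU⟩, hr0⟩ :=
    exists_polar_ne_zero hNs hN.ne hpN (Filter.inter_mem hU hV)
  exact ⟨q, ⟨hq, hqU.1⟩, r, ⟨hr, hrU.1⟩,
    (h q ⟨hq, hqU.2⟩ r ⟨hr, hrU.2⟩).lt_of_ne (mul_ne_zero hq0 hr0).symm⟩

end

section

variable {M N : Matrix (Fin 3) (Fin 3) ℝ}

theorem polar_eq_of_pencil {t : ℝ} {p : ℝ × ℝ} (ht : (t • N + M) *ᵥ hom p = 0) (q : ℝ × ℝ) :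
    polar M p q = -t * polar N p q := by
  have := polar_pencil M N t p q
  rw [ht, dotProduct_zero] at this
  linarith

theorem crossingPoints_eq (hM : M.det ≠ 0) (hN : N.det ≠ 0) :
    crossingPoints M N = crossSet M N := by
  ext p
  simp only [crossingPoints, crossSet, conic, Set.mem_ofPred_eq]
  refine and_congr_right fun h1 => and_congr_right fun h2 => ?_
  rw [Ne, tangentLine_eq_iff hM hN h1 h2, not_exists]

theorem tangentPoints_eq (hM : M.det ≠ 0) (hN : N.det ≠ 0) :
    tangentPoints M N = singSet M N fun _ => True := by
  ext p
  simp only [tangentPoints, singSet, conic, Set.mem_ofPred_eq, true_and]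
  refine and_congr_right fun h1 => and_congr_right fun h2 => ?_
  rw [tangentLine_eq_iff hM hN h1 h2]

/-- A tangent point is inner exactly when the pencil parameter belonging to it is negative. -/
theorem innerTangentPoints_eq (hMs : M.IsSymm) (hNs : N.IsSymm) (hM : M.det < 0)
    (hN : N.det < 0) : innerTangentPoints M N = singSet M N fun t => t < 0 := by
  ext p
  rw [innerTangentPoints, Set.mem_ofPred_eq, tangentPoints_eq hM.ne hN.ne]
  constructor
  · rintro ⟨⟨h1, h2, t, -, ht⟩, U, hU, h⟩
    refine ⟨h1, h2, t, ?_, ht⟩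
    obtain ⟨q, hq, r, hr, hqr⟩ := exists_polar_mul hMs hNs hM hN h1 h2 hU
    have := h q hq r hr
    rw [polar_eq_of_pencil ht r] at this
    have h0 := pencil_param_ne_zero hM.ne ht
    by_contra! hc
    have hc' := hc.lt_of_ne h0.symm
    nlinarith
  · rintro ⟨h1, h2, t, ht0, ht⟩
    obtain ⟨U, hU, h⟩ := eventually_polar_mul hMs hNs hM hN h1 h2
    refine ⟨⟨h1, h2, t, trivial, ht⟩, U, hU, fun q hq r hr => ?_⟩
    rw [polar_eq_of_pencil ht r]
    nlinarith [h q hq r hr]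

theorem outerTangentPoints_eq (hMs : M.IsSymm) (hNs : N.IsSymm) (hM : M.det < 0)
    (hN : N.det < 0) : outerTangentPoints M N = singSet M N fun t => 0 < t := by
  ext p
  rw [outerTangentPoints, Set.mem_ofPred_eq, tangentPoints_eq hM.ne hN.ne]
  constructor
  · rintro ⟨⟨h1, h2, t, -, ht⟩, U, hU, h⟩
    refine ⟨h1, h2, t, ?_, ht⟩
    obtain ⟨q, hq, r, hr, hqr⟩ := exists_polar_mul hMs hNs hM hN h1 h2 hU
    have := h q hq r hr
    rw [polar_eq_of_pencil ht r] at this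
    have h0 := pencil_param_ne_zero hM.ne ht
    by_contra! hc
    have hc' := hc.lt_of_ne h0
    nlinarith
  · rintro ⟨h1, h2, t, ht0, ht⟩
    obtain ⟨U, hU, h⟩ := eventually_polar_mul hMs hNs hM hN h1 h2
    refine ⟨⟨h1, h2, t, trivial, ht⟩, U, hU, fun q hq r hr => ?_⟩
    rw [polar_eq_of_pencil ht r]
    nlinarith [h q hq r hr]

/-- For nondegenerate conics of negative determinant, contact is read off from the singular points of
the members of the pencil and the signs of their parameters. -/
theorem hasContact_iff (hMs : M.IsSymm) (hNs : N.IsSymm) (hM : M.det < 0) (hN : N.det < 0)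
    (c i o : ℕ∞) :
    HasContact M N c i o ↔ (crossSet M N).encard = c ∧
      (singSet M N fun t => t < 0).encard = i ∧ (singSet M N fun t => 0 < t).encard = o := by
  rw [HasContact, crossingPoints_eq hM.ne hN.ne, innerTangentPoints_eq hMs hNs hM hN,
    outerTangentPoints_eq hMs hNs hM hN, tangentPoints_eq hM.ne hN.ne]
  refine and_congr_right fun _ => and_congr_right fun _ => and_iff_left ?_
  ext p
  constructor
  · rintro ⟨h1, h2, t, -, ht⟩
    rcases lt_or_gt_of_ne (pencil_param_ne_zero hM.ne ht) with h | h
    · exact Or.inl ⟨h1, h2, t, h, ht⟩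
    · exact Or.inr ⟨h1, h2, t, h, ht⟩
  · rintro (⟨h1, h2, t, -, ht⟩ | ⟨h1, h2, t, -, ht⟩) <;> exact ⟨h1, h2, t, trivial, ht⟩

end

/-! ### Affine changes of coordinates and the normal form of the pencil -/

/-- The affine map of the plane given by a matrix with last row `(0, 0, 1)`. -/
noncomputable def affMap (P : Matrix (Fin 3) (Fin 3) ℝ) (q : ℝ × ℝ) : ℝ × ℝ :=
  ((P *ᵥ hom q) 0, (P *ᵥ hom q) 1)

section

variable {P : Matrix (Fin 3) (Fin 3) ℝ}

theorem hom_affMap (h0 : P 2 0 = 0) (h1 : P 2 1 = 0) (h2 : P 2 2 = 1) (q : ℝ × ℝ) :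
    hom (affMap P q) = P *ᵥ hom q := by
  ext i
  fin_cases i <;> simp [hom, affMap, mulVec, dotProduct, Fin.sum_univ_three, h0, h1, h2]

theorem hom_injective : Function.Injective hom := fun p q h =>
  Prod.ext (by simpa [hom] using congrFun h 0) (by simpa [hom] using congrFun h 1)

theorem affMap_bijective (h0 : P 2 0 = 0) (h1 : P 2 1 = 0) (h2 : P 2 2 = 1) (hP : P.det ≠ 0) :
    Function.Bijective (affMap P) := by
  have hu : IsUnit P := (isUnit_iff_isUnit_det P).2 hP.isUnit
  constructor
  · intro p q h
    have := congrArg hom h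
    rw [hom_affMap h0 h1 h2, hom_affMap h0 h1 h2] at this
    exact hom_injective (mulVec_injective_iff_isUnit.2 hu this)
  · intro q
    obtain ⟨v, hv⟩ := mulVec_surjective_iff_isUnit.2 hu (hom q)
    have hv2 : v 2 = 1 := by
      have := congrFun hv 2
      simpa [hom, mulVec, dotProduct, Fin.sum_univ_three, h0, h1, h2] using this
    refine ⟨(v 0, v 1), hom_injective ?_⟩
    rw [hom_affMap h0 h1 h2, ← hv]
    congr 1
    ext i
    fin_cases i <;> simp [hom, hv2]

variable {A : Matrix (Fin 3) (Fin 3) ℝ} {k : ℝ}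

theorem mulVec_congr_hom (h0 : P 2 0 = 0) (h1 : P 2 1 = 0) (h2 : P 2 2 = 1) (q : ℝ × ℝ) :
    (k • (Pᵀ * A * P)) *ᵥ hom q = k • Pᵀ *ᵥ (A *ᵥ hom (affMap P q)) := by
  rw [hom_affMap h0 h1 h2, smul_mulVec, ← mulVec_mulVec, ← mulVec_mulVec]

theorem form_congr (h0 : P 2 0 = 0) (h1 : P 2 1 = 0) (h2 : P 2 2 = 1) (q : ℝ × ℝ) :
    form (k • (Pᵀ * A * P)) q = k * form A (affMap P q) := by
  rw [form, mulVec_congr_hom h0 h1 h2, form, dotProduct_smul, smul_eq_mul, mulVec_transpose,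
    dotProduct_comm, ← dotProduct_mulVec, dotProduct_comm, hom_affMap h0 h1 h2]

theorem mulVec_congr_eq_zero_iff (h0 : P 2 0 = 0) (h1 : P 2 1 = 0) (h2 : P 2 2 = 1)
    (hP : P.det ≠ 0) (hk : k ≠ 0) (q : ℝ × ℝ) :
    (k • (Pᵀ * A * P)) *ᵥ hom q = 0 ↔ A *ᵥ hom (affMap P q) = 0 := by
  have hu : IsUnit Pᵀ := (isUnit_iff_isUnit_det _).2 (by simpa using hP)
  rw [mulVec_congr_hom h0 h1 h2, smul_eq_zero, or_iff_right hk]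
  constructor
  · intro h
    exact mulVec_injective_iff_isUnit.2 hu (h.trans (mulVec_zero _).symm)
  · intro h
    rw [h, mulVec_zero]

end

theorem pencil_congr (P M N : Matrix (Fin 3) (Fin 3) ℝ) (k t : ℝ) :
    t • (k • (Pᵀ * N * P)) + k • (Pᵀ * M * P) = k • (Pᵀ * (t • N + M) * P) := by
  rw [Matrix.mul_add, Matrix.add_mul, smul_add, Matrix.mul_smul, Matrix.smul_mul, smul_comm]

section

variable {P M N M' N' : Matrix (Fin 3) (Fin 3) ℝ} {k : ℝ}

theorem crossSet_congr (h0 : P 2 0 = 0) (h1 : P 2 1 = 0) (h2 : P 2 2 = 1) (hP : P.det ≠ 0)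
    (hk : k ≠ 0) (hM : k • (Pᵀ * M * P) = M') (hN : k • (Pᵀ * N * P) = N') :
    (crossSet M' N').encard = (crossSet M N).encard := by
  subst hM hN
  rw [← Set.encard_preimage_of_bijective (affMap_bijective h0 h1 h2 hP) (crossSet M N)]
  congr 1
  ext q
  simp [crossSet, form_congr h0 h1 h2, hk, pencil_congr, mulVec_congr_eq_zero_iff h0 h1 h2 hP hk]

theorem singSet_congr (h0 : P 2 0 = 0) (h1 : P 2 1 = 0) (h2 : P 2 2 = 1) (hP : P.det ≠ 0)
    (hk : k ≠ 0) (hM : k • (Pᵀ * M * P) = M') (hN : k • (Pᵀ * N * P) = N') (S : ℝ → Prop) :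
    (singSet M' N' S).encard = (singSet M N S).encard := by
  subst hM hN
  rw [← Set.encard_preimage_of_bijective (affMap_bijective h0 h1 h2 hP) (singSet M N S)]
  congr 1
  ext q
  simp [singSet, form_congr h0 h1 h2, hk, pencil_congr, mulVec_congr_eq_zero_iff h0 h1 h2 hP hk]

theorem separated_congr (h0 : P 2 0 = 0) (h1 : P 2 1 = 0) (h2 : P 2 2 = 1) (hP : P.det ≠ 0)
    (hk : 0 < k) (hM : k • (Pᵀ * M * P) = M') (hN : k • (Pᵀ * N * P) = N')
    (h : Separated M' N') : Separated M N := by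
  subst hM hN
  rw [Separated, Set.disjoint_left] at h ⊢
  intro p hp hp'
  obtain ⟨q, rfl⟩ := (affMap_bijective h0 h1 h2 hP).2 p
  refine h (a := q) ?_ ?_
  · change form _ q ≤ 0
    rw [form_congr h0 h1 h2]
    exact mul_nonpos_of_nonneg_of_nonpos hk.le hp
  · change form _ q ≤ 0
    rw [form_congr h0 h1 h2]
    exact mul_nonpos_of_nonneg_of_nonpos hk.le hp'

theorem inside_congr (h0 : P 2 0 = 0) (h1 : P 2 1 = 0) (h2 : P 2 2 = 1) (hP : P.det ≠ 0)
    (hk : 0 < k) (hM : k • (Pᵀ * M * P) = M') (hN : k • (Pᵀ * N * P) = N')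
    (h : Inside M' N') : Inside M N := by
  subst hM hN
  intro p hp
  obtain ⟨q, rfl⟩ := (affMap_bijective h0 h1 h2 hP).2 p
  have h3 : q ∈ solid (k • (Pᵀ * M * P)) := by
    change form _ q ≤ 0
    rw [form_congr h0 h1 h2]
    exact mul_nonpos_of_nonneg_of_nonpos hk.le hp
  have h4 : form (k • (Pᵀ * N * P)) q < 0 := h h3
  rw [form_congr h0 h1 h2] at h4
  change form N _ < 0
  by_contra! hc
  exact h4.not_ge (mul_nonneg hk.le hc)

end

/-- The unit circle. -/
def circleMat : Matrix (Fin 3) (Fin 3) ℝ := !![1, 0, 0; 0, 1, 0; 0, 0, -1]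

theorem circleMat_det : circleMat.det = -1 := by
  simp [circleMat, det_fin_three]

/-- The conic `a x² - b y² + 2 p x + 2 q y + r = 0`. -/
def hypMat (a b p q r : ℝ) : Matrix (Fin 3) (Fin 3) ℝ := !![a, 0, p; 0, -b, q; p, q, r]

section

variable {M N : Matrix (Fin 3) (Fin 3) ℝ}

theorem T₁_eq (hM : M.IsSymm) : T₁ M = M 0 0 * M 1 1 - M 0 1 ^ 2 := by
  rw [T₁, quadPart, det_fin_two_of, (symm_entries hM).1]
  ring

theorem T_eq (hM : M.IsSymm) (hN : N.IsSymm) (h : T₁ M ≠ 0) :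
    T M N = M 0 0 * N 1 1 + M 1 1 * N 0 0 - 2 * M 0 1 * N 0 1 := by
  rw [T, inv_def, smul_mul, trace_smul, Ring.inverse_eq_inv', smul_eq_mul]
  rw [show (quadPart M).det = T₁ M from rfl, mul_inv_cancel_left₀ h]
  simp [quadPart, adjugate_fin_two_of, trace_fin_two,
    (symm_entries hM).1, (symm_entries hN).1]
  ring

theorem H₀_spec (hT₁ : 0 < T₁ M) (hT₂ : T₂ N < 0) :
    0 < H₀ M N ∧ T₁ M * H₀ M N ^ 2 - T M N * H₀ M N + T₂ N = 0 := by
  have hd : T M N ^ 2 < T M N ^ 2 - 4 * T₁ M * T₂ N := by nlinarith [mul_neg_of_pos_of_neg hT₁ hT₂]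
  have hs := Real.sq_sqrt ((sq_nonneg (T M N)).trans hd.le)
  have hlt : -T M N < √(T M N ^ 2 - 4 * T₁ M * T₂ N) := by
    apply Real.lt_sqrt_of_sq_lt
    rwa [neg_sq]
  constructor
  · exact div_pos (by linarith) (by linarith)
  · rw [H₀]
    set s := √(T M N ^ 2 - 4 * T₁ M * T₂ N)
    field_simp
    linear_combination hs

theorem H₂_spec (hT₁ : 0 < T₁ M) (hT₂ : T₂ N < 0) :
    H₂ M N < 0 ∧ T₁ M * H₂ M N ^ 2 - T M N * H₂ M N + T₂ N = 0 := by
  have hd : T M N ^ 2 < T M N ^ 2 - 4 * T₁ M * T₂ N := by nlinarith [mul_neg_of_pos_of_neg hT₁ hT₂]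
  have hs := Real.sq_sqrt ((sq_nonneg (T M N)).trans hd.le)
  have hlt : T M N < √(T M N ^ 2 - 4 * T₁ M * T₂ N) := Real.lt_sqrt_of_sq_lt hd
  constructor
  · exact div_neg_of_neg_of_pos (by linarith) (by linarith)
  · rw [H₂]
    set s := √(T M N ^ 2 - 4 * T₁ M * T₂ N)
    field_simp
    linear_combination hs

/-- An eigenvector of the quadratic part of `N` relative to that of `M`, of prescribed length. -/
theorem exists_eigenvector (hM : IsEllipse M) (hN : N.IsSymm) {h κ : ℝ} (hκ : 0 < κ)
    (hh : T₁ M * h ^ 2 - T M N * h + T₂ N = 0) :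
    ∃ u v : ℝ, (N 0 0 - h * M 0 0) * u + (N 0 1 - h * M 0 1) * v = 0 ∧
      (N 0 1 - h * M 0 1) * u + (N 1 1 - h * M 1 1) * v = 0 ∧
      M 0 0 * u ^ 2 + 2 * M 0 1 * u * v + M 1 1 * v ^ 2 = κ := by
  have hT₁ := hM.T₁_pos
  have ha := hM.a₁₁_pos
  rw [T_eq hM.symm hN hT₁.ne', T₁_eq hM.symm, show T₂ N = T₁ N from rfl, T₁_eq hN] at hh
  rw [T₁_eq hM.symm] at hT₁
  obtain ⟨w, hw0, hw⟩ := (exists_mulVec_eq_zero_iff (M := !![N 0 0 - h * M 0 0, N 0 1 - h * M 0 1;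
    N 0 1 - h * M 0 1, N 1 1 - h * M 1 1])).2 (by rw [det_fin_two_of]; linear_combination hh)
  have e0 : (N 0 0 - h * M 0 0) * w 0 + (N 0 1 - h * M 0 1) * w 1 = 0 := by
    simpa [mulVec, dotProduct, Fin.sum_univ_two] using congrFun hw 0
  have e1 : (N 0 1 - h * M 0 1) * w 0 + (N 1 1 - h * M 1 1) * w 1 = 0 := by
    simpa [mulVec, dotProduct, Fin.sum_univ_two] using congrFun hw 1
  have hpos : 0 < M 0 0 * w 0 ^ 2 + 2 * M 0 1 * w 0 * w 1 + M 1 1 * w 1 ^ 2 := by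
    have hid : M 0 0 * (M 0 0 * w 0 ^ 2 + 2 * M 0 1 * w 0 * w 1 + M 1 1 * w 1 ^ 2) =
        (M 0 0 * w 0 + M 0 1 * w 1) ^ 2 + (M 0 0 * M 1 1 - M 0 1 ^ 2) * w 1 ^ 2 := by ring
    refine pos_of_mul_pos_right ?_ ha.le
    rw [hid]
    by_cases h1 : w 1 = 0
    · have h2 : w 0 ≠ 0 := fun h2 => hw0 (by ext i; fin_cases i <;> simp [h1, h2])
      rw [h1]
      have := mul_ne_zero ha.ne' h2
      have := sq_pos_of_ne_zero this
      linarith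
    · have := mul_pos hT₁ (sq_pos_of_ne_zero h1)
      have := sq_nonneg (M 0 0 * w 0 + M 0 1 * w 1)
      linarith
  set m := M 0 0 * w 0 ^ 2 + 2 * M 0 1 * w 0 * w 1 + M 1 1 * w 1 ^ 2 with hm
  have hs : √(κ / m) ^ 2 = κ / m := Real.sq_sqrt (by positivity)
  refine ⟨√(κ / m) * w 0, √(κ / m) * w 1, ?_, ?_, ?_⟩
  · linear_combination √(κ / m) * e0
  · linear_combination √(κ / m) * e1
  · have : √(κ / m) ^ 2 * m = κ := by rw [hs]; field_simp
    rw [hm] at this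
    linear_combination this

/-- Simultaneous reduction: the origin is moved to the centre of the ellipse, and the axes are
conjugate for both conics. -/
theorem exists_normal_form (hM : IsEllipse M) (hN : IsHyperbola N) :
    ∃ (P : Matrix (Fin 3) (Fin 3) ℝ) (k p q r : ℝ), P 2 0 = 0 ∧ P 2 1 = 0 ∧ P 2 2 = 1 ∧
      P.det ≠ 0 ∧ 0 < k ∧ k • (Pᵀ * M * P) = circleMat ∧
      k • (Pᵀ * N * P) = hypMat (H₀ M N) (-H₂ M N) p q r := by
  obtain ⟨s1, s2, s3⟩ := symm_entries hM.symm
  obtain ⟨n1, n2, n3⟩ := symm_entries hN.symm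
  obtain ⟨hH₀, e₀⟩ := H₀_spec hM.T₁_pos hN.T₂_neg
  obtain ⟨hH₂, e₂⟩ := H₂_spec hM.T₁_pos hN.T₂_neg
  have hT := hM.T₁_pos
  rw [T₁_eq hM.symm] at hT
  -- the centre of the ellipse
  obtain ⟨c, hc1, hc2⟩ : ∃ c : ℝ × ℝ, M 0 0 * c.1 + M 0 1 * c.2 + M 0 2 = 0 ∧
      M 1 0 * c.1 + M 1 1 * c.2 + M 1 2 = 0 := by
    obtain ⟨i, hi⟩ : ∃ i, (M 0 0 * M 1 1 - M 0 1 ^ 2) * i = 1 := ⟨_, mul_inv_cancel₀ hT.ne'⟩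
    refine ⟨((M 0 1 * M 1 2 - M 1 1 * M 0 2) * i, (M 0 1 * M 0 2 - M 0 0 * M 1 2) * i), ?_, ?_⟩
    · linear_combination -M 0 2 * hi
    · rw [s1]
      linear_combination -M 1 2 * hi
  obtain ⟨κ, hκ⟩ : ∃ κ, -form M c = κ := ⟨_, rfl⟩
  have hκ0 : 0 < κ := by
    have h1 := det_translate hM.symm c hc1 hc2
    have h2 : M.det < 0 := hM.L₃_neg
    rw [h1] at h2
    nlinarith
  have hc3 : M 2 0 * c.1 + M 2 1 * c.2 + M 2 2 = -κ := by
    rw [← hκ, form_eq_polar, polar_apply, hc1, hc2]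
    ring
  obtain ⟨u1, u2, hu1, hu2, hu⟩ := exists_eigenvector hM hN.symm hκ0 e₀
  obtain ⟨v1, v2, hv1, hv2, hv⟩ := exists_eigenvector hM hN.symm hκ0 e₂
  generalize H₀ M N = a at *
  generalize H₂ M N = b at *
  have hab : a - b ≠ 0 := by linarith
  have huv : M 0 0 * u1 * v1 + M 0 1 * (u1 * v2 + u2 * v1) + M 1 1 * u2 * v2 = 0 := by
    apply mul_left_cancel₀ hab
    linear_combination u1 * hv1 + u2 * hv2 - v1 * hu1 - v2 * hu2
  have hk : κ⁻¹ * κ = 1 := inv_mul_cancel₀ hκ0.ne'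
  rw [s1] at hc2
  rw [s2, s3] at hc3
  have hE : κ⁻¹ • ((!![u1, v1, c.1; u2, v2, c.2; 0, 0, 1] : Matrix (Fin 3) (Fin 3) ℝ)ᵀ * M *
      !![u1, v1, c.1; u2, v2, c.2; 0, 0, 1]) = circleMat := by
    ext i j
    fin_cases i <;> fin_cases j <;>
      simp [circleMat, mul_apply, Fin.sum_univ_three, s1, s2, s3, -mul_eq_zero]
    · linear_combination κ⁻¹ * hu + hk
    · linear_combination κ⁻¹ * huv
    · linear_combination κ⁻¹ * (u1 * hc1 + u2 * hc2)
    · linear_combination κ⁻¹ * huv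
    · linear_combination κ⁻¹ * hv + hk
    · linear_combination κ⁻¹ * (v1 * hc1 + v2 * hc2)
    · linear_combination κ⁻¹ * (u1 * hc1 + u2 * hc2)
    · linear_combination κ⁻¹ * (v1 * hc1 + v2 * hc2)
    · linear_combination κ⁻¹ * (c.1 * hc1 + c.2 * hc2 + hc3) - hk
  refine ⟨!![u1, v1, c.1; u2, v2, c.2; 0, 0, 1], κ⁻¹,
    κ⁻¹ * (u1 * (N 0 0 * c.1 + N 0 1 * c.2 + N 0 2) + u2 * (N 0 1 * c.1 + N 1 1 * c.2 + N 1 2)),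
    κ⁻¹ * (v1 * (N 0 0 * c.1 + N 0 1 * c.2 + N 0 2) + v2 * (N 0 1 * c.1 + N 1 1 * c.2 + N 1 2)),
    κ⁻¹ * form N c, by simp, by simp, by simp, ?_, inv_pos.2 hκ0, hE, ?_⟩
  · intro h0
    have := congrArg det hE
    rw [det_smul, det_mul, h0] at this
    rw [circleMat_det] at this
    norm_num at this
  · ext i j
    fin_cases i <;> fin_cases j <;>
      simp [hypMat, mul_apply, Fin.sum_univ_three, n1, n2, n3, form_eq_polar, polar_apply,
          -mul_eq_zero, -mul_eq_mul_left_iff]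
    · linear_combination κ⁻¹ * (u1 * hu1 + u2 * hu2 + a * hu) + a * hk
    · linear_combination κ⁻¹ * (v1 * hu1 + v2 * hu2 + a * huv)
    · ring
    · linear_combination κ⁻¹ * (v1 * hu1 + v2 * hu2 + a * huv)
    · linear_combination κ⁻¹ * (v1 * hv1 + v2 * hv2 + b * hv) + b * hk
    · ring
    · ring
    · ring
    · ring

end

/-! ### The pencil in normal form -/

/-- The determinant of `t N + M` for `M` the unit circle and `N = hypMat a b p q r`. -/
def charPoly (a b p q r t : ℝ) : ℝ :=
  (-a * b * r + b * p ^ 2 - a * q ^ 2) * t ^ 3 + ((a - b) * r + a * b - p ^ 2 - q ^ 2) * t ^ 2 +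
    (r - a + b) * t - 1

/-- The derivative of `charPoly`. -/
def charDeriv (a b p q r t : ℝ) : ℝ :=
  3 * (-a * b * r + b * p ^ 2 - a * q ^ 2) * t ^ 2 +
    2 * ((a - b) * r + a * b - p ^ 2 - q ^ 2) * t + (r - a + b)

/-- The bilinear form of the unit circle. -/
def bilE (u v : Fin 3 → ℝ) : ℝ := u 0 * v 0 + u 1 * v 1 - u 2 * v 2

/-- The bilinear form of `hypMat a b p q r`. -/
def bilN (a b p q r : ℝ) (u v : Fin 3 → ℝ) : ℝ :=
  a * u 0 * v 0 - b * u 1 * v 1 + p * (u 0 * v 2 + u 2 * v 0) + q * (u 1 * v 2 + u 2 * v 1) +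
    r * u 2 * v 2

/-- `v` is in the kernel of the member of the pencil with parameter `t`. -/
def IsKer (a b p q r t : ℝ) (v : Fin 3 → ℝ) : Prop :=
  (1 + t * a) * v 0 + t * p * v 2 = 0 ∧ (1 - t * b) * v 1 + t * q * v 2 = 0 ∧
    t * (p * v 0 + q * v 1 + r * v 2) - v 2 = 0

/-- The common points of the circle and the hyperbola. -/
def commonPts (a b p q r : ℝ) : Set (ℝ × ℝ) :=
  {z | form circleMat z = 0 ∧ form (hypMat a b p q r) z = 0}

/-- `HasContact` in algebraic terms, for the pencil in normal form. -/
def NormalContact (a b p q r : ℝ) (c i o : ℕ∞) : Prop :=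
  (crossSet circleMat (hypMat a b p q r)).encard = c ∧
    (singSet circleMat (hypMat a b p q r) fun t => t < 0).encard = i ∧
    (singSet circleMat (hypMat a b p q r) fun t => 0 < t).encard = o

section

variable {a b p q r t : ℝ}

theorem det_hypMat : (t • hypMat a b p q r + circleMat).det = charPoly a b p q r t := by
  simp [hypMat, circleMat, det_fin_three, charPoly]
  ring

theorem form_circleMat (z : ℝ × ℝ) : form circleMat z = z.1 ^ 2 + z.2 ^ 2 - 1 := by
  simp [form_eq_polar, polar_apply, circleMat]
  ring

theorem form_hypMat (z : ℝ × ℝ) : form (hypMat a b p q r) z =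
    a * z.1 ^ 2 - b * z.2 ^ 2 + 2 * p * z.1 + 2 * q * z.2 + r := by
  simp [form_eq_polar, polar_apply, hypMat]
  ring

theorem mem_commonPts {z : ℝ × ℝ} : z ∈ commonPts a b p q r ↔ z.1 ^ 2 + z.2 ^ 2 = 1 ∧
    a * z.1 ^ 2 - b * z.2 ^ 2 + 2 * p * z.1 + 2 * q * z.2 + r = 0 := by
  rw [commonPts, Set.mem_ofPred_eq, form_circleMat, form_hypMat, sub_eq_zero]

theorem mem_commonPts_iff_bil {z : ℝ × ℝ} : z ∈ commonPts a b p q r ↔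
    bilE (hom z) (hom z) = 0 ∧ bilN a b p q r (hom z) (hom z) = 0 := by
  rw [mem_commonPts]
  simp only [bilE, bilN, hom, cons_val_zero, cons_val_one, cons_val]
  refine and_congr ?_ ?_ <;> constructor <;> intro h <;> linear_combination h

theorem mulVec_eq_zero_iff_isKer (z : ℝ × ℝ) :
    (t • hypMat a b p q r + circleMat) *ᵥ hom z = 0 ↔ IsKer a b p q r t (hom z) := by
  rw [mulVec_hom_eq_zero_iff, IsKer]
  simp only [hypMat, circleMat, hom, Matrix.add_apply, Matrix.smul_apply, of_apply, cons_val_zero,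
    cons_val_one, cons_val, smul_eq_mul]
  refine and_congr ?_ (and_congr ?_ ?_) <;> constructor <;> intro h <;> linear_combination h

theorem isKer_hom {z : ℝ × ℝ} : IsKer a b p q r t (hom z) ↔ (1 + t * a) * z.1 + t * p = 0 ∧
    (1 - t * b) * z.2 + t * q = 0 ∧ t * (p * z.1 + q * z.2 + r) = 1 := by
  simp [IsKer, hom, sub_eq_zero]

theorem mem_crossSet {z : ℝ × ℝ} : z ∈ crossSet circleMat (hypMat a b p q r) ↔
    z ∈ commonPts a b p q r ∧ ∀ t, ¬ IsKer a b p q r t (hom z) := by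
  simp only [crossSet, commonPts, Set.mem_ofPred_eq, and_assoc, Ne, mulVec_eq_zero_iff_isKer]

theorem mem_singSet {S : ℝ → Prop} {z : ℝ × ℝ} : z ∈ singSet circleMat (hypMat a b p q r) S ↔
    z ∈ commonPts a b p q r ∧ ∃ t, S t ∧ IsKer a b p q r t (hom z) := by
  simp only [singSet, commonPts, Set.mem_ofPred_eq, and_assoc, mulVec_eq_zero_iff_isKer]

theorem IsKer.bilE_eq {v : Fin 3 → ℝ} (h : IsKer a b p q r t v) (u : Fin 3 → ℝ) :
    bilE v u = -t * bilN a b p q r v u := by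
  obtain ⟨h0, h1, h2⟩ := h
  simp only [bilE, bilN]
  linear_combination u 0 * h0 + u 1 * h1 + u 2 * h2

theorem bilE_comm (u v : Fin 3 → ℝ) : bilE u v = bilE v u := by
  simp only [bilE]; ring

theorem bilN_comm (u v : Fin 3 → ℝ) : bilN a b p q r u v = bilN a b p q r v u := by
  simp only [bilN]; ring

/-- Kernel vectors of different members of the pencil are conjugate for all conics of it. -/
theorem IsKer.orthogonal {s : ℝ} {u v : Fin 3 → ℝ} (hu : IsKer a b p q r s u)
    (hv : IsKer a b p q r t v) (hst : s ≠ t) :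
    bilE u v = 0 ∧ bilN a b p q r u v = 0 := by
  have h1 := hu.bilE_eq v
  have h2 := hv.bilE_eq u
  rw [bilE_comm, bilN_comm] at h2
  have : bilN a b p q r u v = 0 :=
    (mul_eq_zero.1 (show (s - t) * bilN a b p q r u v = 0 by linear_combination h1 - h2)).resolve_left
      (sub_ne_zero.2 hst)
  exact ⟨by rw [h1, this, mul_zero], this⟩

/-- A vector in the kernel is a root of the determinant, and the derivative of the determinant
there is the value of `N` on it, up to the cofactor. -/
theorem charPoly_of_isKer {z : ℝ × ℝ} (h : IsKer a b p q r t (hom z)) :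
    charPoly a b p q r t = 0 ∧ charDeriv a b p q r t = (1 + t * a) * (1 - t * b) *
      (a * z.1 ^ 2 - b * z.2 ^ 2 + 2 * p * z.1 + 2 * q * z.2 + r) := by
  obtain ⟨h1, h2, h3⟩ := isKer_hom.1 h
  constructor
  · rw [charPoly]
    linear_combination (1 + t * a) * (1 - t * b) * h3 - (1 - t * b) * (t * p) * h1 -
      (1 + t * a) * (t * q) * h2
  · rw [charDeriv]
    linear_combination (a * (1 - t * b) - b * (1 + t * a)) * (h3 - z.1 * h1 - z.2 * h2) +
      b * (t * p - (1 + t * a) * z.1) * h1 - 2 * (1 - t * b) * p * h1 -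
      a * (t * q - (1 - t * b) * z.2) * h2 - 2 * (1 + t * a) * q * h2

/-- Tangency at a common point forces a double root of the determinant. -/
theorem double_root_of_isKer {z : ℝ × ℝ} (hz : z ∈ commonPts a b p q r)
    (h : IsKer a b p q r t (hom z)) :
    charPoly a b p q r t = 0 ∧ charDeriv a b p q r t = 0 := by
  obtain ⟨h1, h2⟩ := charPoly_of_isKer h
  exact ⟨h1, by rw [h2, (mem_commonPts.1 hz).2, mul_zero]⟩

/-- The completed square of a member of the pencil. -/
theorem pencil_square (z : ℝ × ℝ) : (1 + t * a) * (1 - t * b) *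
    (t * (a * z.1 ^ 2 - b * z.2 ^ 2 + 2 * p * z.1 + 2 * q * z.2 + r) + (z.1 ^ 2 + z.2 ^ 2 - 1)) =
    (1 - t * b) * ((1 + t * a) * z.1 + t * p) ^ 2 + (1 + t * a) * ((1 - t * b) * z.2 + t * q) ^ 2 +
      charPoly a b p q r t := by
  rw [charPoly]
  ring

theorem pencil_pos (h1 : 0 < 1 + t * a) (h2 : 0 < 1 - t * b) (hF : 0 < charPoly a b p q r t)
    (z : ℝ × ℝ) : 0 < t * form (hypMat a b p q r) z + form circleMat z := by
  rw [form_hypMat, form_circleMat]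
  have := pencil_square (a := a) (b := b) (p := p) (q := q) (r := r) (t := t) z
  refine pos_of_mul_pos_right ?_ (mul_pos h1 h2).le
  rw [this]
  positivity

theorem separated_of_pos (h1 : 0 < 1 + t * a) (h2 : 0 < 1 - t * b) (ht : 0 < t)
    (hF : 0 < charPoly a b p q r t) : Separated circleMat (hypMat a b p q r) := by
  rw [Separated, Set.disjoint_left]
  intro z hz hz'
  have h3 := pencil_pos h1 h2 hF z
  have h4 : form circleMat z ≤ 0 := hz
  have h5 : form (hypMat a b p q r) z ≤ 0 := hz'
  nlinarith

theorem inside_of_pos (h1 : 0 < 1 + t * a) (h2 : 0 < 1 - t * b) (ht : t < 0)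
    (hF : 0 < charPoly a b p q r t) : Inside circleMat (hypMat a b p q r) := by
  intro z hz
  have h3 := pencil_pos h1 h2 hF z
  have h4 : form circleMat z ≤ 0 := hz
  change form (hypMat a b p q r) z < 0
  nlinarith

theorem IsKer.param_ne_zero {z : ℝ × ℝ} (h : IsKer a b p q r t (hom z)) : t ≠ 0 := by
  rintro rfl
  simpa using (isKer_hom.1 h).2.2

/-- A point is singular for at most one member of the pencil. -/
theorem IsKer.param_unique {s : ℝ} {z : ℝ × ℝ} (hs : IsKer a b p q r s (hom z))
    (ht : IsKer a b p q r t (hom z)) : s = t := by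
  have h1 := (isKer_hom.1 hs).2.2
  have h2 := (isKer_hom.1 ht).2.2
  have h3 : p * z.1 + q * z.2 + r ≠ 0 := fun h => by rw [h, mul_zero] at h1; exact zero_ne_one h1
  exact mul_right_cancel₀ h3 (h1.trans h2.symm)

/-! ### A double root off the poles: a single point of tangency -/

/-- If the quadratic part of a member of the pencil is nonsingular, its vertex is the only point
of tangency of the two conics. -/
theorem tangent_unique {s : ℝ} {z w : ℝ × ℝ} (hz : z ∈ commonPts a b p q r)
    (hw : w ∈ commonPts a b p q r) (hkz : IsKer a b p q r t (hom z))
    (hkw : IsKer a b p q r s (hom w)) (ht : (1 + t * a) * (1 - t * b) ≠ 0) : w = z := by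
  have hA := left_ne_zero_of_mul ht
  have hB := right_ne_zero_of_mul ht
  by_cases hst : t = s
  · subst hst
    obtain ⟨h1, h2, -⟩ := isKer_hom.1 hkz
    obtain ⟨h3, h4, -⟩ := isKer_hom.1 hkw
    refine Prod.ext (mul_left_cancel₀ hA ?_) (mul_left_cancel₀ hB ?_)
    · linear_combination h3 - h1
    · linear_combination h4 - h2
  · have h := (hkz.orthogonal hkw hst).1
    have h1 := (mem_commonPts.1 hz).1
    have h2 := (mem_commonPts.1 hw).1
    simp only [bilE, hom, cons_val_zero, cons_val_one, cons_val] at h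
    have h3 : (w.1 - z.1) ^ 2 + (w.2 - z.2) ^ 2 = 0 := by linear_combination h1 + h2 - 2 * h
    have h4 : (w.1 - z.1) ^ 2 = 0 := by nlinarith [sq_nonneg (w.1 - z.1), sq_nonneg (w.2 - z.2)]
    have h5 : (w.2 - z.2) ^ 2 = 0 := by nlinarith [sq_nonneg (w.1 - z.1), sq_nonneg (w.2 - z.2)]
    exact Prod.ext (sub_eq_zero.1 (pow_eq_zero_iff two_ne_zero |>.1 h4))
      (sub_eq_zero.1 (pow_eq_zero_iff two_ne_zero |>.1 h5))

/-- The vertex of the member of the pencil at a double root lies on both conics. -/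
theorem exists_vertex (ht : (1 + t * a) * (1 - t * b) ≠ 0) (hF : charPoly a b p q r t = 0)
    (hF' : charDeriv a b p q r t = 0) :
    ∃ z ∈ commonPts a b p q r, IsKer a b p q r t (hom z) := by
  have hA := left_ne_zero_of_mul ht
  have hB := right_ne_zero_of_mul ht
  obtain ⟨x, hx⟩ : ∃ x, (1 + t * a) * x + t * p = 0 := ⟨-(t * p) / (1 + t * a), by field_simp; ring⟩
  obtain ⟨y, hy⟩ : ∃ y, (1 - t * b) * y + t * q = 0 := ⟨-(t * q) / (1 - t * b), by field_simp; ring⟩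
  have h3 : t * (p * x + q * y + r) = 1 := by
    apply mul_left_cancel₀ ht
    rw [charPoly] at hF
    linear_combination hF + (1 - t * b) * (t * p) * hx + (1 + t * a) * (t * q) * hy
  have hk : IsKer a b p q r t (hom (x, y)) := isKer_hom.2 ⟨hx, hy, h3⟩
  refine ⟨(x, y), mem_commonPts.2 ?_, hk⟩
  have h4 := (charPoly_of_isKer hk).2
  rw [hF'] at h4
  have h5 := (mul_eq_zero.1 h4.symm).resolve_left ht
  refine ⟨?_, h5⟩
  simp only at h5 ⊢
  linear_combination x * hx + y * hy + h3 - t * h5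

/-- About its vertex, a member of the pencil is given by its quadratic part. -/
theorem square_of_isKer {z w : ℝ × ℝ} (hw : w ∈ commonPts a b p q r)
    (hk : IsKer a b p q r t (hom z)) :
    (1 + t * a) * (w.1 - z.1) ^ 2 + (1 - t * b) * (w.2 - z.2) ^ 2 = 0 := by
  obtain ⟨h1, h2, h3⟩ := isKer_hom.1 hk
  obtain ⟨h4, h5⟩ := mem_commonPts.1 hw
  linear_combination h4 + t * h5 - (2 * w.1 - z.1) * h1 - (2 * w.2 - z.2) * h2 - h3

theorem singSet_eq {S : ℝ → Prop} [Decidable (S t)] {z : ℝ × ℝ} (hz : z ∈ commonPts a b p q r)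
    (hk : IsKer a b p q r t (hom z)) (ht : (1 + t * a) * (1 - t * b) ≠ 0) :
    (singSet circleMat (hypMat a b p q r) S).encard = if S t then 1 else 0 := by
  split_ifs with hS
  · rw [Set.encard_eq_one]
    refine ⟨z, Set.eq_singleton_iff_unique_mem.2 ⟨mem_singSet.2 ⟨hz, t, hS, hk⟩, fun w hw => ?_⟩⟩
    obtain ⟨hw, s, -, hs⟩ := mem_singSet.1 hw
    exact tangent_unique hz hw hk hs ht
  · rw [Set.encard_eq_zero, Set.eq_empty_iff_forall_notMem]
    intro w hw
    obtain ⟨hw, s, hSs, hs⟩ := mem_singSet.1 hw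
    obtain rfl := tangent_unique hz hw hk hs ht
    exact hS (hk.param_unique hs ▸ hSs)

theorem crossSet_eq {z : ℝ × ℝ} (hz : z ∈ commonPts a b p q r)
    (hk : IsKer a b p q r t (hom z)) (ht : (1 + t * a) * (1 - t * b) ≠ 0) :
    crossSet circleMat (hypMat a b p q r) = commonPts a b p q r \ {z} := by
  ext w
  rw [mem_crossSet, Set.mem_sdiff, Set.mem_singleton_iff]
  refine and_congr_right fun hw => ⟨?_, fun h s hs => h (tangent_unique hz hw hk hs ht)⟩
  rintro h rfl
  exact h t hk

/-- A double root at which the quadratic part is definite: the conics meet in a single point. -/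
theorem crossSet_of_definite {z : ℝ × ℝ} (hz : z ∈ commonPts a b p q r)
    (hk : IsKer a b p q r t (hom z)) (ht : 0 < (1 + t * a) * (1 - t * b)) :
    crossSet circleMat (hypMat a b p q r) = ∅ := by
  rw [crossSet_eq hz hk ht.ne', Set.sdiff_eq_empty]
  intro w hw
  have h1 := square_of_isKer hw hk
  have h2 : (1 + t * a) ^ 2 * (w.1 - z.1) ^ 2 +
      ((1 + t * a) * (1 - t * b)) * (w.2 - z.2) ^ 2 = 0 := by
    linear_combination (1 + t * a) * h1
  have hA : 0 < (1 + t * a) ^ 2 := sq_pos_of_ne_zero (left_ne_zero_of_mul ht.ne')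
  have h3 := mul_nonneg hA.le (sq_nonneg (w.1 - z.1))
  have h4 := mul_nonneg ht.le (sq_nonneg (w.2 - z.2))
  have h5 := (mul_eq_zero.1 (show (1 + t * a) ^ 2 * (w.1 - z.1) ^ 2 = 0 by linarith)).resolve_left
    hA.ne'
  have h6 := (mul_eq_zero.1 (show ((1 + t * a) * (1 - t * b)) * (w.2 - z.2) ^ 2 = 0 by
    linarith)).resolve_left ht.ne'
  exact Prod.ext (sub_eq_zero.1 (pow_eq_zero_iff two_ne_zero |>.1 h5))
    (sub_eq_zero.1 (pow_eq_zero_iff two_ne_zero |>.1 h6))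

/-- The second derivative of the determinant at a double root measures the member of the pencil
along the common tangent line. -/
theorem second_deriv_eq {z : ℝ × ℝ} (hz : z.1 ^ 2 + z.2 ^ 2 = 1)
    (hk : IsKer a b p q r t (hom z)) :
    t ^ 2 * (3 * (-a * b * r + b * p ^ 2 - a * q ^ 2) * t + ((a - b) * r + a * b - p ^ 2 - q ^ 2)) =
      -((1 + t * a) * z.2 ^ 2 + (1 - t * b) * z.1 ^ 2) := by
  obtain ⟨h1, h2, h3⟩ := isKer_hom.1 hk
  have hP : t * p = -(1 + t * a) * z.1 := by linear_combination h1
  have hQ : t * q = -(1 - t * b) * z.2 := by linear_combination h2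
  have hR : t * r = 1 + (1 + t * a) * z.1 ^ 2 + (1 - t * b) * z.2 ^ 2 := by
    linear_combination h3 - z.1 * h1 - z.2 * h2
  have e : t ^ 2 * (3 * (-a * b * r + b * p ^ 2 - a * q ^ 2) * t +
      ((a - b) * r + a * b - p ^ 2 - q ^ 2)) =
      3 * (-(t * a) * (t * b) * (t * r) + (t * b) * (t * p) ^ 2 - (t * a) * (t * q) ^ 2) +
      ((t * a - t * b) * (t * r) + (t * a) * (t * b) - (t * p) ^ 2 - (t * q) ^ 2) := by ring
  rw [e, hP, hQ, hR]
  linear_combination ((1 + t * a) + (1 - t * b) - 2 * (1 + t * a) * (1 - t * b)) * hz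

/-- A double root at which the quadratic part is indefinite: the other common points are the second
points of intersection of the circle with the two lines through the vertex `z` that make up the
singular conic. They are different from `z` unless the line is the tangent at `z`. -/
theorem commonPts_of_indefinite {z : ℝ × ℝ} (hz : z ∈ commonPts a b p q r)
    (hk : IsKer a b p q r t (hom z)) (ht : (1 + t * a) * (1 - t * b) < 0) :
    ∃ κ s₁ s₂ : ℝ, 0 < κ ∧ (1 + t * a) * κ ^ 2 + (1 - t * b) = 0 ∧
      s₁ * (κ ^ 2 + 1) = -2 * (κ * z.1 + z.2) ∧ s₂ * (κ ^ 2 + 1) = -2 * (κ * z.1 - z.2) ∧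
      commonPts a b p q r =
        {z, (z.1 + s₁ * κ, z.2 + s₁), (z.1 + s₂ * κ, z.2 - s₂)} := by
  have hA := left_ne_zero_of_mul ht.ne
  have hκ2 : 0 < -(1 - t * b) / (1 + t * a) := by
    have : -(1 - t * b) / (1 + t * a) = -((1 + t * a) * (1 - t * b)) / (1 + t * a) ^ 2 := by
      field_simp
    rw [this]
    exact div_pos (neg_pos.2 ht) (sq_pos_of_ne_zero hA)
  obtain ⟨κ, hκ, hκs⟩ : ∃ κ : ℝ, 0 < κ ∧ (1 + t * a) * κ ^ 2 + (1 - t * b) = 0 := by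
    refine ⟨√(-(1 - t * b) / (1 + t * a)), Real.sqrt_pos.2 hκ2, ?_⟩
    rw [Real.sq_sqrt hκ2.le]
    field_simp
    ring
  have hκ1 : κ ^ 2 + 1 ≠ 0 := by positivity
  have ht0 := hk.param_ne_zero
  obtain ⟨hz1, hz2⟩ := mem_commonPts.1 hz
  obtain ⟨h1, h2, h3⟩ := isKer_hom.1 hk
  refine ⟨κ, -2 * (κ * z.1 + z.2) / (κ ^ 2 + 1), -2 * (κ * z.1 - z.2) / (κ ^ 2 + 1), hκ, hκs,
    div_mul_cancel₀ _ hκ1, div_mul_cancel₀ _ hκ1, ?_⟩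
  have hs₁ := div_mul_cancel₀ (-2 * (κ * z.1 + z.2)) hκ1
  have hs₂ := div_mul_cancel₀ (-2 * (κ * z.1 - z.2)) hκ1
  generalize -2 * (κ * z.1 + z.2) / (κ ^ 2 + 1) = s₁ at *
  generalize -2 * (κ * z.1 - z.2) / (κ ^ 2 + 1) = s₂ at *
  ext w
  simp only [Set.mem_insert_iff, Set.mem_singleton_iff, Prod.ext_iff]
  constructor
  · intro hw
    have hsq := square_of_isKer hw hk
    obtain ⟨hw1, hw2⟩ := mem_commonPts.1 hw
    have hfac : (w.1 - z.1 - κ * (w.2 - z.2)) * (w.1 - z.1 + κ * (w.2 - z.2)) = 0 := by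
      apply mul_left_cancel₀ hA
      linear_combination hsq - (w.2 - z.2) ^ 2 * hκs
    rcases mul_eq_zero.1 hfac with h | h
    · have h4 : (w.2 - z.2) * ((w.2 - z.2) - s₁) = 0 := by
        apply mul_left_cancel₀ hκ1
        linear_combination hw1 - hz1 - (w.1 + z.1 + κ * (w.2 - z.2)) * h - (w.2 - z.2) * hs₁
      rcases mul_eq_zero.1 h4 with h5 | h5
      · left
        exact ⟨by linear_combination h + κ * h5, by linear_combination h5⟩
      · right; left
        exact ⟨by linear_combination h + κ * h5, by linear_combination h5⟩
    · have h4 : (w.2 - z.2) * ((w.2 - z.2) + s₂) = 0 := by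
        apply mul_left_cancel₀ hκ1
        linear_combination hw1 - hz1 - (w.1 + z.1 - κ * (w.2 - z.2)) * h + (w.2 - z.2) * hs₂
      rcases mul_eq_zero.1 h4 with h5 | h5
      · left
        exact ⟨by linear_combination h - κ * h5, by linear_combination h5⟩
      · right; right
        exact ⟨by linear_combination h - κ * h5, by linear_combination h5⟩
  · have key : ∀ w : ℝ × ℝ, w.1 ^ 2 + w.2 ^ 2 = 1 →
        (1 + t * a) * (w.1 - z.1) ^ 2 + (1 - t * b) * (w.2 - z.2) ^ 2 = 0 →
        w ∈ commonPts a b p q r := by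
      intro w hw hsq
      refine mem_commonPts.2 ⟨hw, ?_⟩
      apply (mul_eq_zero.1 (?_ : t * _ = 0)).resolve_left ht0
      linear_combination hsq - hw + (2 * w.1 - z.1) * h1 + (2 * w.2 - z.2) * h2 + h3
    rintro (⟨e1, e2⟩ | ⟨e1, e2⟩ | ⟨e1, e2⟩)
    · exact (Prod.ext e1 e2 : w = z) ▸ hz
    · refine key w ?_ ?_
      · rw [e1, e2]; linear_combination hz1 + s₁ * hs₁
      · rw [e1, e2]; linear_combination s₁ ^ 2 * hκs
    · refine key w ?_ ?_
      · rw [e1, e2]; linear_combination hz1 + s₂ * hs₂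
      · rw [e1, e2]; linear_combination s₂ ^ 2 * hκs

/-- Two further points of intersection if the root is only double. -/
theorem crossSet_of_indefinite {z : ℝ × ℝ} (hz : z ∈ commonPts a b p q r)
    (hk : IsKer a b p q r t (hom z)) (ht : (1 + t * a) * (1 - t * b) < 0)
    (hF'' : 3 * (-a * b * r + b * p ^ 2 - a * q ^ 2) * t +
      ((a - b) * r + a * b - p ^ 2 - q ^ 2) ≠ 0) :
    (crossSet circleMat (hypMat a b p q r)).encard = 2 := by
  obtain ⟨κ, s₁, s₂, hκ, hκs, hs₁, hs₂, hc⟩ := commonPts_of_indefinite hz hk ht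
  have h2 := second_deriv_eq (mem_commonPts.1 hz).1 hk
  have hprod : (κ * z.1 + z.2) * (κ * z.1 - z.2) ≠ 0 := by
    intro h
    refine mul_ne_zero (pow_ne_zero 2 hk.param_ne_zero) hF'' (h2.trans ?_)
    linear_combination (1 + t * a) * h - z.1 ^ 2 * hκs
  have h₁ : s₁ ≠ 0 := by
    rintro rfl
    exact left_ne_zero_of_mul hprod (by linarith)
  have h₂ : s₂ ≠ 0 := by
    rintro rfl
    exact right_ne_zero_of_mul hprod (by linarith)
  have hne : ((z.1 + s₁ * κ, z.2 + s₁) : ℝ × ℝ) ≠ (z.1 + s₂ * κ, z.2 - s₂) := by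
    intro h
    obtain ⟨e1, e2⟩ := Prod.ext_iff.1 h
    simp only at e1 e2
    have : s₁ = s₂ := mul_right_cancel₀ hκ.ne' (by linarith)
    exact h₁ (by linarith)
  rw [crossSet_eq hz hk ht.ne, hc, Set.insert_sdiff_of_mem _ (Set.mem_singleton z),
    Set.sdiff_singleton_eq_self, Set.encard_pair hne]
  simp only [Set.mem_insert_iff, Set.mem_singleton_iff, not_or]
  constructor <;> intro h <;> obtain ⟨-, e2⟩ := Prod.ext_iff.1 h <;> simp only at e2
  · exact h₁ (by linarith)
  · exact h₂ (by linarith)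

/-- One further point of intersection if the root is triple. -/
theorem crossSet_of_triple {z : ℝ × ℝ} (hz : z ∈ commonPts a b p q r)
    (hk : IsKer a b p q r t (hom z)) (ht : (1 + t * a) * (1 - t * b) < 0)
    (hF'' : 3 * (-a * b * r + b * p ^ 2 - a * q ^ 2) * t +
      ((a - b) * r + a * b - p ^ 2 - q ^ 2) = 0) :
    (crossSet circleMat (hypMat a b p q r)).encard = 1 := by
  obtain ⟨κ, s₁, s₂, hκ, hκs, hs₁, hs₂, hc⟩ := commonPts_of_indefinite hz hk ht
  have hz1 := (mem_commonPts.1 hz).1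
  have h2 := second_deriv_eq hz1 hk
  have hκ1 : κ ^ 2 + 1 ≠ 0 := by positivity
  rw [hF'', mul_zero] at h2
  have hprod : (κ * z.1 + z.2) * (κ * z.1 - z.2) = 0 := by
    apply mul_left_cancel₀ (left_ne_zero_of_mul ht.ne)
    linear_combination z.1 ^ 2 * hκs - h2
  -- the two lines cannot both be tangent
  have hboth : ¬ (κ * z.1 + z.2 = 0 ∧ κ * z.1 - z.2 = 0) := by
    rintro ⟨h, h'⟩
    have e2 : z.2 = 0 := by linarith
    have e1 : z.1 = 0 := by
      have : κ * z.1 = 0 := by linarith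
      exact (mul_eq_zero.1 this).resolve_left hκ.ne'
    rw [e1, e2] at hz1
    norm_num at hz1
  rw [crossSet_eq hz hk ht.ne, hc, Set.insert_sdiff_of_mem _ (Set.mem_singleton z), Set.encard_eq_one]
  rcases mul_eq_zero.1 hprod with h | h
  · have e₁ : s₁ = 0 := (mul_eq_zero.1 (hs₁.trans (by rw [h, mul_zero]))).resolve_right hκ1
    have e₂ : s₂ ≠ 0 := by
      rintro rfl
      exact hboth ⟨h, by linarith⟩
    refine ⟨(z.1 + s₂ * κ, z.2 - s₂), ?_⟩
    rw [e₁]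
    ext w
    simp only [Set.mem_sdiff, Set.mem_insert_iff, Set.mem_singleton_iff, zero_mul, add_zero]
    constructor
    · rintro ⟨h3 | h3, h4⟩
      · exact absurd h3 h4
      · exact h3
    · intro h3
      refine ⟨Or.inr h3, fun h4 => e₂ ?_⟩
      rw [h3] at h4
      have := congrArg Prod.snd h4
      simp only at this
      linarith
  · have e₂ : s₂ = 0 := (mul_eq_zero.1 (hs₂.trans (by rw [h, mul_zero]))).resolve_right hκ1
    have e₁ : s₁ ≠ 0 := by
      rintro rfl
      exact hboth ⟨by linarith, h⟩
    refine ⟨(z.1 + s₁ * κ, z.2 + s₁), ?_⟩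
    rw [e₂]
    ext w
    simp only [Set.mem_sdiff, Set.mem_insert_iff, Set.mem_singleton_iff, zero_mul, add_zero,
      sub_zero]
    constructor
    · rintro ⟨h3 | h3, h4⟩
      · exact h3
      · exact absurd h3 h4
    · intro h3
      refine ⟨Or.inl h3, fun h4 => e₁ ?_⟩
      rw [h3] at h4
      have := congrArg Prod.snd h4
      simp only at this
      linarith

end

/-! ### A member of the pencil of rank one: bitangency and contact of order four -/

section

variable {a b p q r t : ℝ}

/-- If all common points are singular points of the same member of the pencil, then there are no
others. -/
theorem contact_of_forall_isKer (hk : ∀ z ∈ commonPts a b p q r, IsKer a b p q r t (hom z)) :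
    crossSet circleMat (hypMat a b p q r) = ∅ ∧
      ∀ S : ℝ → Prop, (S t → singSet circleMat (hypMat a b p q r) S = commonPts a b p q r) ∧
        (¬ S t → singSet circleMat (hypMat a b p q r) S = ∅) := by
  refine ⟨?_, fun S => ⟨fun hS => ?_, fun hS => ?_⟩⟩
  · rw [Set.eq_empty_iff_forall_notMem]
    intro z hz
    exact (mem_crossSet.1 hz).2 t (hk z (mem_crossSet.1 hz).1)
  · ext z
    rw [mem_singSet]
    exact ⟨fun h => h.1, fun h => ⟨h, t, hS, hk z h⟩⟩
  · rw [Set.eq_empty_iff_forall_notMem]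
    intro z hz
    obtain ⟨hz, s, hs, hs'⟩ := mem_singSet.1 hz
    exact hS (hs'.param_unique (hk z hz) ▸ hs)

/-- A double root at the negative pole: the hyperbola is
`a (x² + y² - 1) = (a + b) (y - y₀)²`, and the position of the line `y = y₀` is read off from the
third root `w`. -/
theorem double_root_neg_pole (ha : 0 < a) (hb : 0 < b) (ht : 1 + t * a = 0)
    (hF : charPoly a b p q r t = 0) (hF' : charDeriv a b p q r t = 0) {w : ℝ} (hw : w < 0)
    (hw' : (-a * b * r + b * p ^ 2 - a * q ^ 2) * t ^ 2 * w = 1) :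
    ∃ y : ℝ, commonPts a b p q r = {z | z.1 ^ 2 + z.2 ^ 2 = 1 ∧ z.2 = y} ∧
      (∀ z ∈ commonPts a b p q r, IsKer a b p q r t (hom z)) ∧
      (w < t → y ^ 2 < 1) ∧ (w = t → y ^ 2 = 1) := by
  have hab : a + b ≠ 0 := by positivity
  have htb : 0 < 1 - t * b := by nlinarith
  have htn : t < 0 := by nlinarith
  have hp : p = 0 := by
    have h1 := pencil_square (a := a) (b := b) (p := p) (q := q) (r := r) (t := t) (0, 0)
    rw [hF, ht] at h1
    have h2 : (1 - t * b) * (t * p) ^ 2 = 0 := by linear_combination -h1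
    have h3 := (pow_eq_zero_iff two_ne_zero).1 ((mul_eq_zero.1 h2).resolve_left htb.ne')
    exact (mul_eq_zero.1 h3).resolve_left htn.ne
  subst hp
  obtain ⟨y, rfl⟩ : ∃ y, q = (a + b) * y := ⟨q / (a + b), by field_simp⟩
  -- the derivative is `a` times the determinant of the remaining block
  have hG : (1 - t * b) * (t * r - 1) - t ^ 2 * ((a + b) * y) ^ 2 = 0 := by
    apply mul_left_cancel₀ ha.ne'
    rw [charDeriv] at hF'
    linear_combination hF' - (r - 2 * b * r * t + b - 2 * ((a + b) * y) ^ 2 * t) * ht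
  have hta : t = -a⁻¹ := by field_simp; linarith
  have hr : r = -a - (a + b) * y ^ 2 := by
    rw [hta] at hG
    field_simp at hG
    apply mul_left_cancel₀ hab
    linear_combination -hG
  subst hr
  have hwy : w * ((a + b) * y ^ 2 - b) = -1 := by
    rw [hta] at hw'
    field_simp at hw'
    apply mul_left_cancel₀ (pow_ne_zero 2 ha.ne')
    linear_combination -hw'
  have hkey : commonPts a b 0 ((a + b) * y) (-a - (a + b) * y ^ 2) =
      {z | z.1 ^ 2 + z.2 ^ 2 = 1 ∧ z.2 = y} := by
    ext z
    rw [mem_commonPts, Set.mem_ofPred_eq]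
    refine and_congr_right fun h => ⟨fun h' => ?_, fun h' => ?_⟩
    · have : (a + b) * (z.2 - y) ^ 2 = 0 := by linear_combination a * h - h'
      exact sub_eq_zero.1 ((pow_eq_zero_iff two_ne_zero).1 ((mul_eq_zero.1 this).resolve_left hab))
    · rw [h'] at h ⊢
      linear_combination a * h
  refine ⟨y, hkey, fun z hz => ?_, fun h => ?_, fun h => ?_⟩
  · rw [hkey] at hz
    obtain ⟨h1, h2⟩ := hz
    refine isKer_hom.2 ⟨by rw [ht]; ring, ?_, ?_⟩
    · rw [h2]; linear_combination y * ht
    · rw [h2]; linear_combination -ht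
  · by_contra! hc
    have h1 : a ≤ (a + b) * y ^ 2 - b := by nlinarith
    have h2 := mul_le_mul_of_nonpos_left h1 hw.le
    have h3 := mul_lt_mul_of_pos_right h ha
    linarith
  · rw [h] at hwy
    apply mul_left_cancel₀ (mul_ne_zero htn.ne hab)
    linear_combination hwy - ht

/-- A double root at the positive pole: the hyperbola is
`b (x² + y² - 1) = (a + b) (x - x₀)²`, and the line `x = x₀` meets the circle in two points. -/
theorem double_root_pos_pole (ha : 0 < a) (hb : 0 < b) (ht : 1 - t * b = 0)
    (hL : -a * b * r + b * p ^ 2 - a * q ^ 2 < 0)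
    (hF : charPoly a b p q r t = 0) (hF' : charDeriv a b p q r t = 0) :
    ∃ x : ℝ, commonPts a b p q r = {z | z.1 ^ 2 + z.2 ^ 2 = 1 ∧ z.1 = x} ∧
      (∀ z ∈ commonPts a b p q r, IsKer a b p q r t (hom z)) ∧ x ^ 2 < 1 := by
  have hab : a + b ≠ 0 := by positivity
  have htn : 0 < t := by nlinarith
  have hta' : 0 < 1 + t * a := by positivity
  have hq : q = 0 := by
    have h1 := pencil_square (a := a) (b := b) (p := p) (q := q) (r := r) (t := t) (0, 0)
    rw [hF, ht] at h1
    have h2 : (1 + t * a) * (t * q) ^ 2 = 0 := by linear_combination -h1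
    have h3 := (pow_eq_zero_iff two_ne_zero).1 ((mul_eq_zero.1 h2).resolve_left hta'.ne')
    exact (mul_eq_zero.1 h3).resolve_left htn.ne'
  subst hq
  obtain ⟨x, rfl⟩ : ∃ x, p = -((a + b) * x) := ⟨-p / (a + b), by field_simp⟩
  have htb : t = b⁻¹ := by field_simp; linarith
  have hr : r = b + (a + b) * x ^ 2 := by
    -- the derivative is `-b` times the determinant of the remaining block
    have hK : (1 + t * a) * (t * r - 1) - t ^ 2 * ((a + b) * x) ^ 2 = 0 := by
      apply mul_left_cancel₀ hb.ne'
      rw [charDeriv] at hF'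
      linear_combination -hF' + (a * (t * r - 1) + (1 + t * a) * r - 2 * t * ((a + b) * x) ^ 2) * ht
    rw [htb] at hK
    field_simp at hK
    apply mul_left_cancel₀ hab
    linear_combination hK
  subst hr
  have hkey : commonPts a b (-((a + b) * x)) 0 (b + (a + b) * x ^ 2) =
      {z | z.1 ^ 2 + z.2 ^ 2 = 1 ∧ z.1 = x} := by
    ext z
    rw [mem_commonPts, Set.mem_ofPred_eq]
    refine and_congr_right fun h => ⟨fun h' => ?_, fun h' => ?_⟩
    · have : (a + b) * (z.1 - x) ^ 2 = 0 := by linear_combination b * h + h'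
      exact sub_eq_zero.1 ((pow_eq_zero_iff two_ne_zero).1 ((mul_eq_zero.1 this).resolve_left hab))
    · rw [h'] at h ⊢
      linear_combination -b * h
  refine ⟨x, hkey, fun z hz => ?_, ?_⟩
  · rw [hkey] at hz
    obtain ⟨h1, h2⟩ := hz
    refine isKer_hom.2 ⟨?_, by rw [ht]; ring, ?_⟩
    · rw [h2]; linear_combination x * ht
    · rw [h2]; linear_combination -ht
  · have h1 : b ^ 2 * ((a + b) * x ^ 2 - a) < 0 := by nlinarith
    have h2 : (a + b) * x ^ 2 - a < 0 := by
      by_contra! hc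
      exact h1.not_ge (mul_nonneg (sq_nonneg b) hc)
    have h3 : 0 < a + b := by positivity
    nlinarith

theorem encard_circle_horizontal {y : ℝ} :
    (y ^ 2 < 1 → {z : ℝ × ℝ | z.1 ^ 2 + z.2 ^ 2 = 1 ∧ z.2 = y}.encard = 2) ∧
      (y ^ 2 = 1 → {z : ℝ × ℝ | z.1 ^ 2 + z.2 ^ 2 = 1 ∧ z.2 = y}.encard = 1) := by
  constructor
  · intro h
    have h0 : 0 < 1 - y ^ 2 := by linarith
    have hs := Real.sqrt_pos.2 h0
    have hs2 := Real.sq_sqrt h0.le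
    refine Set.encard_eq_two.2 ⟨(√(1 - y ^ 2), y), (-√(1 - y ^ 2), y), ?_, ?_⟩
    · intro h
      have := congrArg Prod.fst h
      simp only at this
      linarith
    · ext z
      simp only [Set.mem_ofPred_eq, Set.mem_insert_iff, Set.mem_singleton_iff, Prod.ext_iff,
        ← or_and_right]
      refine and_congr_left fun hz => ?_
      rw [hz, ← sq_eq_sq_iff_eq_or_eq_neg, hs2]
      constructor <;> intro h <;> linarith
  · intro h
    refine Set.encard_eq_one.2 ⟨(0, y), ?_⟩
    ext z
    simp only [Set.mem_ofPred_eq, Set.mem_singleton_iff, Prod.ext_iff]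
    refine and_congr_left fun hz => ?_
    rw [hz, h, add_eq_right, sq_eq_zero_iff]

theorem encard_circle_vertical {x : ℝ} (h : x ^ 2 < 1) :
    {z : ℝ × ℝ | z.1 ^ 2 + z.2 ^ 2 = 1 ∧ z.1 = x}.encard = 2 := by
  rw [← encard_circle_horizontal.1 h, ← Set.encard_preimage_of_bijective Prod.swap_bijective]
  congr 1
  ext z
  simp [add_comm]

/-! ### Simple roots: simultaneous diagonalisation -/

/-- The affine point with homogeneous coordinates `v`. -/
noncomputable def toPt (v : Fin 3 → ℝ) : ℝ × ℝ := (v 0 / v 2, v 1 / v 2)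

theorem hom_toPt {v : Fin 3 → ℝ} (h : v 2 ≠ 0) : hom (toPt v) = (v 2)⁻¹ • v := by
  ext i
  fin_cases i <;> simp [hom, toPt, h, div_eq_inv_mul]

theorem toPt_eq_of_hom {v : Fin 3 → ℝ} {z : ℝ × ℝ} {c : ℝ} (h : hom z = c • v) :
    z = toPt v := by
  have h2 : c * v 2 = 1 := by simpa [hom] using (congrFun h 2).symm
  have h0 : z.1 = c * v 0 := by simpa [hom] using congrFun h 0
  have h1 : z.2 = c * v 1 := by simpa [hom] using congrFun h 1
  have hv : v 2 ≠ 0 := right_ne_zero_of_mul (h2 ▸ one_ne_zero)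
  refine Prod.ext ?_ ?_
  · rw [h0, toPt, eq_div_iff hv]
    linear_combination v 0 * h2
  · rw [h1, toPt, eq_div_iff hv]
    linear_combination v 1 * h2

theorem bilE_null {v : Fin 3 → ℝ} (h : bilE v v = 0) (hv : v ≠ 0) : v 2 ≠ 0 := by
  intro h2
  rw [bilE, h2] at h
  have h0 : v 0 = 0 := by nlinarith
  have h1 : v 1 = 0 := by nlinarith
  exact hv (by ext i; fin_cases i <;> simp [h0, h1, h2])

theorem toPt_mem_commonPts {v : Fin 3 → ℝ} (hE : bilE v v = 0) (hN : bilN a b p q r v v = 0)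
    (hv : v ≠ 0) : toPt v ∈ commonPts a b p q r := by
  rw [mem_commonPts_iff_bil, hom_toPt (bilE_null hE hv)]
  constructor
  · rw [bilE] at *
    simp only [Pi.smul_apply, smul_eq_mul]
    linear_combination (v 2)⁻¹ ^ 2 * hE
  · rw [bilN] at *
    simp only [Pi.smul_apply, smul_eq_mul]
    linear_combination (v 2)⁻¹ ^ 2 * hN

/-- Three independent vectors of `ℝ³` span it. -/
theorem exists_coords {u v w : Fin 3 → ℝ}
    (h : ∀ x y z : ℝ, x • u + y • v + z • w = 0 → x = 0 ∧ y = 0 ∧ z = 0) (X : Fin 3 → ℝ) :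
    ∃ x y z : ℝ, X = x • u + y • v + z • w := by
  have hP : ∀ c : Fin 3 → ℝ, (of ![u, v, w])ᵀ *ᵥ c = c 0 • u + c 1 • v + c 2 • w := by
    intro c
    ext i
    simp [mulVec, dotProduct, Fin.sum_univ_three, mul_comm]
  have hinj : Function.Injective ((of ![u, v, w])ᵀ).mulVecLin := by
    rw [← LinearMap.ker_eq_bot, LinearMap.ker_eq_bot']
    intro c hc
    rw [mulVecLin_apply, hP] at hc
    obtain ⟨h0, h1, h2⟩ := h _ _ _ hc
    ext i
    fin_cases i <;> simp [h0, h1, h2]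
  obtain ⟨c, hc⟩ := LinearMap.injective_iff_surjective.1 hinj X
  rw [mulVecLin_apply, hP] at hc
  exact ⟨c 0, c 1, c 2, hc.symm⟩

theorem bilE_comb (x y z : ℝ) (u v w : Fin 3 → ℝ) :
    bilE (x • u + y • v + z • w) (x • u + y • v + z • w) =
      x ^ 2 * bilE u u + y ^ 2 * bilE v v + z ^ 2 * bilE w w + 2 * x * y * bilE u v +
        2 * x * z * bilE u w + 2 * y * z * bilE v w := by
  simp only [bilE, Pi.add_apply, Pi.smul_apply, smul_eq_mul]
  ring

theorem bilN_comb (x y z : ℝ) (u v w : Fin 3 → ℝ) :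
    bilN a b p q r (x • u + y • v + z • w) (x • u + y • v + z • w) =
      x ^ 2 * bilN a b p q r u u + y ^ 2 * bilN a b p q r v v + z ^ 2 * bilN a b p q r w w +
        2 * x * y * bilN a b p q r u v + 2 * x * z * bilN a b p q r u w +
        2 * y * z * bilN a b p q r v w := by
  simp only [bilN, Pi.add_apply, Pi.smul_apply, smul_eq_mul]
  ring

theorem bilE_comb_left (x y z : ℝ) (u v w s : Fin 3 → ℝ) :
    bilE (x • u + y • v + z • w) s = x * bilE u s + y * bilE v s + z * bilE w s := by
  simp only [bilE, Pi.add_apply, Pi.smul_apply, smul_eq_mul]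
  ring

theorem bilN_comb_left (x y z : ℝ) (u v w s : Fin 3 → ℝ) :
    bilN a b p q r (x • u + y • v + z • w) s =
      x * bilN a b p q r u s + y * bilN a b p q r v s + z * bilN a b p q r w s := by
  simp only [bilN, Pi.add_apply, Pi.smul_apply, smul_eq_mul]
  ring

theorem bilE_smul (c : ℝ) (u v : Fin 3 → ℝ) :
    bilE (c • u) v = c * bilE u v ∧ bilE u (c • v) = c * bilE u v := by
  simp only [bilE, Pi.smul_apply, smul_eq_mul]
  constructor <;> ring

theorem bilN_smul (c : ℝ) (u v : Fin 3 → ℝ) :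
    bilN a b p q r (c • u) v = c * bilN a b p q r u v ∧
      bilN a b p q r u (c • v) = c * bilN a b p q r u v := by
  simp only [bilN, Pi.smul_apply, smul_eq_mul]
  constructor <;> ring

/-- The sign attached to a Boolean. -/
def boolSign (s : Bool) : ℝ := if s then 1 else -1

theorem boolSign_sq (s : Bool) : boolSign s ^ 2 = 1 := by cases s <;> norm_num [boolSign]

theorem boolSign_injective : Function.Injective boolSign := by
  intro s t
  cases s <;> cases t <;> norm_num [boolSign]

theorem exists_boolSign {x y : ℝ} (h : x ^ 2 = y ^ 2) : ∃ s, x = y * boolSign s := by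
  rcases sq_eq_sq_iff_eq_or_eq_neg.1 h with h | h
  · exact ⟨true, by simp [boolSign, h]⟩
  · exact ⟨false, by simp [boolSign, h]⟩

/-- Four common points, given a basis that diagonalises both conics and is scaled in such a way
that `u + v + w` is a common point. -/
theorem encard_commonPts_eq_four {u v w : Fin 3 → ℝ}
    (h12 : bilE u v = 0) (h13 : bilE u w = 0) (h23 : bilE v w = 0)
    (n12 : bilN a b p q r u v = 0) (n13 : bilN a b p q r u w = 0) (n23 : bilN a b p q r v w = 0)
    (hu : bilE u u ≠ 0) (hv : bilE v v ≠ 0) (hw : bilE w w ≠ 0)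
    (hE : bilE u u + bilE v v + bilE w w = 0)
    (hN : bilN a b p q r u u + bilN a b p q r v v + bilN a b p q r w w = 0)
    (hd : bilE u u * bilN a b p q r v v - bilE v v * bilN a b p q r u u ≠ 0) :
    (commonPts a b p q r).encard = 4 := by
  have hind : ∀ x y z : ℝ, x • u + y • v + z • w = 0 → x = 0 ∧ y = 0 ∧ z = 0 := by
    intro x y z h
    have h1 := bilE_comb_left x y z u v w u
    have h2 := bilE_comb_left x y z u v w v
    have h3 := bilE_comb_left x y z u v w w
    have h0 : ∀ s : Fin 3 → ℝ, bilE 0 s = 0 := by simp [bilE]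
    rw [h, h0] at h1 h2 h3
    rw [bilE_comm v u, bilE_comm w u, h12, h13] at h1
    rw [bilE_comm w v, h12, h23] at h2
    rw [h13, h23] at h3
    exact ⟨(mul_eq_zero.1 (by linarith)).resolve_right hu,
      (mul_eq_zero.1 (by linarith)).resolve_right hv,
      (mul_eq_zero.1 (by linarith)).resolve_right hw⟩
  let W : Bool × Bool → Fin 3 → ℝ := fun s => boolSign s.1 • u + boolSign s.2 • v + (1 : ℝ) • w
  have hW0 : ∀ s, W s ≠ 0 := fun s h => one_ne_zero (hind _ _ _ h).2.2
  have hWE : ∀ s, bilE (W s) (W s) = 0 := by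
    intro s
    rw [bilE_comb, h12, h13, h23, boolSign_sq, boolSign_sq]
    linear_combination hE
  have hWN : ∀ s, bilN a b p q r (W s) (W s) = 0 := by
    intro s
    rw [bilN_comb, n12, n13, n23, boolSign_sq, boolSign_sq]
    linear_combination hN
  have hrange : commonPts a b p q r = Set.range fun s => toPt (W s) := by
    ext z
    constructor
    · intro hz
      obtain ⟨zE, zN⟩ := mem_commonPts_iff_bil.1 hz
      obtain ⟨x, y, c, hc⟩ := exists_coords hind (hom z)
      rw [hc, bilE_comb, h12, h13, h23] at zE
      rw [hc, bilN_comb, n12, n13, n23] at zN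
      have hx : x ^ 2 = c ^ 2 := by
        apply mul_left_cancel₀ hd
        linear_combination bilN a b p q r v v * zE - bilE v v * zN -
          c ^ 2 * bilN a b p q r v v * hE + c ^ 2 * bilE v v * hN
      have hy : y ^ 2 = c ^ 2 := by
        apply mul_left_cancel₀ hd
        linear_combination bilE u u * zN - bilN a b p q r u u * zE -
          c ^ 2 * bilE u u * hN + c ^ 2 * bilN a b p q r u u * hE
      obtain ⟨s, rfl⟩ := exists_boolSign hx
      obtain ⟨s', rfl⟩ := exists_boolSign hy
      refine ⟨(s, s'), (toPt_eq_of_hom (c := c) ?_).symm⟩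
      rw [hc]
      simp only [W, smul_add, smul_smul, mul_one]
    · rintro ⟨s, rfl⟩
      exact toPt_mem_commonPts (hWE s) (hWN s) (hW0 s)
  have hinj : Function.Injective fun s => toPt (W s) := by
    intro s s' h
    have h1 := congrArg hom (show toPt (W s) = toPt (W s') from h)
    rw [hom_toPt (bilE_null (hWE s) (hW0 s)), hom_toPt (bilE_null (hWE s') (hW0 s'))] at h1
    set c := (W s 2)⁻¹
    set c' := (W s' 2)⁻¹
    have h2 : (c * boolSign s.1 - c' * boolSign s'.1) • u +
        (c * boolSign s.2 - c' * boolSign s'.2) • v + (c - c') • w = 0 := by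
      have := sub_eq_zero.2 h1
      rw [← this]
      simp only [W]
      module
    obtain ⟨e1, e2, e3⟩ := hind _ _ _ h2
    have hc : c ≠ 0 := inv_ne_zero (bilE_null (hWE s) (hW0 s))
    rw [← sub_eq_zero.1 e3, ← mul_sub] at e1 e2
    exact Prod.ext (boolSign_injective (sub_eq_zero.1 ((mul_eq_zero.1 e1).resolve_left hc)))
      (boolSign_injective (sub_eq_zero.1 ((mul_eq_zero.1 e2).resolve_left hc)))
  rw [hrange, ← Set.image_univ, hinj.encard_image, Set.encard_univ]
  simp

/-- Four common points, given three conjugate vectors in the kernels of three members of the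
pencil, if the one of negative sign belongs to the middle one of the numbers `1 / t`. -/
theorem encard_commonPts_of_kernels {t₁ t₂ t₃ : ℝ} {u v w : Fin 3 → ℝ}
    (hu : IsKer a b p q r t₁ u) (hv : IsKer a b p q r t₂ v) (hw : IsKer a b p q r t₃ w)
    (h₁ : t₁ ≠ 0) (h₂ : t₂ ≠ 0) (h₃ : t₃ ≠ 0) (hu0 : 0 < bilE u u) (hv0 : 0 < bilE v v)
    (hw0 : bilE w w < 0) (hm : 0 < (t₃⁻¹ - t₂⁻¹) * (t₁⁻¹ - t₃⁻¹)) :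
    (commonPts a b p q r).encard = 4 := by
  have h32 : t₃⁻¹ - t₂⁻¹ ≠ 0 := left_ne_zero_of_mul hm.ne'
  have h13 : t₁⁻¹ - t₃⁻¹ ≠ 0 := right_ne_zero_of_mul hm.ne'
  have h12 : t₁⁻¹ - t₂⁻¹ ≠ 0 := by
    intro h
    rw [sub_eq_zero.1 h] at hm
    nlinarith [sq_nonneg (t₃⁻¹ - t₂⁻¹)]
  have n12 : t₁ ≠ t₂ := by rintro rfl; simp at h12
  have n13 : t₁ ≠ t₃ := by rintro rfl; simp at h13
  have n23 : t₂ ≠ t₃ := by rintro rfl; simp at h32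
  have hN : ∀ {t : ℝ} {x : Fin 3 → ℝ}, IsKer a b p q r t x → t ≠ 0 →
      bilN a b p q r x x = -t⁻¹ * bilE x x := by
    intro t x hx ht
    rw [hx.bilE_eq x]
    field_simp
  have nu := hN hu h₁
  have nv := hN hv h₂
  have nw := hN hw h₃
  generalize t₁⁻¹ = ρ₁ at *
  generalize t₂⁻¹ = ρ₂ at *
  generalize t₃⁻¹ = ρ₃ at *
  -- the scaling that makes `α u + β v + w` a common point
  have hα : 0 < -(bilE w w) * (ρ₃ - ρ₂) / (bilE u u * (ρ₁ - ρ₂)) := by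
    have : -(bilE w w) * (ρ₃ - ρ₂) / (bilE u u * (ρ₁ - ρ₂)) =
        -(bilE w w) * ((ρ₃ - ρ₂) ^ 2 + (ρ₃ - ρ₂) * (ρ₁ - ρ₃)) / (bilE u u * (ρ₁ - ρ₂) ^ 2) := by
      field_simp
      ring
    rw [this]
    have := sq_pos_of_ne_zero h12
    have := neg_pos.2 hw0
    positivity
  have hβ : 0 < -(bilE w w) * (ρ₁ - ρ₃) / (bilE v v * (ρ₁ - ρ₂)) := by
    have : -(bilE w w) * (ρ₁ - ρ₃) / (bilE v v * (ρ₁ - ρ₂)) =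
        -(bilE w w) * ((ρ₁ - ρ₃) ^ 2 + (ρ₃ - ρ₂) * (ρ₁ - ρ₃)) / (bilE v v * (ρ₁ - ρ₂) ^ 2) := by
      field_simp
      ring
    rw [this]
    have := sq_pos_of_ne_zero h12
    have := neg_pos.2 hw0
    positivity
  obtain ⟨α, hα0, hαs⟩ : ∃ α : ℝ, α ≠ 0 ∧
      α ^ 2 * (bilE u u * (ρ₁ - ρ₂)) = -(bilE w w) * (ρ₃ - ρ₂) := by
    refine ⟨_, (Real.sqrt_pos.2 hα).ne', ?_⟩
    rw [Real.sq_sqrt hα.le, div_mul_cancel₀ _ (mul_ne_zero hu0.ne' h12)]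
  obtain ⟨β, hβ0, hβs⟩ : ∃ β : ℝ, β ≠ 0 ∧
      β ^ 2 * (bilE v v * (ρ₁ - ρ₂)) = -(bilE w w) * (ρ₁ - ρ₃) := by
    refine ⟨_, (Real.sqrt_pos.2 hβ).ne', ?_⟩
    rw [Real.sq_sqrt hβ.le, div_mul_cancel₀ _ (mul_ne_zero hv0.ne' h12)]
  obtain ⟨e12, f12⟩ := hu.orthogonal hv n12
  obtain ⟨e13, f13⟩ := hu.orthogonal hw n13
  obtain ⟨e23, f23⟩ := hv.orthogonal hw n23
  apply encard_commonPts_eq_four (u := α • u) (v := β • v) (w := w) <;>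
    try simp only [bilE_smul, bilN_smul, e12, e13, e23, f12, f13, f23, nu, nv, nw, mul_zero]
  · exact mul_ne_zero hα0 (mul_ne_zero hα0 hu0.ne')
  · exact mul_ne_zero hβ0 (mul_ne_zero hβ0 hv0.ne')
  · exact hw0.ne
  · apply mul_left_cancel₀ h12
    linear_combination hαs + hβs
  · apply mul_left_cancel₀ h12
    linear_combination -ρ₁ * hαs - ρ₂ * hβs
  · have : α * (α * bilE u u) * (β * (β * (-ρ₂ * bilE v v))) -
        β * (β * bilE v v) * (α * (α * (-ρ₁ * bilE u u))) =
        α ^ 2 * β ^ 2 * bilE u u * bilE v v * (ρ₁ - ρ₂) := by ring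
    rw [this]
    exact mul_ne_zero (mul_ne_zero (mul_ne_zero (mul_ne_zero (pow_ne_zero 2 hα0)
      (pow_ne_zero 2 hβ0)) hu0.ne') hv0.ne') h12

/-- A kernel vector at a root of the determinant, with the value of `N` on it: a coordinate vector
at the poles, and `N(v)` times the cofactor is the derivative elsewhere. -/
theorem exists_isKer (ha : 0 < a) (hb : 0 < b) (hF : charPoly a b p q r t = 0) :
    ∃ v, IsKer a b p q r t v ∧ (((1 + t * a) * (1 - t * b) = 0 ∧ 0 < bilE v v) ∨
      ((1 + t * a) * (1 - t * b) ≠ 0 ∧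
        (1 + t * a) * (1 - t * b) * bilN a b p q r v v = charDeriv a b p q r t)) := by
  have hsq := pencil_square (a := a) (b := b) (p := p) (q := q) (r := r) (t := t) (0, 0)
  rw [hF] at hsq
  simp only [mul_zero, zero_add, add_zero] at hsq
  by_cases hA : 1 + t * a = 0
  · have hB : 1 - t * b ≠ 0 := by
      intro hB
      have : a + b = 0 := by linear_combination b * hA + a * hB
      linarith
    rw [hA] at hsq
    have h1 : (1 - t * b) * (t * p) ^ 2 = 0 := by linear_combination -hsq
    have h2 := (pow_eq_zero_iff two_ne_zero).1 ((mul_eq_zero.1 h1).resolve_left hB)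
    refine ⟨![1, 0, 0], ⟨by simp [hA], by simp, by simpa using h2⟩, Or.inl ⟨by simp [hA], ?_⟩⟩
    simp [bilE]
  · by_cases hB : 1 - t * b = 0
    · rw [hB] at hsq
      have h1 : (1 + t * a) * (t * q) ^ 2 = 0 := by linear_combination -hsq
      have h2 := (pow_eq_zero_iff two_ne_zero).1 ((mul_eq_zero.1 h1).resolve_left hA)
      refine ⟨![0, 1, 0], ⟨by simp, by simp [hB], by simpa using h2⟩, Or.inl ⟨by simp [hB], ?_⟩⟩
      simp [bilE]
    · have ht := mul_ne_zero hA hB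
      obtain ⟨x, hx⟩ : ∃ x, (1 + t * a) * x + t * p = 0 :=
        ⟨-(t * p) / (1 + t * a), by field_simp; ring⟩
      obtain ⟨y, hy⟩ : ∃ y, (1 - t * b) * y + t * q = 0 :=
        ⟨-(t * q) / (1 - t * b), by field_simp; ring⟩
      have h3 : t * (p * x + q * y + r) = 1 := by
        apply mul_left_cancel₀ ht
        rw [charPoly] at hF
        linear_combination hF + (1 - t * b) * (t * p) * hx + (1 + t * a) * (t * q) * hy
      have hk : IsKer a b p q r t (hom (x, y)) := isKer_hom.2 ⟨hx, hy, h3⟩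
      refine ⟨_, hk, Or.inr ⟨ht, ?_⟩⟩
      rw [(charPoly_of_isKer hk).2]
      congr 1
      simp only [bilN, hom, cons_val_zero, cons_val_one, cons_val]
      ring

/-- At a root where the quadratic part is not definite, the sign of the form of the circle on the kernel
is that of `t F'(t)`, because it is `-t` times the value of `N` there. -/
theorem exists_isKer_pos (ha : 0 < a) (hb : 0 < b) (hF : charPoly a b p q r t = 0)
    (ht : (1 + t * a) * (1 - t * b) ≤ 0) (hF' : 0 < t * charDeriv a b p q r t) :
    ∃ v, IsKer a b p q r t v ∧ 0 < bilE v v := by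
  obtain ⟨v, hv, ⟨-, h⟩ | ⟨h0, h⟩⟩ := exists_isKer ha hb hF
  · exact ⟨v, hv, h⟩
  · refine ⟨v, hv, ?_⟩
    rw [hv.bilE_eq]
    rw [← h] at hF'
    have := ht.lt_of_ne h0
    by_contra! hc
    nlinarith

theorem exists_isKer_neg (ha : 0 < a) (hb : 0 < b) (hF : charPoly a b p q r t = 0)
    (ht : (1 + t * a) * (1 - t * b) < 0) (hF' : t * charDeriv a b p q r t < 0) :
    ∃ v, IsKer a b p q r t v ∧ bilE v v < 0 := by
  obtain ⟨v, hv, ⟨h0, -⟩ | ⟨h0, h⟩⟩ := exists_isKer ha hb hF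
  · exact absurd h0 ht.ne
  · refine ⟨v, hv, ?_⟩
    rw [hv.bilE_eq]
    rw [← h] at hF'
    by_contra! hc
    nlinarith

/-- Without double roots of the determinant there is no tangency. -/
theorem contact_of_simple (h : ∀ t, charPoly a b p q r t = 0 → charDeriv a b p q r t ≠ 0) :
    crossSet circleMat (hypMat a b p q r) = commonPts a b p q r ∧
      ∀ S : ℝ → Prop, singSet circleMat (hypMat a b p q r) S = ∅ := by
  constructor
  · ext z
    rw [mem_crossSet, and_iff_left_iff_imp]
    intro hz t ht
    obtain ⟨h1, h2⟩ := double_root_of_isKer hz ht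
    exact h t h1 h2
  · intro S
    rw [Set.eq_empty_iff_forall_notMem]
    intro z hz
    obtain ⟨hz, t, -, ht⟩ := mem_singSet.1 hz
    obtain ⟨h1, h2⟩ := double_root_of_isKer hz ht
    exact h t h1 h2

end

/-! ### A pair of complex roots -/

section

variable {a b p q r : ℝ}

theorem charPoly_coeffs {l e₁ e₂ e₃ : ℝ}
    (h : ∀ t, charPoly a b p q r t = l * (t ^ 3 - e₁ * t ^ 2 + e₂ * t - e₃)) :
    -a * b * r + b * p ^ 2 - a * q ^ 2 = l ∧
      (a - b) * r + a * b - p ^ 2 - q ^ 2 = -l * e₁ ∧ r - a + b = l * e₂ ∧ l * e₃ = 1 := by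
  have h0 := h 0
  have h1 := h 1
  have h2 := h (-1)
  have h3 := h 2
  simp only [charPoly] at h0 h1 h2 h3
  refine ⟨?_, ?_, ?_, ?_⟩ <;> linarith

/-- The real and imaginary parts of a kernel vector at a complex root `s + i w`. -/
theorem exists_complex_kernel {l x s w : ℝ} (ha : a ≠ 0) (hb : b ≠ 0) (hw : w ≠ 0)
    (h : ∀ t, charPoly a b p q r t =
      l * (t ^ 3 - (x + 2 * s) * t ^ 2 + (2 * x * s + (s ^ 2 + w ^ 2)) * t - x * (s ^ 2 + w ^ 2))) :
    ∃ g h : Fin 3 → ℝ, g ≠ 0 ∧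
      (∀ u, s * bilN a b p q r g u + bilE g u = w * bilN a b p q r h u) ∧
      ∀ u, s * bilN a b p q r h u + bilE h u = -w * bilN a b p q r g u := by
  obtain ⟨c3, c2, c1, c0⟩ := charPoly_coeffs h
  set t : ℂ := ⟨s, w⟩ with ht
  have hA : 1 + t * a ≠ 0 := fun h0 => by
    have := congrArg Complex.im h0
    simp [ht] at this
    tauto
  have hB : 1 - t * b ≠ 0 := fun h0 => by
    have := congrArg Complex.im h0
    simp [ht] at this
    tauto
  have ht2 : t ^ 2 - 2 * s * t + (s ^ 2 + w ^ 2) = 0 := by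
    apply Complex.ext <;> simp [ht, pow_two] <;> ring
  have hF : (1 + t * a) * (1 - t * b) * (t * r - 1) - (1 - t * b) * (t * p) ^ 2 -
      (1 + t * a) * (t * q) ^ 2 = 0 := by
    have d3 : -(a : ℂ) * b * r + b * p ^ 2 - a * q ^ 2 = l := by exact_mod_cast c3
    have d2 : ((a : ℂ) - b) * r + a * b - p ^ 2 - q ^ 2 = -l * (x + 2 * s) := by exact_mod_cast c2
    have d1 : (r : ℂ) - a + b = l * (2 * x * s + (s ^ 2 + w ^ 2)) := by exact_mod_cast c1
    have d0 : (l : ℂ) * (x * (s ^ 2 + w ^ 2)) = 1 := by exact_mod_cast c0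
    linear_combination t ^ 3 * d3 + t ^ 2 * d2 + t * d1 + d0 + l * (t - x) * ht2
  obtain ⟨X, hX⟩ : ∃ X : ℂ, (1 + t * a) * X + t * p = 0 :=
    ⟨-(t * p) / (1 + t * a), by field_simp; ring⟩
  obtain ⟨Y, hY⟩ : ∃ Y : ℂ, (1 - t * b) * Y + t * q = 0 :=
    ⟨-(t * q) / (1 - t * b), by field_simp; ring⟩
  have hZ : t * (p * X + q * Y + r) - 1 = 0 := by
    apply mul_left_cancel₀ (mul_ne_zero hA hB)
    linear_combination hF + (1 - t * b) * (t * p) * hX + (1 + t * a) * (t * q) * hY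
  have x1 := congrArg Complex.re hX
  have x2 := congrArg Complex.im hX
  have y1 := congrArg Complex.re hY
  have y2 := congrArg Complex.im hY
  have z1 := congrArg Complex.re hZ
  have z2 := congrArg Complex.im hZ
  simp [ht] at x1 x2 y1 y2 z1 z2
  refine ⟨![X.re, Y.re, 1], ![X.im, Y.im, 0], fun h => ?_, fun u => ?_, fun u => ?_⟩
  · simpa using congrFun h 2
  · simp [bilE, bilN]
    linear_combination u 0 * x1 + u 1 * y1 + u 2 * z1
  · simp [bilE, bilN]
    linear_combination u 0 * x2 + u 1 * y2 + u 2 * z2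

theorem exists_complex_sq (A B : ℝ) : ∃ x y : ℝ, x ^ 2 - y ^ 2 = A ∧ 2 * x * y = B := by
  obtain ⟨z, hz⟩ := IsAlgClosed.exists_pow_nat_eq (⟨A, B⟩ : ℂ) (n := 2) two_pos
  refine ⟨z.re, z.im, ?_, ?_⟩
  · have := congrArg Complex.re hz
    simp [pow_two] at this
    linarith
  · have := congrArg Complex.im hz
    simp [pow_two] at this
    linarith

theorem complex_sq_eq {x y x' y' : ℝ} (h1 : x ^ 2 - y ^ 2 = x' ^ 2 - y' ^ 2)
    (h2 : x * y = x' * y') : ∃ s, x = x' * boolSign s ∧ y = y' * boolSign s := by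
  have h : (⟨x, y⟩ : ℂ) ^ 2 = (⟨x', y'⟩ : ℂ) ^ 2 := by
    apply Complex.ext <;> simp [pow_two] <;> linarith
  rcases sq_eq_sq_iff_eq_or_eq_neg.1 h with h | h
  · refine ⟨true, ?_, ?_⟩
    · simpa [boolSign] using congrArg Complex.re h
    · simpa [boolSign] using congrArg Complex.im h
  · refine ⟨false, ?_, ?_⟩
    · simpa [boolSign] using congrArg Complex.re h
    · simpa [boolSign] using congrArg Complex.im h

theorem eq_zero_of_bilE {v : Fin 3 → ℝ} (h : ∀ u, bilE v u = 0) : v = 0 := by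
  have h0 := h ![1, 0, 0]
  have h1 := h ![0, 1, 0]
  have h2 := h ![0, 0, 1]
  simp [bilE] at h0 h1 h2
  ext i
  fin_cases i <;> simp [h0, h1, h2]

theorem eq_zero_of_sq_add_sq {x y : ℝ} (h : x ^ 2 + y ^ 2 = 0) : x = 0 ∧ y = 0 := by
  constructor <;> nlinarith

/-- The basis formed by the real kernel vector `v` and the real and imaginary parts `g, h` of a
complex one. -/
theorem exists_complex_basis {l x s w : ℝ} (ha : 0 < a) (hb : 0 < b) (hw : w ≠ 0)
    (hF : ∀ t, charPoly a b p q r t =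
      l * (t ^ 3 - (x + 2 * s) * t ^ 2 + (2 * x * s + (s ^ 2 + w ^ 2)) * t - x * (s ^ 2 + w ^ 2))) :
    ∃ (v g h : Fin 3 → ℝ) (n k : ℝ),
      (∀ c y z : ℝ, c • v + y • g + z • h = 0 → c = 0 ∧ y = 0 ∧ z = 0) ∧
      bilN a b p q r v v ≠ 0 ∧ bilE v v = -x * bilN a b p q r v v ∧
      bilN a b p q r v g = 0 ∧ bilN a b p q r v h = 0 ∧ bilE v g = 0 ∧ bilE v h = 0 ∧
      bilN a b p q r g g = n ∧ bilN a b p q r g h = k ∧ bilN a b p q r h h = -n ∧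
      bilE g g = w * k - s * n ∧ bilE h h = -(w * k - s * n) ∧ bilE g h = -w * n - s * k ∧
      n ^ 2 + k ^ 2 ≠ 0 := by
  obtain ⟨c3, c2, c1, c0⟩ := charPoly_coeffs hF
  obtain ⟨g, h, hg0, hg, hh⟩ := exists_complex_kernel ha.ne' hb.ne' hw hF
  have hl : l ≠ 0 := left_ne_zero_of_mul (c0 ▸ one_ne_zero)
  have hx0 : x ≠ 0 := left_ne_zero_of_mul (right_ne_zero_of_mul (c0 ▸ one_ne_zero))
  have hsw : (x - s) ^ 2 + w ^ 2 ≠ 0 := by positivity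
  obtain ⟨v, hv, hv'⟩ := exists_isKer (t := x) ha hb (by rw [hF]; ring)
  have hderiv : charDeriv a b p q r x ≠ 0 := by
    have : charDeriv a b p q r x = l * ((x - s) ^ 2 + w ^ 2) := by
      rw [charDeriv, c3, c2, c1]
      ring
    rw [this]
    exact mul_ne_zero hl hsw
  have hEv := hv.bilE_eq v
  have hNv : bilN a b p q r v v ≠ 0 := by
    intro h0
    rcases hv' with ⟨-, h1⟩ | ⟨-, h1⟩
    · rw [hEv, h0, mul_zero] at h1
      exact lt_irrefl _ h1
    · rw [h0, mul_zero] at h1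
      exact hderiv h1.symm
  -- `v` is conjugate to `g` and `h`
  have hvg1 := hv.bilE_eq g
  have hvh1 := hv.bilE_eq h
  have hgv := hg v
  have hhv := hh v
  rw [bilE_comm g v, bilN_comm g v, bilN_comm h v] at hgv
  rw [bilE_comm h v, bilN_comm g v, bilN_comm h v] at hhv
  have hvg : bilN a b p q r v g = 0 := by
    apply (mul_eq_zero.1 (?_ : ((x - s) ^ 2 + w ^ 2) * _ = 0)).resolve_left hsw
    linear_combination (s - x) * (hgv - hvg1) + w * (hhv - hvh1)
  have hvh : bilN a b p q r v h = 0 := by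
    apply (mul_eq_zero.1 (?_ : w * _ = 0)).resolve_left hw
    linear_combination (s - x) * hvg + hvg1 - hgv
  rw [hvg, mul_zero] at hvg1
  rw [hvh, mul_zero] at hvh1
  have hgg := hg g
  have hgh := hg h
  have hhg := hh g
  have hhh := hh h
  rw [bilE_comm h g, bilN_comm h g] at hhg
  rw [bilN_comm h g] at hgg
  have hNh : bilN a b p q r h h = -bilN a b p q r g g := by
    apply mul_left_cancel₀ hw
    linear_combination hhg - hgh
  have hind : ∀ c y z : ℝ, c • v + y • g + z • h = 0 → c = 0 ∧ y = 0 ∧ z = 0 := by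
    intro c y z h0
    have h1 := bilN_comb_left (a := a) (b := b) (p := p) (q := q) (r := r) c y z v g h v
    have hz : ∀ u, bilN a b p q r 0 u = 0 := fun u => by simp [bilN]
    rw [h0, hz, bilN_comm g v, bilN_comm h v, hvg, hvh] at h1
    have hc : c = 0 := (mul_eq_zero.1 (by linarith)).resolve_right hNv
    rw [hc, zero_smul, zero_add] at h0
    refine ⟨hc, ?_⟩
    -- the complex kernel would be a real line, so that the complex root would be real
    have key : ∀ u, y * bilN a b p q r g u + z * bilN a b p q r h u = 0 := by
      intro u
      have := bilN_comb_left (a := a) (b := b) (p := p) (q := q) (r := r) 0 y z v g h u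
      rw [zero_smul, zero_add, h0, hz] at this
      linarith
    have keyE : ∀ u, y * bilE g u + z * bilE h u = 0 := by
      intro u
      have := bilE_comb_left 0 y z v g h u
      rw [zero_smul, zero_add, h0] at this
      simp only [bilE, Pi.zero_apply] at this ⊢
      linarith
    have key2 : ∀ u, y * bilN a b p q r h u - z * bilN a b p q r g u = 0 := by
      intro u
      apply (mul_eq_zero.1 (?_ : w * _ = 0)).resolve_left hw
      linear_combination s * key u + keyE u - y * hg u - z * hh u
    by_contra hne
    have hyz : y ^ 2 + z ^ 2 ≠ 0 := by
      intro h2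
      exact hne (eq_zero_of_sq_add_sq h2)
    have hNg : ∀ u, bilN a b p q r g u = 0 := by
      intro u
      apply (mul_eq_zero.1 (?_ : (y ^ 2 + z ^ 2) * _ = 0)).resolve_left hyz
      linear_combination y * key u - z * key2 u
    have hNh' : ∀ u, bilN a b p q r h u = 0 := by
      intro u
      apply (mul_eq_zero.1 (?_ : (y ^ 2 + z ^ 2) * _ = 0)).resolve_left hyz
      linear_combination z * key u + y * key2 u
    refine hg0 (eq_zero_of_bilE fun u => ?_)
    have := hg u
    rw [hNg, hNh'] at this
    linarith
  obtain ⟨n, hn⟩ : ∃ n, bilN a b p q r g g = n := ⟨_, rfl⟩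
  obtain ⟨k, hk⟩ : ∃ k, bilN a b p q r g h = k := ⟨_, rfl⟩
  rw [hn] at hNh
  rw [hn, hk] at hgg
  rw [hNh, hk] at hgh hhh
  rw [hn, hk] at hhg
  have hnk : n ^ 2 + k ^ 2 ≠ 0 := by
    intro h0
    obtain ⟨hn0, hk0⟩ := eq_zero_of_sq_add_sq h0
    refine hg0 (eq_zero_of_bilE fun u => ?_)
    obtain ⟨c, y, z, rfl⟩ := exists_coords hind u
    rw [bilE_comm, bilE_comb_left, hvg1, bilE_comm h g]
    have h1 : bilE g g = 0 := by rw [hn0, hk0] at hgg; linarith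
    have h2 : bilE g h = 0 := by rw [hn0, hk0] at hgh; linarith
    rw [h1, h2]
    ring
  exact ⟨v, g, h, n, k, hind, hNv, hEv, hvg, hvh, hvg1, hvh1, hn, hk, hNh, by linarith,
    by linarith, by linarith, hnk⟩

/-- With one real and two complex roots, the conics meet in two points. In the basis formed by the
real kernel vector `v` and the real and imaginary parts `g, h` of a complex one, the equations of
the common points `c v + x g + y h` prescribe the complex number `(x + i y)²` up to the factor
`c²`. -/
theorem encard_commonPts_eq_two {l x s w : ℝ} (ha : 0 < a) (hb : 0 < b) (hw : w ≠ 0)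
    (hF : ∀ t, charPoly a b p q r t =
      l * (t ^ 3 - (x + 2 * s) * t ^ 2 + (2 * x * s + (s ^ 2 + w ^ 2)) * t - x * (s ^ 2 + w ^ 2))) :
    (commonPts a b p q r).encard = 2 := by
  obtain ⟨v, g, h, n, k, hind, hNv, hEv, hvg, hvh, hvg1, hvh1, hn, hk, hNh, e1, e2, e3, hnk⟩ :=
    exists_complex_basis ha hb hw hF
  -- the equations of the common points
  have hcom : ∀ c y z : ℝ,
      (bilE (c • v + y • g + z • h) (c • v + y • g + z • h) = 0 ∧
        bilN a b p q r (c • v + y • g + z • h) (c • v + y • g + z • h) = 0) ↔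
      (n * (y ^ 2 - z ^ 2) + k * (2 * y * z) = -c ^ 2 * bilN a b p q r v v ∧
        w * (k * (y ^ 2 - z ^ 2) - n * (2 * y * z)) = c ^ 2 * (x - s) * bilN a b p q r v v) := by
    intro c y z
    rw [bilE_comb, bilN_comb, hvg, hvh, hvg1, hvh1, hEv, hn, hk, hNh, e1, e2, e3]
    constructor
    · rintro ⟨h1, h2⟩
      exact ⟨by linear_combination h2, by linear_combination h1 + s * h2⟩
    · rintro ⟨h1, h2⟩
      exact ⟨by linear_combination h2 - s * h1, by linear_combination h1⟩
  obtain ⟨y, z, hy, hz⟩ := exists_complex_sq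
    ((-n * bilN a b p q r v v + k * ((x - s) * bilN a b p q r v v / w)) / (n ^ 2 + k ^ 2))
    ((-k * bilN a b p q r v v - n * ((x - s) * bilN a b p q r v v / w)) / (n ^ 2 + k ^ 2))
  have f1 : n * (y ^ 2 - z ^ 2) + k * (2 * y * z) = -bilN a b p q r v v := by
    rw [hy, hz]; field_simp; ring
  have f2 : w * (k * (y ^ 2 - z ^ 2) - n * (2 * y * z)) = (x - s) * bilN a b p q r v v := by
    rw [hy, hz]; field_simp; ring
  have hyz : ¬ (y = 0 ∧ z = 0) := by
    rintro ⟨rfl, rfl⟩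
    apply hNv
    linear_combination f1
  let W : Bool → Fin 3 → ℝ := fun σ => (1 : ℝ) • v + (y * boolSign σ) • g + (z * boolSign σ) • h
  have hW0 : ∀ σ, W σ ≠ 0 := fun σ h => one_ne_zero (hind _ _ _ h).1
  have hWc : ∀ σ, bilE (W σ) (W σ) = 0 ∧ bilN a b p q r (W σ) (W σ) = 0 := by
    intro σ
    have := boolSign_sq σ
    exact (hcom _ _ _).2 ⟨by linear_combination f1 +
        (n * (y ^ 2 - z ^ 2) + k * (2 * y * z)) * this,
      by linear_combination f2 + w * (k * (y ^ 2 - z ^ 2) - n * (2 * y * z)) * this⟩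
  have hrange : commonPts a b p q r = Set.range fun σ => toPt (W σ) := by
    ext P
    constructor
    · intro hP
      rw [mem_commonPts_iff_bil] at hP
      obtain ⟨c, y', z', hc⟩ := exists_coords hind (hom P)
      rw [hc, hcom] at hP
      obtain ⟨h1, h2⟩ := hP
      have k1 : w * (n * (y' ^ 2 - z' ^ 2 - ((c * y) ^ 2 - (c * z) ^ 2)) +
          k * (2 * (y' * z' - (c * y) * (c * z)))) = 0 := by
        linear_combination w * (h1 - c ^ 2 * f1)
      have k2 : w * (k * (y' ^ 2 - z' ^ 2 - ((c * y) ^ 2 - (c * z) ^ 2)) -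
          n * (2 * (y' * z' - (c * y) * (c * z)))) = 0 := by
        linear_combination h2 - c ^ 2 * f2
      have hwnk := mul_ne_zero hw hnk
      obtain ⟨σ, rfl, rfl⟩ := complex_sq_eq (x := y') (y := z') (x' := c * y) (y' := c * z)
        (by apply mul_left_cancel₀ hwnk; linear_combination n * k1 + k * k2)
        (by apply mul_left_cancel₀ hwnk; linear_combination (k * k1 - n * k2) / 2)
      refine ⟨σ, (toPt_eq_of_hom (c := c) ?_).symm⟩
      rw [hc]
      simp only [W, smul_add, smul_smul, mul_one, mul_assoc]
    · rintro ⟨σ, rfl⟩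
      exact toPt_mem_commonPts (hWc σ).1 (hWc σ).2 (hW0 σ)
  have hinj : Function.Injective fun σ => toPt (W σ) := by
    intro σ σ' h0
    have h1 := congrArg hom (show toPt (W σ) = toPt (W σ') from h0)
    rw [hom_toPt (bilE_null (hWc σ).1 (hW0 σ)), hom_toPt (bilE_null (hWc σ').1 (hW0 σ'))] at h1
    have hc := inv_ne_zero (bilE_null (hWc σ).1 (hW0 σ))
    generalize (W σ 2)⁻¹ = c at *
    generalize (W σ' 2)⁻¹ = c' at *
    have h2 : (c - c') • v + (c * (y * boolSign σ) - c' * (y * boolSign σ')) • g +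
        (c * (z * boolSign σ) - c' * (z * boolSign σ')) • h = 0 := by
      have := sub_eq_zero.2 h1
      rw [← this]
      simp only [W]
      module
    obtain ⟨f1, f2, f3⟩ := hind _ _ _ h2
    obtain rfl := sub_eq_zero.1 f1
    rw [← mul_sub, ← mul_sub] at f2 f3
    by_contra hne
    have hs : boolSign σ - boolSign σ' ≠ 0 :=
      sub_ne_zero.2 fun h => hne (boolSign_injective h)
    exact hyz ⟨(mul_eq_zero.1 ((mul_eq_zero.1 f2).resolve_left hc)).resolve_right hs,
      (mul_eq_zero.1 ((mul_eq_zero.1 f3).resolve_left hc)).resolve_right hs⟩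
  rw [hrange, ← Set.image_univ, hinj.encard_image, Set.encard_univ]
  simp

/-! ### The contact of the conics in terms of the roots of the determinant -/

theorem charDeriv_of_roots {l x y z : ℝ} (h : ∀ t, charPoly a b p q r t =
      l * (t ^ 3 - (x + y + z) * t ^ 2 + (x * y + y * z + z * x) * t - x * y * z)) (t : ℝ) :
    charDeriv a b p q r t = l * ((t - x) * (t - y) + (t - y) * (t - z) + (t - z) * (t - x)) := by
  obtain ⟨c3, c2, c1, c0⟩ := charPoly_coeffs h
  rw [charDeriv, c3, c2, c1]
  ring

theorem contact_of_complex {l x s w : ℝ} (ha : 0 < a) (hb : 0 < b) (hw : w ≠ 0)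
    (hF : ∀ t, charPoly a b p q r t =
      l * (t ^ 3 - (x + 2 * s) * t ^ 2 + (2 * x * s + (s ^ 2 + w ^ 2)) * t - x * (s ^ 2 + w ^ 2))) :
    NormalContact a b p q r 2 0 0 := by
  obtain ⟨c3, c2, c1, c0⟩ := charPoly_coeffs hF
  have hl : l ≠ 0 := left_ne_zero_of_mul (c0 ▸ one_ne_zero)
  obtain ⟨h1, h2⟩ := contact_of_simple (a := a) (b := b) (p := p) (q := q) (r := r) (by
    intro t ht ht'
    have hsw : (t - s) ^ 2 + w ^ 2 ≠ 0 := by positivity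
    have e : l * ((t - x) * ((t - s) ^ 2 + w ^ 2)) = 0 := by rw [← ht, hF]; ring
    obtain rfl := sub_eq_zero.1 ((mul_eq_zero.1 ((mul_eq_zero.1 e).resolve_left hl)).resolve_right
      hsw)
    rw [charDeriv, c3, c2, c1] at ht'
    exact mul_ne_zero hl hsw (by linear_combination ht'))
  exact ⟨by rw [h1]; exact encard_commonPts_eq_two ha hb hw hF, by rw [h2, Set.encard_empty],
    by rw [h2, Set.encard_empty]⟩

/-- Distinct roots exclude tangency, so that all common points are points of intersection. -/
theorem contact_of_distinct {l x y z : ℝ} (hxy : x < y) (hyz : y < z)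
    (hF : ∀ t, charPoly a b p q r t =
      l * (t ^ 3 - (x + y + z) * t ^ 2 + (x * y + y * z + z * x) * t - x * y * z))
    (h4 : (commonPts a b p q r).encard = 4) : NormalContact a b p q r 4 0 0 := by
  obtain ⟨c3, c2, c1, c0⟩ := charPoly_coeffs hF
  have hl : l ≠ 0 := left_ne_zero_of_mul (c0 ▸ one_ne_zero)
  obtain ⟨h1, h2⟩ := contact_of_simple (a := a) (b := b) (p := p) (q := q) (r := r) (by
    intro t ht ht'
    rw [charDeriv_of_roots hF] at ht'
    replace ht' := (mul_eq_zero.1 ht').resolve_left hl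
    have e : l * ((t - x) * (t - y) * (t - z)) = 0 := by rw [← ht, hF]; ring
    rcases mul_eq_zero.1 ((mul_eq_zero.1 e).resolve_left hl) with e | e
    · rcases mul_eq_zero.1 e with e | e
      · rw [e] at ht'
        obtain rfl := sub_eq_zero.1 e
        nlinarith
      · rw [e] at ht'
        obtain rfl := sub_eq_zero.1 e
        nlinarith
    · rw [e] at ht'
      obtain rfl := sub_eq_zero.1 e
      nlinarith)
  exact ⟨by rw [h1, h4], by rw [h2, Set.encard_empty], by rw [h2, Set.encard_empty]⟩

/-- Three distinct roots, none to the right of the negative pole: the kernel vector at the middle root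
`y` is the one inside the circle, and `1 / y` lies between `1 / z` and `1 / x`. -/
theorem contact_four_neg {l x y z : ℝ} (ha : 0 < a) (hb : 0 < b) (hl : l < 0) (hxy : x < y)
    (hyz : y < z) (hz : 1 + z * a ≤ 0) (hF : ∀ t, charPoly a b p q r t =
      l * (t ^ 3 - (x + y + z) * t ^ 2 + (x * y + y * z + z * x) * t - x * y * z)) :
    NormalContact a b p q r 4 0 0 := by
  have hz0 : z < 0 := by nlinarith
  have hy : 1 + y * a < 0 := by nlinarith
  have hx : 1 + x * a < 0 := by nlinarith
  have bx : 0 < 1 - x * b := by nlinarith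
  have bY : 0 < 1 - y * b := by nlinarith
  have bz : 0 < 1 - z * b := by nlinarith
  obtain ⟨u, hu, hu'⟩ := exists_isKer_pos (t := x) ha hb (by rw [hF]; ring)
    (by nlinarith) (by
      rw [charDeriv_of_roots hF]
      have : 0 < (-x) * (-l) * ((y - x) * (z - x)) :=
        mul_pos (mul_pos (by linarith) (by linarith)) (mul_pos (by linarith) (by linarith))
      linarith)
  obtain ⟨v, hv, hv'⟩ := exists_isKer_pos (t := z) ha hb (by rw [hF]; ring)
    (by nlinarith) (by
      rw [charDeriv_of_roots hF]
      have : 0 < (-z) * (-l) * ((z - x) * (z - y)) :=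
        mul_pos (mul_pos (by linarith) (by linarith)) (mul_pos (by linarith) (by linarith))
      linarith)
  obtain ⟨w, hw, hw'⟩ := exists_isKer_neg (t := y) ha hb (by rw [hF]; ring)
    (by nlinarith) (by
      rw [charDeriv_of_roots hF]
      have : 0 < (-y) * (-l) * ((y - x) * (z - y)) :=
        mul_pos (mul_pos (by linarith) (by linarith)) (mul_pos (by linarith) (by linarith))
      linarith)
  refine contact_of_distinct hxy hyz hF (encard_commonPts_of_kernels hu hv hw (by linarith)
    (by linarith) (by linarith) hu' hv' hw' (mul_pos ?_ ?_))
  · rw [sub_pos]; exact (inv_lt_inv_of_neg hz0 (by linarith)).2 hyz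
  · rw [sub_pos]; exact (inv_lt_inv_of_neg (by linarith) (by linarith)).2 hxy

/-- Two distinct roots, none to the left of the positive pole: the kernel vector at the greatest root `z` is the one inside
the circle, and `1 / z` lies between `1 / x < 0` and `1 / y`. -/
theorem contact_four_pos {l x y z : ℝ} (ha : 0 < a) (hb : 0 < b) (hl : l < 0)
    (hx : 1 + x * a ≤ 0) (hyz : y < z) (hy : 1 - y * b ≤ 0) (hF : ∀ t, charPoly a b p q r t =
      l * (t ^ 3 - (x + y + z) * t ^ 2 + (x * y + y * z + z * x) * t - x * y * z)) :
    NormalContact a b p q r 4 0 0 := by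
  have hx0 : x < 0 := by nlinarith
  have hy0 : 0 < y := by nlinarith
  have bx : 0 < 1 - x * b := by nlinarith
  have hz : 1 - z * b < 0 := by nlinarith
  have ay : 0 < 1 + y * a := by nlinarith
  have az : 0 < 1 + z * a := by nlinarith
  obtain ⟨u, hu, hu'⟩ := exists_isKer_pos (t := x) ha hb (by rw [hF]; ring)
    (by nlinarith) (by
      rw [charDeriv_of_roots hF]
      have : 0 < (-x) * (-l) * ((y - x) * (z - x)) :=
        mul_pos (mul_pos (by linarith) (by linarith)) (mul_pos (by linarith) (by linarith))
      linarith)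
  obtain ⟨v, hv, hv'⟩ := exists_isKer_pos (t := y) ha hb (by rw [hF]; ring)
    (by nlinarith) (by
      rw [charDeriv_of_roots hF]
      have : 0 < y * (-l) * ((y - x) * (z - y)) :=
        mul_pos (mul_pos (by linarith) (by linarith)) (mul_pos (by linarith) (by linarith))
      linarith)
  obtain ⟨w, hw, hw'⟩ := exists_isKer_neg (t := z) ha hb (by rw [hF]; ring)
    (by nlinarith) (by
      rw [charDeriv_of_roots hF]
      have : 0 < z * (-l) * ((z - x) * (z - y)) :=
        mul_pos (mul_pos (by linarith) (by linarith)) (mul_pos (by linarith) (by linarith))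
      linarith)
  refine contact_of_distinct (by linarith) hyz hF (encard_commonPts_of_kernels hv hu hw
    (by linarith) (by linarith) (by linarith) hv' hu' hw' (mul_pos ?_ ?_))
  · rw [sub_pos]
    exact (inv_lt_zero.2 hx0).trans (inv_pos.2 (by linarith))
  · rw [sub_pos]; exact (inv_lt_inv₀ (by linarith) hy0).2 hyz

/-- At a double root off the poles there is exactly one tangent point, inner or outer according to the
sign of the root. -/
theorem contact_of_double {t : ℝ} (ht : (1 + t * a) * (1 - t * b) ≠ 0)
    (hF : charPoly a b p q r t = 0) (hF' : charDeriv a b p q r t = 0) {c : ℕ∞}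
    (hc : ∀ z ∈ commonPts a b p q r, IsKer a b p q r t (hom z) →
      (crossSet circleMat (hypMat a b p q r)).encard = c) :
    (t < 0 → NormalContact a b p q r c 1 0) ∧ (0 < t → NormalContact a b p q r c 0 1) := by
  classical
  obtain ⟨z, hz, hk⟩ := exists_vertex ht hF hF'
  constructor <;> intro h0 <;> refine ⟨hc z hz hk, ?_, ?_⟩ <;> rw [singSet_eq hz hk ht]
  · rw [if_pos h0]
  · rw [if_neg h0.not_gt]
  · rw [if_neg h0.not_gt]
  · rw [if_pos h0]

theorem contact_double_definite {t : ℝ} (ht : 0 < (1 + t * a) * (1 - t * b))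
    (hF : charPoly a b p q r t = 0) (hF' : charDeriv a b p q r t = 0) :
    (t < 0 → NormalContact a b p q r 0 1 0) ∧ (0 < t → NormalContact a b p q r 0 0 1) :=
  contact_of_double ht.ne' hF hF' fun _ hz hk => by
    rw [crossSet_of_definite hz hk ht, Set.encard_empty]

theorem contact_double_indefinite {t : ℝ} (ht : (1 + t * a) * (1 - t * b) < 0)
    (hF : charPoly a b p q r t = 0) (hF' : charDeriv a b p q r t = 0)
    (hF'' : 3 * (-a * b * r + b * p ^ 2 - a * q ^ 2) * t +
      ((a - b) * r + a * b - p ^ 2 - q ^ 2) ≠ 0) :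
    (t < 0 → NormalContact a b p q r 2 1 0) ∧ (0 < t → NormalContact a b p q r 2 0 1) :=
  contact_of_double ht.ne hF hF' fun _ hz hk => crossSet_of_indefinite hz hk ht hF''

theorem contact_triple {t : ℝ} (ht : (1 + t * a) * (1 - t * b) < 0) (ht0 : t < 0)
    (hF : charPoly a b p q r t = 0) (hF' : charDeriv a b p q r t = 0)
    (hF'' : 3 * (-a * b * r + b * p ^ 2 - a * q ^ 2) * t +
      ((a - b) * r + a * b - p ^ 2 - q ^ 2) = 0) : NormalContact a b p q r 1 1 0 :=
  (contact_of_double ht.ne hF hF' fun _ hz hk => crossSet_of_triple hz hk ht hF'').1 ht0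

theorem contact_neg_pole {t w : ℝ} (ha : 0 < a) (hb : 0 < b) (ht : 1 + t * a = 0)
    (hF : charPoly a b p q r t = 0) (hF' : charDeriv a b p q r t = 0) (hw : w < 0)
    (hw' : (-a * b * r + b * p ^ 2 - a * q ^ 2) * t ^ 2 * w = 1) :
    (w < t → NormalContact a b p q r 0 2 0) ∧ (w = t → NormalContact a b p q r 0 1 0) := by
  obtain ⟨y, hy, hk, h1, h2⟩ := double_root_neg_pole ha hb ht hF hF' hw hw'
  obtain ⟨hc, hS⟩ := contact_of_forall_isKer hk
  have ht0 : t < 0 := by nlinarith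
  constructor <;> intro h <;>
    refine ⟨by rw [hc, Set.encard_empty], ?_, by rw [(hS _).2 ht0.not_gt, Set.encard_empty]⟩ <;>
    rw [(hS _).1 ht0, hy]
  · exact encard_circle_horizontal.1 (h1 h)
  · exact encard_circle_horizontal.2 (h2 h)

theorem contact_pos_pole {t : ℝ} (ha : 0 < a) (hb : 0 < b) (ht : 1 - t * b = 0)
    (hL : -a * b * r + b * p ^ 2 - a * q ^ 2 < 0)
    (hF : charPoly a b p q r t = 0) (hF' : charDeriv a b p q r t = 0) :
    NormalContact a b p q r 0 0 2 := by
  obtain ⟨x, hx, hk, h1⟩ := double_root_pos_pole ha hb ht hL hF hF'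
  obtain ⟨hc, hS⟩ := contact_of_forall_isKer hk
  have ht0 : 0 < t := by nlinarith
  refine ⟨by rw [hc, Set.encard_empty], by rw [(hS _).2 ht0.not_gt, Set.encard_empty], ?_⟩
  rw [(hS _).1 ht0, hx]
  exact encard_circle_vertical h1

end

/-! ### Sign variations and roots -/

theorem signVar_concat_zero (u v w : ℝ) : signVar [u, v, w, 0] = signVar [u, v, w] := by
  simp [signVar, List.filter_cons]

theorem sign_cases (u : ℝ) : (u < 0 ∧ SignType.sign u = -1) ∨ (u = 0 ∧ SignType.sign u = 0) ∨
    (0 < u ∧ SignType.sign u = 1) := by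
  rcases lt_trichotomy u 0 with h | h | h
  · exact Or.inl ⟨h, sign_neg h⟩
  · exact Or.inr (Or.inl ⟨h, by rw [h, sign_zero]⟩)
  · exact Or.inr (Or.inr ⟨h, sign_pos h⟩)

/-- No sign variation: all terms are nonpositive. -/
theorem signVar_eq_zero {l u v w : ℝ} (hl : l < 0) (hu : u ≤ 0) (hv : v ≤ 0) (hw : w ≤ 0) :
    signVar [l, u, v, w] = 0 := by
  rw [signVar]
  simp only [List.map_cons, List.map_nil, sign_neg hl]
  rcases sign_cases u with ⟨h1, e1⟩ | ⟨h1, e1⟩ | ⟨h1, e1⟩ <;>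
  rcases sign_cases v with ⟨h2, e2⟩ | ⟨h2, e2⟩ | ⟨h2, e2⟩ <;>
  rcases sign_cases w with ⟨h3, e3⟩ | ⟨h3, e3⟩ | ⟨h3, e3⟩ <;>
  first
  | (exfalso; linarith)
  | (rw [e1, e2, e3]; decide)

/-- One sign variation. -/
theorem signVar_eq_one {l u v w : ℝ} (hl : l < 0) (hw : 0 ≤ w)
    (h : 0 < u ∨ 0 < v ∨ 0 < w) (h' : 0 < u → 0 ≤ v) :
    signVar [l, u, v, w] = 1 := by
  rw [signVar]
  simp only [List.map_cons, List.map_nil, sign_neg hl]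
  rcases sign_cases u with ⟨h1, e1⟩ | ⟨h1, e1⟩ | ⟨h1, e1⟩ <;>
  rcases sign_cases v with ⟨h2, e2⟩ | ⟨h2, e2⟩ | ⟨h2, e2⟩ <;>
  rcases sign_cases w with ⟨h4, e4⟩ | ⟨h4, e4⟩ | ⟨h4, e4⟩ <;>
  first
  | (rw [e1, e2, e4]; decide)
  | (exfalso; grind)

/-- Two sign variations. -/
theorem signVar_eq_two {l u v w : ℝ} (hl : l < 0) (h : (0 < u ∧ (v < 0 ∨ w < 0)) ∨ (0 < v ∧ w < 0))
    (hw : w ≤ 0) : signVar [l, u, v, w] = 2 := by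
  rw [signVar]
  simp only [List.map_cons, List.map_nil, sign_neg hl]
  rcases sign_cases u with ⟨h1, e1⟩ | ⟨h1, e1⟩ | ⟨h1, e1⟩ <;>
  rcases sign_cases v with ⟨h2, e2⟩ | ⟨h2, e2⟩ | ⟨h2, e2⟩ <;>
  rcases sign_cases w with ⟨h4, e4⟩ | ⟨h4, e4⟩ | ⟨h4, e4⟩ <;>
  first
  | (rw [e1, e2, e4]; decide)
  | (exfalso; grind)

section

variable {l k X Y Z : ℝ}

/-- Descartes' rule for a cubic with real roots `X ≤ Y ≤ Z`, none of them positive. -/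
theorem signVar_roots_zero (hl : l < 0) (hk : 0 < k) (hXY : X ≤ Y) (hYZ : Y ≤ Z) (hZ : Z ≤ 0) :
    signVar [l, -l * k * (X + Y + Z), l * (X * Y + Y * Z + Z * X), -l * (X * Y * Z)] = 0 := by
  have hlk : 0 < -l * k := mul_pos (neg_pos.2 hl) hk
  have hY : Y ≤ 0 := hYZ.trans hZ
  have hX : X ≤ 0 := hXY.trans hY
  refine signVar_eq_zero hl ?_ ?_ ?_
  · exact mul_nonpos_of_nonneg_of_nonpos hlk.le (by linarith)
  · refine mul_nonpos_of_nonpos_of_nonneg hl.le ?_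
    have := mul_nonneg_of_nonpos_of_nonpos hX hY
    have := mul_nonneg_of_nonpos_of_nonpos hY hZ
    have := mul_nonneg_of_nonpos_of_nonpos hZ hX
    linarith
  · refine mul_nonpos_of_nonneg_of_nonpos (by linarith) ?_
    exact mul_nonpos_of_nonneg_of_nonpos (mul_nonneg_of_nonpos_of_nonpos hX hY) hZ

/-- Descartes' rule for a cubic with real roots `X ≤ Y ≤ Z`, one of them positive. -/
theorem signVar_roots_one (hl : l < 0) (hk : 0 < k) (hXY : X ≤ Y) (hY : Y ≤ 0) (hZ : 0 < Z) :
    signVar [l, -l * k * (X + Y + Z), l * (X * Y + Y * Z + Z * X), -l * (X * Y * Z)] = 1 := by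
  have hlk : 0 < -l * k := mul_pos (neg_pos.2 hl) hk
  have hX : X ≤ 0 := hXY.trans hY
  have hXYn : 0 ≤ X * Y := mul_nonneg_of_nonpos_of_nonpos hX hY
  have h3 : 0 ≤ -l * (X * Y * Z) := mul_nonneg (by linarith) (mul_nonneg hXYn hZ.le)
  -- `e₁ ≥ 0` forces `e₂ ≤ X Y - (X + Y)² ≤ 0`
  have h12 : 0 ≤ X + Y + Z → X * Y + Y * Z + Z * X ≤ 0 := by
    intro h
    nlinarith [mul_nonneg h (neg_nonneg.2 (add_nonpos hX hY)), sq_nonneg X, sq_nonneg Y]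
  have hv : 0 < -l * k * (X + Y + Z) → 0 ≤ l * (X * Y + Y * Z + Z * X) := fun h =>
    mul_nonneg_of_nonpos_of_nonpos hl.le (h12 (pos_of_mul_pos_right h hlk.le).le)
  refine signVar_eq_one hl h3 ?_ hv
  rcases hY.lt_or_eq with h | rfl
  · have : 0 < X * Y := mul_pos_of_neg_of_neg (hXY.trans_lt h) h
    exact Or.inr (Or.inr (mul_pos (by linarith) (mul_pos this hZ)))
  · rcases hX.lt_or_eq with h | rfl
    · have := mul_neg_of_pos_of_neg hZ h
      exact Or.inr (Or.inl (mul_pos_of_neg_of_neg hl (by linarith)))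
    · exact Or.inl (mul_pos hlk (by linarith))

/-- Descartes' rule for a cubic with real roots `X ≤ Y ≤ Z`, two of them positive. -/
theorem signVar_roots_two (hl : l < 0) (hk : 0 < k) (hX : X ≤ 0) (hY : 0 < Y) (hYZ : Y ≤ Z) :
    signVar [l, -l * k * (X + Y + Z), l * (X * Y + Y * Z + Z * X), -l * (X * Y * Z)] = 2 := by
  have hlk : 0 < -l * k := mul_pos (neg_pos.2 hl) hk
  have hZ : 0 < Z := hY.trans_le hYZ
  have hYZ' : 0 < Y * Z := mul_pos hY hZ
  rcases hX.lt_or_eq with h | rfl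
  · have h3 : -l * (X * Y * Z) < 0 := by
      refine mul_neg_of_pos_of_neg (neg_pos.2 hl) ?_
      rw [mul_assoc]
      exact mul_neg_of_neg_of_pos h hYZ'
    refine signVar_eq_two hl ?_ h3.le
    rcases lt_or_ge 0 (X + Y + Z) with h1 | h1
    · exact Or.inl ⟨mul_pos hlk h1, Or.inr h3⟩
    · refine Or.inr ⟨mul_pos_of_neg_of_neg hl ?_, h3⟩
      -- `e₁ ≤ 0` forces `e₂ ≤ Y Z - (Y + Z)² < 0`
      nlinarith [mul_nonneg (neg_nonneg.2 h1) (add_pos hY hZ).le, sq_nonneg Y, sq_nonneg Z]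
  · refine signVar_eq_two hl (Or.inl ⟨mul_pos hlk (by linarith), Or.inl ?_⟩) (by simp)
    exact mul_neg_of_neg_of_pos hl (by linarith)

end

/-! ### Roots of a real cubic -/

/-- A real cubic has either a pair of complex roots `s ± i w`, or three real roots. -/
theorem exists_cubic_roots {l₀ l₁ l₂ l₃ : ℝ} (h₀ : l₀ < 0) (h₃ : l₃ < 0) :
    (∃ x s w : ℝ, w ≠ 0 ∧ l₁ = -l₀ * (x + 2 * s) ∧ l₂ = l₀ * (2 * x * s + (s ^ 2 + w ^ 2)) ∧
      l₃ = -l₀ * (x * (s ^ 2 + w ^ 2))) ∨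
    ∃ x y z : ℝ, x ≤ y ∧ y ≤ z ∧ l₁ = -l₀ * (x + y + z) ∧ l₂ = l₀ * (x * y + y * z + z * x) ∧
      l₃ = -l₀ * (x * y * z) := by
  have hne : l₀ ≠ 0 := h₀.ne
  obtain ⟨x, hx⟩ : ∃ x, l₀ * x ^ 3 + l₁ * x ^ 2 + l₂ * x + l₃ = 0 := by
    refine mem_range_of_exists_le_of_exists_ge
      (f := fun x => l₀ * x ^ 3 + l₁ * x ^ 2 + l₂ * x + l₃) (by fun_prop)
      ⟨0, by simpa using h₃.le⟩ ⟨-(1 + (|l₁| + |l₂| + |l₃|) / -l₀), ?_⟩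
    obtain ⟨K, hK⟩ : ∃ K, 1 + (|l₁| + |l₂| + |l₃|) / -l₀ = K := ⟨_, rfl⟩
    have hK1 : 1 ≤ K := by
      rw [← hK, le_add_iff_nonneg_right]
      exact div_nonneg (by positivity) (by linarith)
    have hK2 : |l₁| + |l₂| + |l₃| = -l₀ * (K - 1) := by
      rw [← hK]
      field_simp
      ring
    simp only [hK]
    have h1 := neg_abs_le l₁
    have h2 := le_abs_self l₂
    have h3 := neg_abs_le l₃
    have g1 : 0 ≤ (l₁ + |l₁|) * K ^ 2 := mul_nonneg (by linarith) (by positivity)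
    have g2 : 0 ≤ (|l₂| - l₂) * K := mul_nonneg (by linarith) (by linarith)
    have g3 : 0 ≤ |l₂| * (K * (K - 1)) :=
      mul_nonneg (abs_nonneg _) (mul_nonneg (by linarith) (by linarith))
    have g4 : 0 ≤ |l₃| * (K ^ 2 - 1) := mul_nonneg (abs_nonneg _) (by nlinarith)
    have g5 : 0 ≤ -l₀ * K ^ 2 := mul_nonneg (by linarith) (by positivity)
    have g6 : (|l₁| + |l₂| + |l₃|) * K ^ 2 = -l₀ * (K - 1) * K ^ 2 := by rw [hK2]
    linarith
  -- division by `t - x`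
  obtain ⟨u, hu⟩ : ∃ u, l₁ = l₀ * (u - x) := ⟨l₁ / l₀ + x, by field_simp; ring⟩
  obtain ⟨v, hv⟩ : ∃ v, l₂ = l₀ * (v - x * u) := ⟨l₂ / l₀ + x * u, by field_simp; ring⟩
  have hl₃ : l₃ = -l₀ * (x * v) := by
    rw [hu, hv] at hx
    linear_combination hx
  rcases lt_or_ge (u ^ 2 - 4 * v) 0 with h | h
  · left
    have hs := Real.sq_sqrt (neg_pos.2 h).le
    have hs0 := Real.sqrt_pos.2 (neg_pos.2 h)
    refine ⟨x, -u / 2, √(-(u ^ 2 - 4 * v)) / 2, by positivity, ?_, ?_, ?_⟩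
    · rw [hu]; ring
    · linear_combination hv - l₀ / 4 * hs
    · linear_combination hl₃ + l₀ * x / 4 * hs
  · right
    have hs := Real.sq_sqrt h
    have hs0 := Real.sqrt_nonneg (u ^ 2 - 4 * v)
    obtain ⟨y, z, hyz, h1, h2⟩ : ∃ y z : ℝ, y ≤ z ∧ y + z = -u ∧ y * z = v :=
      ⟨(-u - √(u ^ 2 - 4 * v)) / 2, (-u + √(u ^ 2 - 4 * v)) / 2, by linarith, by ring,
        by linear_combination -hs / 4⟩
    have e1 : l₁ = -l₀ * (x + y + z) := by linear_combination hu + l₀ * h1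
    have e2 : l₂ = l₀ * (x * y + y * z + z * x) := by
      linear_combination hv - l₀ * h2 - l₀ * x * h1
    have e3 : l₃ = -l₀ * (x * y * z) := by linear_combination hl₃ + l₀ * x * h2
    rcases le_total x y with h | h
    · exact ⟨x, y, z, h, hyz, e1, e2, e3⟩
    · rcases le_total x z with h' | h'
      · exact ⟨y, x, z, h, h', by rw [e1]; ring, by rw [e2]; ring, by rw [e3]; ring⟩
      · exact ⟨y, z, x, hyz, h', by rw [e1]; ring, by rw [e2]; ring, by rw [e3]; ring⟩

/-! ### The invariants in terms of the roots -/

/-- What the classification needs to know about the pencil of an ellipse and a hyperbola: its normal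
form has the parameters `a = H₀` and `b = -H₂`, and the same characteristic polynomial up to a
positive factor. -/
theorem exists_pencil_data {M N : Matrix (Fin 3) (Fin 3) ℝ} (hM : IsEllipse M)
    (hN : IsHyperbola N) :
    ∃ p q r D : ℝ, 0 < D ∧
      (∀ t, charPoly (H₀ M N) (-H₂ M N) p q r t =
        D * (L₀ N * t ^ 3 + L₁ M N * t ^ 2 + L₂ M N * t + L₃ M)) ∧
      (∀ c i o, NormalContact (H₀ M N) (-H₂ M N) p q r c i o → HasContact M N c i o) ∧
      (Separated circleMat (hypMat (H₀ M N) (-H₂ M N) p q r) → Separated M N) ∧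
      (Inside circleMat (hypMat (H₀ M N) (-H₂ M N) p q r) → Inside M N) ∧ (solid M).Nonempty := by
  obtain ⟨P, k, p, q, r, h0, h1, h2, hP, hk, hE, hH⟩ := exists_normal_form hM hN
  have hM0 : M.det < 0 := hM.L₃_neg
  have hN0 : N.det < 0 := hN.L₀_neg
  refine ⟨p, q, r, k ^ 3 * P.det ^ 2, by positivity, fun t => ?_, ?_,
    separated_congr h0 h1 h2 hP hk hE hH, inside_congr h0 h1 h2 hP hk hE hH, ?_⟩
  · rw [← det_hypMat, ← hE, ← hH, pencil_congr, det_smul, det_mul, det_mul, det_transpose,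
      det_pencil M N hM0.ne hN0.ne, Fintype.card_fin]
    ring
  · rintro c i o ⟨hc, hi, ho⟩
    rw [hasContact_iff hM.symm hN.symm hM0 hN0, ← crossSet_congr h0 h1 h2 hP hk.ne' hE hH,
      ← singSet_congr h0 h1 h2 hP hk.ne' hE hH, ← singSet_congr h0 h1 h2 hP hk.ne' hE hH]
    exact ⟨hc, hi, ho⟩
  · refine ⟨affMap P (0, 0), ?_⟩
    have h3 := form_congr (A := M) (k := k) h0 h1 h2 (0, 0)
    rw [hE, form_circleMat] at h3
    change form M _ ≤ 0
    by_contra! hc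
    have := mul_pos hk hc
    norm_num at h3
    linarith

section

variable {M N : Matrix (Fin 3) (Fin 3) ℝ}

theorem hasContact_of_disjoint (h : ∀ z, form M z = 0 → form N z ≠ 0) : HasContact M N 0 0 0 := by
  have ht : tangentPoints M N = ∅ :=
    Set.eq_empty_iff_forall_notMem.2 fun z hz => h z hz.1 hz.2.1
  have hc : crossingPoints M N = ∅ :=
    Set.eq_empty_iff_forall_notMem.2 fun z hz => h z hz.1 hz.2.1
  have hi : innerTangentPoints M N = ∅ :=
    Set.eq_empty_iff_forall_notMem.2 fun z hz => h z hz.1.1 hz.1.2.1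
  have ho : outerTangentPoints M N = ∅ :=
    Set.eq_empty_iff_forall_notMem.2 fun z hz => h z hz.1.1 hz.1.2.1
  simp [HasContact, ht, hc, hi, ho]

theorem hasContact_of_separated (h : Separated M N) : HasContact M N 0 0 0 :=
  hasContact_of_disjoint fun z hz hz' => by
    have h1 : z ∈ solid M := show form M z ≤ 0 from hz.le
    have h2 : z ∈ solid N := show form N z ≤ 0 from hz'.le
    exact Set.disjoint_left.1 h h1 h2

theorem hasContact_of_inside (h : Inside M N) : HasContact M N 0 0 0 :=
  hasContact_of_disjoint fun z hz hz' => by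
    have h1 : z ∈ solid M := show form M z ≤ 0 from hz.le
    have h2 : form N z < 0 := h h1
    linarith

theorem not_separated_of_inside (hM : (solid M).Nonempty) (h : Inside M N) : ¬ Separated M N := by
  obtain ⟨z, hz⟩ := hM
  intro hs
  have : form N z < 0 := h hz
  exact Set.disjoint_left.1 hs hz (show form N z ≤ 0 from this.le)

theorem HasContact.iff {c i o c' i' o' : ℕ∞} (h : HasContact M N c i o) :
    HasContact M N c' i' o' ↔ c' = c ∧ i' = i ∧ o' = o := by
  constructor
  · rintro ⟨h1, h2, h3, -⟩
    exact ⟨h1.symm.trans h.1, h2.symm.trans h.2.1, h3.symm.trans h.2.2.1⟩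
  · rintro ⟨rfl, rfl, rfl⟩
    exact h

/-- The condition `J₁ = 0`, when `-1 / H₀` is a root and the two other roots have sum `e` and
product `f`: these roots are equal and negative. -/
theorem J₁_eq_zero_iff (hM : IsEllipse M) (hN : IsHyperbola N) {u e f : ℝ}
    (hu : 1 + H₀ M N * u = 0) (hf : 0 < f) (h₁ : L₁ M N = -L₀ N * (u + e))
    (h₃ : L₃ M = -L₀ N * (u * f)) : J₁ M N = 0 ↔ -2 * √f = e := by
  obtain ⟨ha, h0⟩ := H₀_spec hM.T₁_pos hN.T₂_neg
  obtain ⟨hb, h2⟩ := H₂_spec hM.T₁_pos hN.T₂_neg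
  have hL := hN.L₀_neg
  have hT := hN.T₂_neg
  have hT1 := hM.T₁_pos
  have hab : H₀ M N - H₂ M N ≠ 0 := by linarith
  have hprod : T₁ M * H₀ M N * H₂ M N = T₂ N := by
    apply mul_left_cancel₀ hab
    linear_combination H₂ M N * h0 - H₀ M N * h2
  have e1 : L₃ M * H₅ N / (H₂ M N * T₁ M) = (L₀ N / T₂ N) ^ 2 * f := by
    rw [H₅, h₃]
    have : T₂ N = H₀ M N * (H₂ M N * T₁ M) := by rw [← hprod]; ring
    have hne : H₂ M N * T₁ M ≠ 0 := mul_ne_zero hb.ne hT1.ne'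
    rw [this]
    field_simp
    linear_combination -(L₀ N ^ 2 * (H₂ M N)⁻¹ ^ 2) * hu
  have hpos : 0 < L₀ N / T₂ N := div_pos_of_neg_of_neg hL hT
  have e2 : J₁ M N = L₀ N / T₂ N * (√f + e / 2) := by
    have e3 : (H₀ M N * L₁ M N - L₀ N) / (2 * H₀ M N * L₀ N) = -e / 2 := by
      rw [div_eq_iff (mul_ne_zero (mul_ne_zero two_ne_zero ha.ne') hL.ne), h₁]
      linear_combination -L₀ N * hu
    rw [J₁, e1, Real.sqrt_mul (sq_nonneg _), Real.sqrt_sq hpos.le, H₅, e3]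
    ring
  rw [e2, mul_eq_zero, or_iff_right hpos.ne']
  constructor <;> intro h <;> linarith

end

section

variable {a b p q r : ℝ}

/-- The determinant is nonpositive at the poles `-1 / a` and `1 / b`. -/
theorem roots_poles {l x y z : ℝ} (ha : 0 < a) (hb : 0 < b) (hl : l < 0)
    (hF : ∀ t, charPoly a b p q r t =
      l * (t ^ 3 - (x + y + z) * t ^ 2 + (x * y + y * z + z * x) * t - x * y * z)) :
    (1 + x * a) * (1 + y * a) * (1 + z * a) ≤ 0 ∧
      0 ≤ (1 - x * b) * (1 - y * b) * (1 - z * b) := by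
  constructor
  · obtain ⟨t, ht⟩ : ∃ t, 1 + t * a = 0 := ⟨-a⁻¹, by field_simp; ring⟩
    have h1 := pencil_square (a := a) (b := b) (p := p) (q := q) (r := r) (t := t) (0, 0)
    rw [ht, hF] at h1
    have h2 : 0 < 1 - t * b := by nlinarith
    have h3 := mul_nonneg h2.le (sq_nonneg (t * p))
    have h4 : a ^ 3 * (t ^ 3 - (x + y + z) * t ^ 2 + (x * y + y * z + z * x) * t - x * y * z) =
        -((1 + x * a) * (1 + y * a) * (1 + z * a)) := by
      have : t = -a⁻¹ := by field_simp; linarith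
      rw [this]
      field_simp
      ring
    have h5 : 0 ≤ -l * (a ^ 3 * (t ^ 3 - (x + y + z) * t ^ 2 + (x * y + y * z + z * x) * t -
        x * y * z)) := by
      have := mul_nonneg (pow_pos ha 3).le h3
      linear_combination this - a ^ 3 * h1
    rw [h4] at h5
    have := nonneg_of_mul_nonneg_right h5 (neg_pos.2 hl)
    linarith
  · obtain ⟨t, ht⟩ : ∃ t, 1 - t * b = 0 := ⟨b⁻¹, by field_simp; ring⟩
    have h1 := pencil_square (a := a) (b := b) (p := p) (q := q) (r := r) (t := t) (0, 0)
    rw [ht, hF] at h1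
    have h2 : 0 < 1 + t * a := by nlinarith
    have h3 := mul_nonneg h2.le (sq_nonneg (t * q))
    have h4 : b ^ 3 * (t ^ 3 - (x + y + z) * t ^ 2 + (x * y + y * z + z * x) * t - x * y * z) =
        (1 - x * b) * (1 - y * b) * (1 - z * b) := by
      have : t = b⁻¹ := by field_simp; linarith
      rw [this]
      field_simp
      ring
    have h5 : 0 ≤ -l * (b ^ 3 * (t ^ 3 - (x + y + z) * t ^ 2 + (x * y + y * z + z * x) * t -
        x * y * z)) := by
      have := mul_nonneg (pow_pos hb 3).le h3
      linear_combination this - b ^ 3 * h1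
    rw [h4] at h5
    exact nonneg_of_mul_nonneg_right h5 (neg_pos.2 hl)

/-- The smallest root is at most `-1 / a`; the two other roots have the same sign. -/
theorem roots_location {x y z : ℝ} (ha : 0 < a) (hxy : x ≤ y) (hyz : y ≤ z)
    (h : x * y * z < 0) (hpa : (1 + x * a) * (1 + y * a) * (1 + z * a) ≤ 0) :
    x < 0 ∧ 0 < y * z ∧ 1 + x * a ≤ 0 := by
  have hx : x < 0 := by
    by_contra! hc
    have := mul_nonneg (mul_nonneg hc (hc.trans hxy)) (hc.trans (hxy.trans hyz))
    linarith
  refine ⟨hx, ?_, ?_⟩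
  · by_contra! hc
    have := mul_nonneg_of_nonpos_of_nonpos hx.le hc
    linarith
  · by_contra! hc
    have h1 : 0 < 1 + y * a := by nlinarith
    have h2 : 0 < 1 + z * a := by nlinarith
    have := mul_pos (mul_pos hc h1) h2
    linarith

/-- Between the roots `y < z < 0`, to the right of the negative pole, the pencil contains a positive
definite member `t N + M` with `t < 0`: where `M ≤ 0`, this forces `N < 0`. -/
theorem inside_of_roots {l x y z : ℝ} (ha : 0 < a) (hb : 0 < b) (hl : l < 0) (hxy : x ≤ y)
    (hyz : y < z) (hz : z < 0) (hy : 0 ≤ 1 + y * a) (hF : ∀ t, charPoly a b p q r t =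
      l * (t ^ 3 - (x + y + z) * t ^ 2 + (x * y + y * z + z * x) * t - x * y * z)) :
    Inside circleMat (hypMat a b p q r) := by
  refine inside_of_pos (t := (y + z) / 2) (by nlinarith) (by nlinarith) (by linarith) ?_
  have : 0 < -l * ((y + z) / 2 - x) * ((z - y) / 2) * ((z - y) / 2) :=
    mul_pos (mul_pos (mul_pos (by linarith) (by linarith)) (by linarith)) (by linarith)
  rw [hF]
  linarith

/-- Between the roots `0 < y < z`, to the left of the positive pole, the pencil contains a positive
definite member `t N + M` with `t > 0`: `M` and `N` are nowhere both nonpositive. -/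
theorem separated_of_roots {l x y z : ℝ} (ha : 0 < a) (hb : 0 < b) (hl : l < 0) (hx : x < 0)
    (hy : 0 < y) (hyz : y < z) (hz : 0 ≤ 1 - z * b) (hF : ∀ t, charPoly a b p q r t =
      l * (t ^ 3 - (x + y + z) * t ^ 2 + (x * y + y * z + z * x) * t - x * y * z)) :
    Separated circleMat (hypMat a b p q r) := by
  refine separated_of_pos (t := (y + z) / 2) (by nlinarith) (by nlinarith) (by linarith) ?_
  have : 0 < -l * ((y + z) / 2 - x) * ((z - y) / 2) * ((z - y) / 2) :=
    mul_pos (mul_pos (mul_pos (by linarith) (by linarith)) (by linarith)) (by linarith)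
  rw [hF]
  linarith

end

section

variable {M N : Matrix (Fin 3) (Fin 3) ℝ}

/-- The cubic `F` has the real roots `x ≤ y ≤ z`. -/
structure RealRoots (M N : Matrix (Fin 3) (Fin 3) ℝ) (x y z : ℝ) : Prop where
  le₁ : x ≤ y
  le₂ : y ≤ z
  e₁ : L₁ M N = -L₀ N * (x + y + z)
  e₂ : L₂ M N = L₀ N * (x * y + y * z + z * x)
  e₃ : L₃ M = -L₀ N * (x * y * z)

namespace RealRoots

variable {x y z : ℝ}

theorem prod_neg (h : RealRoots M N x y z) (hM : IsEllipse M) (hN : IsHyperbola N) :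
    x * y * z < 0 := by
  have h3 := hM.L₃_neg
  rw [h.e₃] at h3
  by_contra! hc
  have := mul_nonneg (neg_pos.2 hN.L₀_neg).le hc
  linarith

theorem Δ_eq (h : RealRoots M N x y z) :
    Δ M N = L₀ N ^ 4 * ((x - y) * (y - z) * (z - x)) ^ 2 := by
  rw [Δ, h.e₁, h.e₂, h.e₃]
  ring

theorem Δ'_eq (h : RealRoots M N x y z) :
    Δ' M N = 2 * L₀ N ^ 2 * ((x - y) ^ 2 + (y - z) ^ 2 + (z - x) ^ 2) := by
  rw [Δ', h.e₁, h.e₂]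
  ring

theorem J₅_eq (h : RealRoots M N x y z) : J₅ M N =
    -L₀ N * ((1 + x * H₀ M N) + (1 + y * H₀ M N) + (1 + z * H₀ M N)) := by
  rw [J₅, h.e₁]
  ring

theorem J₄_eq (h : RealRoots M N x y z) : J₄ M N =
    L₀ N * ((1 + x * H₀ M N) * (1 + y * H₀ M N) + (1 + y * H₀ M N) * (1 + z * H₀ M N) +
      (1 + z * H₀ M N) * (1 + x * H₀ M N)) := by
  rw [J₄, h.e₁, h.e₂]
  ring

theorem J₃_eq (h : RealRoots M N x y z) : J₃ M N =
    -L₀ N * ((1 + x * H₀ M N) * (1 + y * H₀ M N) * (1 + z * H₀ M N)) := by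
  rw [J₃, h.e₁, h.e₂, h.e₃]
  ring

theorem K₅_eq (h : RealRoots M N x y z) (hH : H₂ M N < 0) : K₅ M N =
    -L₀ N * (-H₂ M N)⁻¹ * ((x * -H₂ M N - 1) + (y * -H₂ M N - 1) + (z * -H₂ M N - 1)) := by
  have := hH.ne
  rw [K₅, h.e₁]
  field_simp
  ring

theorem K₄_eq (h : RealRoots M N x y z) : K₄ M N =
    L₀ N * ((x * -H₂ M N - 1) * (y * -H₂ M N - 1) + (y * -H₂ M N - 1) * (z * -H₂ M N - 1) +
      (z * -H₂ M N - 1) * (x * -H₂ M N - 1)) := by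
  rw [K₄, h.e₁, h.e₂]
  ring

theorem K₃_eq (h : RealRoots M N x y z) : K₃ M N =
    -L₀ N * ((x * -H₂ M N - 1) * (y * -H₂ M N - 1) * (z * -H₂ M N - 1)) := by
  rw [K₃, h.e₁, h.e₂, h.e₃]
  ring

theorem varF_eq (h : RealRoots M N x y z) : varF M N = signVar [L₀ N, -L₀ N * 1 * (x + y + z),
    L₀ N * (x * y + y * z + z * x), -L₀ N * (x * y * z)] := by
  rw [varF, h.e₁, h.e₂, h.e₃, mul_one]

theorem varJ_eq (h : RealRoots M N x y z) : signVar [L₀ N, J₅ M N, J₄ M N, J₃ M N] =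
    signVar [L₀ N, -L₀ N * 1 * ((1 + x * H₀ M N) + (1 + y * H₀ M N) + (1 + z * H₀ M N)),
      L₀ N * ((1 + x * H₀ M N) * (1 + y * H₀ M N) + (1 + y * H₀ M N) * (1 + z * H₀ M N) +
        (1 + z * H₀ M N) * (1 + x * H₀ M N)),
      -L₀ N * ((1 + x * H₀ M N) * (1 + y * H₀ M N) * (1 + z * H₀ M N))] := by
  rw [h.J₅_eq, h.J₄_eq, h.J₃_eq, mul_one]

theorem varK_eq (h : RealRoots M N x y z) (hH : H₂ M N < 0) :
    signVar [L₀ N, K₅ M N, K₄ M N, K₃ M N] = signVar [L₀ N, -L₀ N * (-H₂ M N)⁻¹ *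
        ((x * -H₂ M N - 1) + (y * -H₂ M N - 1) + (z * -H₂ M N - 1)),
      L₀ N * ((x * -H₂ M N - 1) * (y * -H₂ M N - 1) + (y * -H₂ M N - 1) * (z * -H₂ M N - 1) +
        (z * -H₂ M N - 1) * (x * -H₂ M N - 1)),
      -L₀ N * ((x * -H₂ M N - 1) * (y * -H₂ M N - 1) * (z * -H₂ M N - 1))] := by
  rw [h.K₅_eq hH, h.K₄_eq, h.K₃_eq]

/-- If `-1 / H₀` is a root, then `J₁ = 0` says that the two other roots are equal and negative. -/
theorem J₁_iff (h : RealRoots M N x y z) (hM : IsEllipse M) (hN : IsHyperbola N) {u v w : ℝ}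
    (hu : 1 + u * H₀ M N = 0) (hvw : 0 < v * w) (h1 : x + y + z = u + (v + w))
    (h3 : x * y * z = u * (v * w)) : J₁ M N = 0 ↔ v = w ∧ v < 0 := by
  rw [J₁_eq_zero_iff hM hN (u := u) (by linarith) hvw (by rw [h.e₁, h1]) (by rw [h.e₃, h3])]
  have hs := Real.sq_sqrt hvw.le
  have hs0 := Real.sqrt_pos.2 hvw
  constructor
  · intro he
    have : (v - w) ^ 2 = 0 := by
      linear_combination 4 * hs + (2 * √(v * w) - (v + w)) * he
    have hvw' : v = w := sub_eq_zero.1 ((pow_eq_zero_iff two_ne_zero).1 this)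
    exact ⟨hvw', by linarith⟩
  · rintro ⟨rfl, hv⟩
    rw [Real.sqrt_mul_self_eq_abs, abs_of_neg hv]
    ring

end RealRoots

end

/-! ### The classification, by the position of the roots -/

/-- The eleven equivalences for the pair `M, N`. -/
def Classification (M N : Matrix (Fin 3) (Fin 3) ℝ) : Prop :=
    (Separated M N ↔
      0 < Δ M N ∧ varF M N = 2 ∧ signVar [L₀ N, K₅ M N, K₄ M N, K₃ M N] = 0) ∧
    (HasContact M N 2 0 0 ↔ Δ M N < 0) ∧
    (HasContact M N 0 1 0 ↔
      (Δ M N = 0 ∧ varF M N = 0 ∧ J₃ M N ≠ 0 ∧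
        signVar [L₀ N, J₅ M N, J₄ M N, J₃ M N] = 2) ∨
      (J₃ M N = 0 ∧ J₄ M N = 0 ∧ J₅ M N = 0) ∨
      (J₁ M N = 0 ∧ J₃ M N = 0 ∧ J₄ M N ≠ 0 ∧ 0 < J₅ M N)) ∧
    (HasContact M N 0 2 0 ↔ J₃ M N = 0 ∧ J₄ M N = 0 ∧ J₅ M N < 0) ∧
    (HasContact M N 2 1 0 ↔
      (Δ M N = 0 ∧ Δ' M N ≠ 0 ∧ signVar [L₀ N, J₅ M N, J₄ M N, J₃ M N] = 0 ∧ J₃ M N ≠ 0) ∨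
      (Δ M N = 0 ∧ signVar [L₀ N, J₅ M N, J₄ M N] = 0 ∧ J₃ M N = 0 ∧ J₅ M N < 0 ∧
        J₁ M N = 0)) ∧
    (HasContact M N 0 0 1 ↔
      Δ M N = 0 ∧ varF M N = 2 ∧ signVar [L₀ N, K₅ M N, K₄ M N, K₃ M N] = 0 ∧ K₃ M N ≠ 0) ∧
    (HasContact M N 0 0 2 ↔ K₃ M N = 0 ∧ K₄ M N = 0) ∧
    (HasContact M N 2 0 1 ↔
      Δ M N = 0 ∧ signVar [L₀ N, K₅ M N, K₄ M N, K₃ M N] = 2 ∧ K₃ M N ≠ 0) ∧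
    (HasContact M N 4 0 0 ↔
      (0 < Δ M N ∧ signVar [L₀ N, J₅ M N, J₄ M N, J₃ M N] = 0) ∨
      (0 < Δ M N ∧ 0 < signVar [L₀ N, K₅ M N, K₄ M N, K₃ M N])) ∧
    (Inside M N ↔
      (0 < Δ M N ∧ varF M N = 0 ∧ J₃ M N ≠ 0 ∧
        signVar [L₀ N, J₅ M N, J₄ M N, J₃ M N] = 2) ∨
      (0 < Δ M N ∧ varF M N = 0 ∧ J₃ M N = 0 ∧ J₄ M N ≠ 0 ∧
        0 < signVar [L₀ N, J₅ M N, J₄ M N]) ∨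
      (J₃ M N = 0 ∧ J₄ M N = 0 ∧ 0 < J₅ M N)) ∧
    (HasContact M N 1 1 0 ↔ Δ M N = 0 ∧ Δ' M N = 0 ∧ J₃ M N < 0 ∧ J₅ M N < 0)

section

variable {M N : Matrix (Fin 3) (Fin 3) ℝ}

/-- A pair of complex roots: `Δ < 0`, and the conics meet in two points. -/
theorem classification_of_complex (hM : IsEllipse M) (hN : IsHyperbola N) {x s w : ℝ} (hw : w ≠ 0)
    (e1 : L₁ M N = -L₀ N * (x + 2 * s)) (e2 : L₂ M N = L₀ N * (2 * x * s + (s ^ 2 + w ^ 2)))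
    (e3 : L₃ M = -L₀ N * (x * (s ^ 2 + w ^ 2))) : Classification M N := by
  obtain ⟨p, q, r, D, hD, hchar, hcon, -, -, -⟩ := exists_pencil_data hM hN
  have ha := (H₀_spec hM.T₁_pos hN.T₂_neg).1
  have hH₂ := (H₂_spec hM.T₁_pos hN.T₂_neg).1
  have hb : 0 < -H₂ M N := neg_pos.2 hH₂
  have hL := hN.L₀_neg
  have hl : D * L₀ N < 0 := mul_neg_of_pos_of_neg hD hL
  have hC := hcon 2 0 0 (contact_of_complex (l := D * L₀ N) (x := x) (s := s) (w := w) ha hb hw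
    fun t => by rw [hchar, e1, e2, e3]; ring)
  have hS : ¬ Separated M N := fun h => by simpa using hC.iff.1 (hasContact_of_separated h)
  have hI : ¬ Inside M N := fun h => by simpa using hC.iff.1 (hasContact_of_inside h)
  have hsw : 0 < (x - s) ^ 2 + w ^ 2 := by positivity
  have hΔ : Δ M N < 0 := by
    have : Δ M N = -(4 * L₀ N ^ 4 * w ^ 2 * ((x - s) ^ 2 + w ^ 2) ^ 2) := by
      rw [Δ, e1, e2, e3]; ring
    rw [this, neg_lt_zero]
    have := hL.ne
    positivity
  have hJ3 : J₃ M N = 0 → 1 + x * H₀ M N = 0 := by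
    have : J₃ M N = -L₀ N * ((1 + x * H₀ M N) * ((1 + s * H₀ M N) ^ 2 + (w * H₀ M N) ^ 2)) := by
      rw [J₃, e1, e2, e3]; ring
    rw [this]
    intro h
    have h2 : (1 + s * H₀ M N) ^ 2 + (w * H₀ M N) ^ 2 ≠ 0 := by positivity
    exact (mul_eq_zero.1 ((mul_eq_zero.1 h).resolve_left (neg_ne_zero.2 hL.ne))).resolve_right h2
  have hJ34 : ¬ (J₃ M N = 0 ∧ J₄ M N = 0) := by
    rintro ⟨h3, h4⟩
    have h5 := hJ3 h3
    have : J₄ M N = L₀ N * ((1 + s * H₀ M N) ^ 2 + (w * H₀ M N) ^ 2) := by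
      rw [J₄, e1, e2]
      linear_combination 2 * L₀ N * (1 + s * H₀ M N) * h5
    rw [this] at h4
    exact mul_ne_zero hL.ne (by positivity) h4
  have hJ13 : ¬ (J₁ M N = 0 ∧ J₃ M N = 0) := by
    rintro ⟨h1, h3⟩
    have hf : 0 < s ^ 2 + w ^ 2 := by positivity
    rw [J₁_eq_zero_iff hM hN (u := x) (e := 2 * s) (by linarith [hJ3 h3]) hf (by rw [e1])
      (by rw [e3])] at h1
    have h4 := Real.sq_sqrt hf.le
    have : w ^ 2 = 0 := by
      rw [show √(s ^ 2 + w ^ 2) = -s by linarith] at h4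
      linarith
    exact hw ((pow_eq_zero_iff two_ne_zero).1 this)
  have hK34 : ¬ (K₃ M N = 0 ∧ K₄ M N = 0) := by
    rintro ⟨h3, h4⟩
    have hne : (s * -H₂ M N - 1) ^ 2 + (w * -H₂ M N) ^ 2 ≠ 0 := by
      have : 0 < (w * -H₂ M N) ^ 2 := sq_pos_of_ne_zero (mul_ne_zero hw hb.ne')
      positivity
    have e3' : K₃ M N = -L₀ N * ((x * -H₂ M N - 1) *
        ((s * -H₂ M N - 1) ^ 2 + (w * -H₂ M N) ^ 2)) := by
      rw [K₃, e1, e2, e3]; ring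
    rw [e3'] at h3
    have h5 := (mul_eq_zero.1 ((mul_eq_zero.1 h3).resolve_left
      (neg_ne_zero.2 hL.ne))).resolve_right hne
    have : K₄ M N = L₀ N * ((s * -H₂ M N - 1) ^ 2 + (w * -H₂ M N) ^ 2) := by
      rw [K₄, e1, e2]
      linear_combination 2 * L₀ N * (s * -H₂ M N - 1) * h5
    rw [this] at h4
    exact mul_ne_zero hL.ne hne h4
  -- `hC` decides all statements on contact; only identities between the invariants remain
  simp only [Classification, hC.iff, hS, hI, hΔ, hΔ.ne, hΔ.not_gt]
  simp
  tauto

set_option maxHeartbeats 1600000 in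
/-- Real roots, two of them positive. -/
theorem classification_of_pos (hM : IsEllipse M) (hN : IsHyperbola N) {x y z : ℝ}
    (hR : RealRoots M N x y z) (hz0 : 0 < z) : Classification M N := by
  obtain ⟨p, q, r, D, hD, hchar, hcon, hsep, -, hne⟩ := exists_pencil_data hM hN
  have ha := (H₀_spec hM.T₁_pos hN.T₂_neg).1
  have hH₂ := (H₂_spec hM.T₁_pos hN.T₂_neg).1
  have hb : 0 < -H₂ M N := neg_pos.2 hH₂
  have hL := hN.L₀_neg
  have hl : D * L₀ N < 0 := mul_neg_of_pos_of_neg hD hL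
  have hF : ∀ t, charPoly (H₀ M N) (-H₂ M N) p q r t = (D * L₀ N) *
      (t ^ 3 - (x + y + z) * t ^ 2 + (x * y + y * z + z * x) * t - x * y * z) := fun t => by
    rw [hchar, hR.e₁, hR.e₂, hR.e₃]; ring
  obtain ⟨c3, c2, c1, c0⟩ := charPoly_coeffs hF
  obtain ⟨hpa, hpb⟩ := roots_poles ha hb hl hF
  have hxy := hR.le₁
  have hyz := hR.le₂
  obtain ⟨hx, hyz0, hx'⟩ := roots_location ha hxy hyz (hR.prod_neg hM hN) hpa
  have hΔ := hR.Δ_eq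
  have hΔ' := hR.Δ'_eq
  have hJ4 := hR.J₄_eq
  have hJ3 := hR.J₃_eq
  have hK4 := hR.K₄_eq
  have hK3 := hR.K₃_eq
  have hF' := charDeriv_of_roots hF
  have hvF := hR.varF_eq
  have hvJ := hR.varJ_eq
  have hvK := hR.varK_eq hH₂
  have hJ1 := fun u v w => hR.J₁_iff hM hN (u := u) (v := v) (w := w)
  have hL4 : 0 < L₀ N ^ 4 := by have := hL.ne; positivity
  have hL2 : 0 < L₀ N ^ 2 := by have := hL.ne; positivity
  have hL' : 0 < -L₀ N := neg_pos.2 hL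
  generalize H₀ M N = a at *
  generalize -H₂ M N = b at *
  have hXY : 1 + x * a ≤ 1 + y * a := by linarith [mul_le_mul_of_nonneg_right hxy ha.le]
  have hYZ : 1 + y * a ≤ 1 + z * a := by linarith [mul_le_mul_of_nonneg_right hyz ha.le]
  have hXY' : x * b - 1 ≤ y * b - 1 := by linarith [mul_le_mul_of_nonneg_right hxy hb.le]
  have hYZ' : y * b - 1 ≤ z * b - 1 := by linarith [mul_le_mul_of_nonneg_right hyz hb.le]
  have hxb : x * b - 1 < 0 := by linarith [mul_neg_of_neg_of_pos hx hb]
  have hy0 : 0 < y := pos_of_mul_pos_left hyz0 hz0.le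
  have hY0 : 0 < 1 + y * a := by positivity
  have hZ0 : 0 < 1 + z * a := by positivity
  have vF : varF M N = 2 := hvF.trans (signVar_roots_two hL one_pos hx.le hy0 hyz)
  have vJ : signVar [L₀ N, J₅ M N, J₄ M N, J₃ M N] = 2 :=
    hvJ.trans (signVar_roots_two hL one_pos hx' hY0 hYZ)
  have hJ3' : J₃ M N = 0 → 1 + x * a = 0 := fun h => by
    rw [hJ3] at h
    simpa [hL.ne, hY0.ne', hZ0.ne'] using h
  have hJ34 : ¬ (J₃ M N = 0 ∧ J₄ M N = 0) := by
    rintro ⟨h3, h4⟩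
    rw [hJ4, hJ3' h3] at h4
    simp [hL.ne, hY0.ne', hZ0.ne'] at h4
  have hJ13 : ¬ (J₁ M N = 0 ∧ J₃ M N = 0) := by
    rintro ⟨h1, h3⟩
    have := ((hJ1 x y z (hJ3' h3) hyz0 (by ring) (by ring)).1 h1).2
    linarith
  rcases hyz.lt_or_eq with hyz | rfl
  · have hΔ0 : 0 < Δ M N := by
      rw [hΔ]
      have : (x - y) * (y - z) * (z - x) ≠ 0 := mul_ne_zero
        (mul_ne_zero (by linarith) (by linarith)) (by linarith)
      positivity
    have hYZs : y * b - 1 < z * b - 1 := by linarith [mul_lt_mul_of_pos_right hyz hb]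
    have hK34 : ¬ (K₃ M N = 0 ∧ K₄ M N = 0) := by
      rintro ⟨h3, h4⟩
      rw [hK3] at h3
      rw [hK4] at h4
      simp only [mul_eq_zero, hL'.ne', hL.ne, hxb.ne, false_or] at h3 h4
      rcases h3 with h3 | h3
      · rw [h3] at h4
        have : (z * b - 1) * (x * b - 1) ≠ 0 := mul_ne_zero (by linarith : 0 < z * b - 1).ne' hxb.ne
        exact this (by linarith)
      · rw [h3] at h4
        have : (x * b - 1) * (y * b - 1) ≠ 0 := mul_ne_zero hxb.ne (by linarith : y * b - 1 < 0).ne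
        exact this (by linarith)
    rcases le_or_gt (z * b - 1) 0 with hzb | hzb
    · -- the interval `(y, z)` lies to the left of the positive pole
      have hS := hsep (separated_of_roots ha hb hl hx hy0 hyz (by linarith) hF)
      have hC := hasContact_of_separated hS
      have hI : ¬ Inside M N := fun h => not_separated_of_inside hne h hS
      have vK := hvK.trans (signVar_roots_zero hL (inv_pos.2 hb) hXY' hYZ' hzb)
      simp only [Classification, hC.iff, hS, hI, hΔ0, hΔ0.ne', hΔ0.not_gt, vF, vJ, vK]
      simp
      clear * - hJ34 hJ13 hK34
      tauto
    · -- the determinant is nonpositive at `1 / b`, which therefore is not between `y` and `z`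
      have hyb : 0 ≤ y * b - 1 := by
        by_contra! hc
        have := mul_pos (mul_pos_of_neg_of_neg hxb hc) hzb
        linarith
      have hC := hcon 4 0 0 (contact_four_pos ha hb hl hx' hyz (by linarith) hF)
      have hS : ¬ Separated M N := fun h => by simpa using hC.iff.1 (hasContact_of_separated h)
      have hI : ¬ Inside M N := fun h => by simpa using hC.iff.1 (hasContact_of_inside h)
      have vK : 0 < signVar [L₀ N, K₅ M N, K₄ M N, K₃ M N] := by
        rcases hyb.lt_or_eq with h | h
        · rw [hvK, signVar_roots_two hL (inv_pos.2 hb) hxb.le h hYZ']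
          norm_num
        · rw [hvK, signVar_roots_one hL (inv_pos.2 hb) hXY' h.ge hzb]
          norm_num
      simp only [Classification, hC.iff, hS, hI, hΔ0, hΔ0.ne', hΔ0.not_gt, vF, vJ, vK, vK.ne']
      simp
      clear * - hJ34 hJ13 hK34
      tauto
  · have hΔ0 : Δ M N = 0 := by rw [hΔ]; ring
    have hF0 : charPoly a b p q r y = 0 := by rw [hF]; ring
    have hF0' : charDeriv a b p q r y = 0 := by rw [hF']; ring
    have hΔ0' : Δ' M N ≠ 0 := by
      rw [hΔ']
      have : 0 < (x - y) ^ 2 := sq_pos_of_ne_zero (by linarith)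
      have : 0 < (y - x) ^ 2 := sq_pos_of_ne_zero (by linarith)
      positivity
    rcases lt_trichotomy (y * b - 1) 0 with hyb | hyb | hyb
    · have hC := hcon 0 0 1 ((contact_double_definite (mul_pos hY0 (by linarith)) hF0 hF0').2 hy0)
      have hS : ¬ Separated M N := fun h => by simpa using hC.iff.1 (hasContact_of_separated h)
      have hI : ¬ Inside M N := fun h => by simpa using hC.iff.1 (hasContact_of_inside h)
      have vK := hvK.trans (signVar_roots_zero hL (inv_pos.2 hb) hXY' hYZ' hyb.le)
      have hK3' : K₃ M N ≠ 0 := by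
        rw [hK3]
        exact mul_ne_zero hL'.ne' (mul_ne_zero (mul_ne_zero hxb.ne hyb.ne) hyb.ne)
      simp only [Classification, hC.iff, hS, hI, hΔ0, vF, vJ, vK]
      simp
      clear * - hΔ0' hJ34 hJ13 hK3'
      tauto
    · have hC := hcon 0 0 2 (contact_pos_pole ha hb (by linarith) (by rw [c3]; exact hl) hF0 hF0')
      have hS : ¬ Separated M N := fun h => by simpa using hC.iff.1 (hasContact_of_separated h)
      have hI : ¬ Inside M N := fun h => by simpa using hC.iff.1 (hasContact_of_inside h)
      have hK3' : K₃ M N = 0 := by rw [hK3, hyb]; ring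
      have hK4' : K₄ M N = 0 := by rw [hK4, hyb]; ring
      simp only [Classification, hC.iff, hS, hI, hΔ0, vF, vJ, hK3', hK4']
      simp
      clear * - hΔ0' hJ34 hJ13 hK3' hK4'
      tauto
    · have hC := hcon 2 0 1 ((contact_double_indefinite
        (mul_neg_of_pos_of_neg hY0 (by linarith)) hF0 hF0' (by
          rw [c3, c2]
          have : D * L₀ N * (y - x) ≠ 0 := mul_ne_zero hl.ne (by linarith)
          intro h
          exact this (by linarith))).2 hy0)
      have hS : ¬ Separated M N := fun h => by simpa using hC.iff.1 (hasContact_of_separated h)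
      have hI : ¬ Inside M N := fun h => by simpa using hC.iff.1 (hasContact_of_inside h)
      have vK := hvK.trans (signVar_roots_two hL (inv_pos.2 hb) hxb.le hyb hYZ')
      have hK3' : K₃ M N ≠ 0 := by
        rw [hK3]
        exact mul_ne_zero hL'.ne' (mul_ne_zero (mul_ne_zero hxb.ne hyb.ne') hyb.ne')
      simp only [Classification, hC.iff, hS, hI, hΔ0, vF, vJ, vK]
      simp
      clear * - hΔ0' hJ34 hJ13 hK3'
      tauto

set_option maxHeartbeats 1600000 in
/-- Real roots, all of them negative. -/
theorem classification_of_neg (hM : IsEllipse M) (hN : IsHyperbola N) {x y z : ℝ}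
    (hR : RealRoots M N x y z) (hz0 : z < 0) : Classification M N := by
  obtain ⟨p, q, r, D, hD, hchar, hcon, -, hins, hne⟩ := exists_pencil_data hM hN
  have ha := (H₀_spec hM.T₁_pos hN.T₂_neg).1
  have hH₂ := (H₂_spec hM.T₁_pos hN.T₂_neg).1
  have hb : 0 < -H₂ M N := neg_pos.2 hH₂
  have hL := hN.L₀_neg
  have hl : D * L₀ N < 0 := mul_neg_of_pos_of_neg hD hL
  have hF : ∀ t, charPoly (H₀ M N) (-H₂ M N) p q r t = (D * L₀ N) *
      (t ^ 3 - (x + y + z) * t ^ 2 + (x * y + y * z + z * x) * t - x * y * z) := fun t => by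
    rw [hchar, hR.e₁, hR.e₂, hR.e₃]; ring
  obtain ⟨c3, c2, c1, c0⟩ := charPoly_coeffs hF
  obtain ⟨hpa, -⟩ := roots_poles ha hb hl hF
  have hxy := hR.le₁
  have hyz := hR.le₂
  obtain ⟨-, hyz0, hx'⟩ := roots_location ha hxy hyz (hR.prod_neg hM hN) hpa
  have hΔ := hR.Δ_eq
  have hΔ' := hR.Δ'_eq
  have hJ5 := hR.J₅_eq
  have hJ4 := hR.J₄_eq
  have hJ3 := hR.J₃_eq
  have hK3 := hR.K₃_eq
  have hF' := charDeriv_of_roots hF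
  have hvF := hR.varF_eq
  have hvJ := hR.varJ_eq
  have hvK := hR.varK_eq hH₂
  have hvJ3 : J₃ M N = 0 → signVar [L₀ N, J₅ M N, J₄ M N] =
      signVar [L₀ N, J₅ M N, J₄ M N, J₃ M N] := fun h => by rw [h, signVar_concat_zero]
  have hJ1 := fun u v w => hR.J₁_iff hM hN (u := u) (v := v) (w := w)
  have hL4 : 0 < L₀ N ^ 4 := by have := hL.ne; positivity
  have hL2 : 0 < L₀ N ^ 2 := by have := hL.ne; positivity
  have hL' : 0 < -L₀ N := neg_pos.2 hL
  generalize H₀ M N = a at *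
  generalize -H₂ M N = b at *
  have hXY : 1 + x * a ≤ 1 + y * a := by linarith [mul_le_mul_of_nonneg_right hxy ha.le]
  have hYZ : 1 + y * a ≤ 1 + z * a := by linarith [mul_le_mul_of_nonneg_right hyz ha.le]
  have hXY' : x * b - 1 ≤ y * b - 1 := by linarith [mul_le_mul_of_nonneg_right hxy hb.le]
  have hYZ' : y * b - 1 ≤ z * b - 1 := by linarith [mul_le_mul_of_nonneg_right hyz hb.le]
  have hy0 : y < 0 := hyz.trans_lt hz0
  have hx0 : x < 0 := hxy.trans_lt hy0
  have hxb : x * b - 1 < 0 := by linarith [mul_neg_of_neg_of_pos hx0 hb]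
  have hyb : y * b - 1 < 0 := by linarith [mul_neg_of_neg_of_pos hy0 hb]
  have hzb : z * b - 1 < 0 := by linarith [mul_neg_of_neg_of_pos hz0 hb]
  have vF : varF M N = 0 := hvF.trans (signVar_roots_zero hL one_pos hxy hyz hz0.le)
  have vK : signVar [L₀ N, K₅ M N, K₄ M N, K₃ M N] = 0 :=
    hvK.trans (signVar_roots_zero hL (inv_pos.2 hb) hXY' hYZ' hzb.le)
  have hK3' : K₃ M N ≠ 0 := by
    rw [hK3]
    exact mul_ne_zero hL'.ne' (mul_ne_zero (mul_ne_zero hxb.ne hyb.ne) hzb.ne)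
  have vJ0 : 1 + z * a ≤ 0 → signVar [L₀ N, J₅ M N, J₄ M N, J₃ M N] = 0 := fun h =>
    hvJ.trans (signVar_roots_zero hL one_pos hXY hYZ h)
  have vJ2 : 0 < 1 + y * a → signVar [L₀ N, J₅ M N, J₄ M N, J₃ M N] = 2 := fun h =>
    hvJ.trans (signVar_roots_two hL one_pos hx' h hYZ)
  rcases hxy.lt_or_eq with hxy | rfl <;> rcases hyz.lt_or_eq with hyz | rfl
  · -- three distinct roots
    have hΔ0 : 0 < Δ M N := by
      rw [hΔ]
      have : (x - y) * (y - z) * (z - x) ≠ 0 := mul_ne_zero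
        (mul_ne_zero (by linarith) (by linarith)) (by linarith)
      positivity
    have hXYs : 1 + x * a < 1 + y * a := by linarith [mul_lt_mul_of_pos_right hxy ha]
    have hYZs : 1 + y * a < 1 + z * a := by linarith [mul_lt_mul_of_pos_right hyz ha]
    -- the numbers `1 + x a`, `1 + y a`, `1 + z a` being distinct, at most one vanishes
    have hJ34 : ¬ (J₃ M N = 0 ∧ J₄ M N = 0) := by
      rintro ⟨h3, h4⟩
      rw [hJ3] at h3
      rw [hJ4] at h4
      simp only [mul_eq_zero, hL'.ne', hL.ne, false_or] at h3 h4
      rcases h3 with (h3 | h3) | h3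
      · rw [h3] at h4 hXYs
        exact (mul_pos hXYs (hXYs.trans hYZs)).ne' (by linarith)
      · rw [h3] at h4 hXYs hYZs
        exact (mul_neg_of_pos_of_neg hYZs hXYs).ne (by linarith)
      · rw [h3] at h4 hYZs
        exact (mul_pos_of_neg_of_neg (hXYs.trans hYZs) hYZs).ne' (by linarith)
    have hJ13 : ¬ (J₁ M N = 0 ∧ J₃ M N = 0) := by
      rintro ⟨h1, h3⟩
      rw [hJ3] at h3
      simp only [mul_eq_zero, hL'.ne', false_or] at h3
      rcases h3 with (h3 | h3) | h3
      · exact hyz.ne ((hJ1 x y z h3 (mul_pos_of_neg_of_neg hy0 hz0) (by ring) (by ring)).1 h1).1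
      · exact (hxy.trans hyz).ne
          ((hJ1 y x z h3 (mul_pos_of_neg_of_neg hx0 hz0) (by ring) (by ring)).1 h1).1
      · exact hxy.ne ((hJ1 z x y h3 (mul_pos_of_neg_of_neg hx0 hy0) (by ring) (by ring)).1 h1).1
    rcases le_or_gt (1 + z * a) 0 with hz | hz
    · -- all roots are to the left of the negative pole or at it
      have hC := hcon 4 0 0 (contact_four_neg ha hb hl hxy hyz hz hF)
      have hS : ¬ Separated M N := fun h => by simpa using hC.iff.1 (hasContact_of_separated h)
      have hI : ¬ Inside M N := fun h => by simpa using hC.iff.1 (hasContact_of_inside h)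
      have vJ := vJ0 hz
      have vJ3 : J₃ M N = 0 → signVar [L₀ N, J₅ M N, J₄ M N] = 0 := fun h => (hvJ3 h).trans vJ
      simp only [Classification, hC.iff, hS, hI, hΔ0, hΔ0.ne', hΔ0.not_gt, vF, vJ, vK]
      simp
      clear * - hJ34 hJ13 hK3' vJ3
      grind
    · -- the determinant is nonpositive at `-1 / a`, which therefore is not between `y` and `z`
      have hy : 0 ≤ 1 + y * a := by
        by_contra! hc
        have := mul_pos (mul_pos_of_neg_of_neg (hXYs.trans hc) hc) hz
        linarith
      have hI := hins (inside_of_roots ha hb hl hxy.le hyz hz0 hy hF)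
      have hC := hasContact_of_inside hI
      have hS := not_separated_of_inside hne hI
      rcases hy.lt_or_eq with hy | hy
      · have vJ := vJ2 hy
        have vJ3 : J₃ M N = 0 → signVar [L₀ N, J₅ M N, J₄ M N] = 2 := fun h => (hvJ3 h).trans vJ
        simp only [Classification, hC.iff, hS, hI, hΔ0, hΔ0.ne', hΔ0.not_gt, vF, vJ, vK]
        simp
        clear * - hJ34 hJ13 hK3' vJ3
        grind
      · have hJ3' : J₃ M N = 0 := by rw [hJ3, ← hy]; ring
        have vJ : signVar [L₀ N, J₅ M N, J₄ M N, J₃ M N] = 1 :=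
          hvJ.trans (signVar_roots_one hL one_pos hXY hy.ge hz)
        have vJ3 : signVar [L₀ N, J₅ M N, J₄ M N] = 1 := (hvJ3 hJ3').trans vJ
        have hJ4' : J₄ M N ≠ 0 := fun h => hJ34 ⟨hJ3', h⟩
        have hJ1' : J₁ M N ≠ 0 := fun h => hJ13 ⟨h, hJ3'⟩
        simp only [Classification, hC.iff, hS, hI, hΔ0, hΔ0.ne', hΔ0.not_gt, vF, vK, vJ3,
          hJ3', hJ4', hJ1', hK3', signVar_concat_zero]
        simp [hJ4', hK3']
  · -- double root `y = z`
    have hΔ0 : Δ M N = 0 := by rw [hΔ]; ring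
    have hF0 : charPoly a b p q r y = 0 := by rw [hF]; ring
    have hF0' : charDeriv a b p q r y = 0 := by rw [hF']; ring
    have hΔ0' : Δ' M N ≠ 0 := by
      rw [hΔ']
      have : 0 < (x - y) ^ 2 := sq_pos_of_ne_zero (by linarith)
      have : 0 < (y - x) ^ 2 := sq_pos_of_ne_zero (by linarith)
      positivity
    have hXYs : 1 + x * a < 1 + y * a := by linarith [mul_lt_mul_of_pos_right hxy ha]
    rcases lt_trichotomy (1 + y * a) 0 with hy | hy | hy
    · have hx := hXYs.trans hy
      have hC := hcon 2 1 0 ((contact_double_indefinite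
        (mul_neg_of_neg_of_pos hy (by linarith)) hF0 hF0' (by
          rw [c3, c2]
          have : D * L₀ N * (y - x) ≠ 0 := mul_ne_zero hl.ne (by linarith)
          intro h
          exact this (by linarith))).1 hy0)
      have hS : ¬ Separated M N := fun h => by simpa using hC.iff.1 (hasContact_of_separated h)
      have hI : ¬ Inside M N := fun h => by simpa using hC.iff.1 (hasContact_of_inside h)
      have vJ := vJ0 hy.le
      have hJ3' : J₃ M N ≠ 0 := by
        rw [hJ3]
        exact mul_ne_zero hL'.ne' (mul_ne_zero (mul_ne_zero hx.ne hy.ne) hy.ne)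
      simp only [Classification, hC.iff, hS, hI, hΔ0, hΔ0', vF, vJ, vK]
      simp [hΔ0', hJ3', hK3']
    · have hx : 1 + x * a < 0 := hXYs.trans_eq hy
      have hC := hcon 0 2 0 ((contact_neg_pole ha hb hy hF0 hF0' hx0 (by
        rw [c3]
        linear_combination c0)).1 hxy)
      have hS : ¬ Separated M N := fun h => by simpa using hC.iff.1 (hasContact_of_separated h)
      have hI : ¬ Inside M N := fun h => by simpa using hC.iff.1 (hasContact_of_inside h)
      have vJ := vJ0 hy.le
      have hJ3' : J₃ M N = 0 := by rw [hJ3, hy]; ring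
      have hJ4' : J₄ M N = 0 := by rw [hJ4, hy]; ring
      have hJ5' : J₅ M N < 0 := by
        rw [hJ5, hy]
        exact mul_neg_of_pos_of_neg hL' (by linarith)
      have hJ1' : J₁ M N ≠ 0 := fun h => hxy.ne
        ((hJ1 y x y hy (mul_pos_of_neg_of_neg hx0 hy0) (by ring) (by ring)).1 h).1
      simp only [Classification, hC.iff, hS, hI, hΔ0, hΔ0', vF, vK, hJ3', hJ4', hJ5', hJ5'.ne,
        hJ5'.not_gt, hJ1', hK3']
      simp
    · have hC := hcon 0 1 0 ((contact_double_definite (mul_pos hy (by linarith)) hF0 hF0').1 hy0)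
      have hS : ¬ Separated M N := fun h => by simpa using hC.iff.1 (hasContact_of_separated h)
      have hI : ¬ Inside M N := fun h => by simpa using hC.iff.1 (hasContact_of_inside h)
      have vJ := vJ2 hy
      rcases hx'.lt_or_eq with hx | hx
      · have hJ3' : J₃ M N ≠ 0 := by
          rw [hJ3]
          exact mul_ne_zero hL'.ne' (mul_ne_zero (mul_ne_zero hx.ne hy.ne') hy.ne')
        simp only [Classification, hC.iff, hS, hI, hΔ0, hΔ0', vF, vJ, vK]
        simp [hΔ0', hJ3', hK3']
      · have hJ3' : J₃ M N = 0 := by rw [hJ3, hx]; ring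
        have hJ4' : J₄ M N ≠ 0 := by
          rw [hJ4, hx]
          have := mul_neg_of_neg_of_pos hL (mul_pos hy hy)
          intro h
          linarith
        have hJ5' : 0 < J₅ M N := by
          rw [hJ5, hx]
          exact mul_pos hL' (by linarith)
        have hJ1' : J₁ M N = 0 :=
          (hJ1 x y y hx (mul_pos_of_neg_of_neg hy0 hy0) (by ring) (by ring)).2 ⟨rfl, hy0⟩
        simp only [Classification, hC.iff, hS, hI, hΔ0, hΔ0', vF, vK, hJ3', hJ4', hJ5',
          hJ5'.ne', hJ5'.not_gt, hJ1', hK3']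
        simp [hJ4']
  · -- double root `x = y`
    have hΔ0 : Δ M N = 0 := by rw [hΔ]; ring
    have hF0 : charPoly a b p q r x = 0 := by rw [hF]; ring
    have hF0' : charDeriv a b p q r x = 0 := by rw [hF']; ring
    have hΔ0' : Δ' M N ≠ 0 := by
      rw [hΔ']
      have : 0 < (x - z) ^ 2 := sq_pos_of_ne_zero (by linarith)
      have : 0 < (z - x) ^ 2 := sq_pos_of_ne_zero (by linarith)
      positivity
    have hYZs : 1 + x * a < 1 + z * a := by linarith [mul_lt_mul_of_pos_right hyz ha]
    rcases hx'.lt_or_eq with hx | hx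
    · have hz : 1 + z * a ≤ 0 := by
        by_contra! hc
        have := mul_pos (mul_pos_of_neg_of_neg hx hx) hc
        linarith
      have hC := hcon 2 1 0 ((contact_double_indefinite
        (mul_neg_of_neg_of_pos hx (by linarith)) hF0 hF0' (by
          rw [c3, c2]
          have : D * L₀ N * (z - x) ≠ 0 := mul_ne_zero hl.ne (by linarith)
          intro h
          exact this (by linarith))).1 hx0)
      have hS : ¬ Separated M N := fun h => by simpa using hC.iff.1 (hasContact_of_separated h)
      have hI : ¬ Inside M N := fun h => by simpa using hC.iff.1 (hasContact_of_inside h)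
      have vJ := vJ0 hz
      rcases hz.lt_or_eq with hz | hz
      · have hJ3' : J₃ M N ≠ 0 := by
          rw [hJ3]
          exact mul_ne_zero hL'.ne' (mul_ne_zero (mul_ne_zero hx.ne hx.ne) hz.ne)
        simp only [Classification, hC.iff, hS, hI, hΔ0, hΔ0', vF, vJ, vK]
        simp [hΔ0', hJ3', hK3']
      · have hJ3' : J₃ M N = 0 := by rw [hJ3, hz]; ring
        have vJ3 := (hvJ3 hJ3').trans vJ
        have hJ4' : J₄ M N ≠ 0 := by
          rw [hJ4, hz]
          have := mul_neg_of_neg_of_pos hL (mul_pos_of_neg_of_neg hx hx)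
          intro h
          linarith
        have hJ5' : J₅ M N < 0 := by
          rw [hJ5, hz]
          exact mul_neg_of_pos_of_neg hL' (by linarith)
        have hJ1' : J₁ M N = 0 :=
          (hJ1 z x x hz (mul_pos_of_neg_of_neg hx0 hx0) (by ring) (by ring)).2 ⟨rfl, hx0⟩
        simp only [Classification, hC.iff, hS, hI, hΔ0, hΔ0', vF, vK, vJ3, hJ3', hJ4', hJ5',
          hJ5'.ne, hJ5'.not_gt, hJ1', hK3']
        simp
    · -- the double root is the negative pole, but the determinant is positive between it and `z`
      have hI := hins (inside_of_roots ha hb hl le_rfl hyz hz0 hx.ge hF)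
      have hC := hasContact_of_inside hI
      have hS := not_separated_of_inside hne hI
      have hJ3' : J₃ M N = 0 := by rw [hJ3, hx]; ring
      have hJ4' : J₄ M N = 0 := by rw [hJ4, hx]; ring
      have hJ5' : 0 < J₅ M N := by
        rw [hJ5, hx]
        exact mul_pos hL' (by linarith)
      simp only [Classification, hC.iff, hS, hI, hΔ0, hΔ0', vF, vK, hJ3', hJ4', hJ5',
        hJ5'.ne', hJ5'.not_gt, hK3']
      simp
  · -- triple root
    have hΔ0 : Δ M N = 0 := by rw [hΔ]; ring
    have hΔ0' : Δ' M N = 0 := by rw [hΔ']; ring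
    have hF0 : charPoly a b p q r x = 0 := by rw [hF]; ring
    have hF0' : charDeriv a b p q r x = 0 := by rw [hF']; ring
    have vJ := vJ0 hx'
    rcases hx'.lt_or_eq with hx | hx
    · have hC := hcon 1 1 0 (contact_triple (mul_neg_of_neg_of_pos hx (by linarith)) hx0 hF0 hF0'
        (by rw [c3, c2]; ring))
      have hS : ¬ Separated M N := fun h => by simpa using hC.iff.1 (hasContact_of_separated h)
      have hI : ¬ Inside M N := fun h => by simpa using hC.iff.1 (hasContact_of_inside h)
      have hJ3' : J₃ M N < 0 := by
        rw [hJ3]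
        exact mul_neg_of_pos_of_neg hL' (mul_neg_of_pos_of_neg (mul_pos_of_neg_of_neg hx hx) hx)
      have hJ5' : J₅ M N < 0 := by
        rw [hJ5]
        exact mul_neg_of_pos_of_neg hL' (by linarith)
      simp only [Classification, hC.iff, hS, hI, hΔ0, hΔ0', vF, vJ, vK, hJ3', hJ3'.ne, hJ5', hK3']
      simp
    · have hC := hcon 0 1 0 ((contact_neg_pole ha hb hx hF0 hF0' hx0 (by
        rw [c3]
        linear_combination c0)).2 rfl)
      have hS : ¬ Separated M N := fun h => by simpa using hC.iff.1 (hasContact_of_separated h)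
      have hI : ¬ Inside M N := fun h => by simpa using hC.iff.1 (hasContact_of_inside h)
      have hJ3' : J₃ M N = 0 := by rw [hJ3, hx]; ring
      have hJ4' : J₄ M N = 0 := by rw [hJ4, hx]; ring
      have hJ5' : J₅ M N = 0 := by rw [hJ5, hx]; ring
      simp only [Classification, hC.iff, hS, hI, hΔ0, hΔ0', vF, vK, hJ3', hJ4', hJ5', hK3']
      simp

end

end EllipseHyperbola

theorem mainTheorem3 (M N : Matrix (Fin 3) (Fin 3) ℝ)
    (hM : EllipseHyperbola.IsEllipse M) (hN : EllipseHyperbola.IsHyperbola N) :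
    -- 1. separated
    (Separated M N ↔
      0 < Δ M N ∧ varF M N = 2 ∧ signVar [L₀ N, K₅ M N, K₄ M N, K₃ M N] = 0) ∧
    -- 2. only two points of intersection
    (HasContact M N 2 0 0 ↔ Δ M N < 0) ∧
    -- 3. only an inner tangent point
    (HasContact M N 0 1 0 ↔
      (Δ M N = 0 ∧ varF M N = 0 ∧ J₃ M N ≠ 0 ∧
        signVar [L₀ N, J₅ M N, J₄ M N, J₃ M N] = 2) ∨
      (J₃ M N = 0 ∧ J₄ M N = 0 ∧ J₅ M N = 0) ∨
      (J₁ M N = 0 ∧ J₃ M N = 0 ∧ J₄ M N ≠ 0 ∧ 0 < J₅ M N)) ∧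
    -- 4. only two inner tangent points
    (HasContact M N 0 2 0 ↔ J₃ M N = 0 ∧ J₄ M N = 0 ∧ J₅ M N < 0) ∧
    -- 5. two points of intersection and an inner tangent point
    (HasContact M N 2 1 0 ↔
      (Δ M N = 0 ∧ Δ' M N ≠ 0 ∧ signVar [L₀ N, J₅ M N, J₄ M N, J₃ M N] = 0 ∧ J₃ M N ≠ 0) ∨
      (Δ M N = 0 ∧ signVar [L₀ N, J₅ M N, J₄ M N] = 0 ∧ J₃ M N = 0 ∧ J₅ M N < 0 ∧
        J₁ M N = 0)) ∧
    -- 6. only one outer tangent point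
    (HasContact M N 0 0 1 ↔
      Δ M N = 0 ∧ varF M N = 2 ∧ signVar [L₀ N, K₅ M N, K₄ M N, K₃ M N] = 0 ∧ K₃ M N ≠ 0) ∧
    -- 7. two outer tangent points
    (HasContact M N 0 0 2 ↔ K₃ M N = 0 ∧ K₄ M N = 0) ∧
    -- 8. two points of intersection and an outer tangent point
    (HasContact M N 2 0 1 ↔
      Δ M N = 0 ∧ signVar [L₀ N, K₅ M N, K₄ M N, K₃ M N] = 2 ∧ K₃ M N ≠ 0) ∧
    -- 9. four points of intersection
    (HasContact M N 4 0 0 ↔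
      (0 < Δ M N ∧ signVar [L₀ N, J₅ M N, J₄ M N, J₃ M N] = 0) ∨
      (0 < Δ M N ∧ 0 < signVar [L₀ N, K₅ M N, K₄ M N, K₃ M N])) ∧
    -- 10. the ellipse is inside the hyperbola
    (Inside M N ↔
      (0 < Δ M N ∧ varF M N = 0 ∧ J₃ M N ≠ 0 ∧
        signVar [L₀ N, J₅ M N, J₄ M N, J₃ M N] = 2) ∨
      (0 < Δ M N ∧ varF M N = 0 ∧ J₃ M N = 0 ∧ J₄ M N ≠ 0 ∧
        0 < signVar [L₀ N, J₅ M N, J₄ M N]) ∨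
      (J₃ M N = 0 ∧ J₄ M N = 0 ∧ 0 < J₅ M N)) ∧
    -- 11. only a point of intersection and an inner tangent point
    (HasContact M N 1 1 0 ↔ Δ M N = 0 ∧ Δ' M N = 0 ∧ J₃ M N < 0 ∧ J₅ M N < 0) := by
  rcases exists_cubic_roots hN.L₀_neg hM.L₃_neg (l₁ := L₁ M N) (l₂ := L₂ M N) with
    ⟨x, s, w, hw, e1, e2, e3⟩ | ⟨x, y, z, hxy, hyz, e1, e2, e3⟩
  · exact classification_of_complex hM hN hw e1 e2 e3
  · have hR : RealRoots M N x y z := ⟨hxy, hyz, e1, e2, e3⟩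
    rcases lt_trichotomy z 0 with hz | rfl | hz
    · exact classification_of_neg hM hN hR hz
    · exact absurd (hR.prod_neg hM hN) (by simp)
    · exact classification_of_pos hM hN hR hz
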